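/- **Setting.** Let $N\ge 1$, $N_0,P_s,P_I,d_1,d_2,d_I,\eta>0$, $0<\theta<1$, $\tau\in\mathbb R$, and put $\rho_1=P_s/N_0$, $\rho_I=P_I/N_0$. Let $\mathbf h_1,\mathbf h_I\in\mathbb C^{N\times1}$ and $\mathbf h_2\in\mathbb C^{1\times N}$ be random vectors all of whose $3N$ entries are independent $\mathcal{CN}(0,1)$ variables. A relay with $N$ antennas receives $\mathbf y_r=\sqrt{(1-\theta)P_s/d_1^\tau}\,\mathbf h_1x+\sqrt{(1-\theta)P_I/d_I^\tau}\,\mathbf h_Is_I+\mathbf n_r$ (uncorrelated unit-power symbols $x,s_I$; white noise of power $N_0$ per antenna) and forwards $\mathbf W\mathbf y_r$ over the channel $\mathbf h_2/\sqrt{d_2^{\tau}}$ to a destination with noise power $N_0$. In the MMSE/MRT scheme $\mathbf W=\omega\frac{\mathbf h_2^\dagger}{\|\mathbf h_2\|}\mathbf w_1$ with $\mathbf w_1=\mathbf h_1^\dagger\big(\mathbf h_1\mathbf h_1^\dagger+\mathbf R\big)^{-1}$, $\mathbf R=\mathbf h_I\mathbf h_I^\dagger+\frac{d_I^\tau}{(1-\theta)\rho_I}\mathbf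 I$, and $\omega\ge0$ is determined by the power constraint (conditionally on the channels) $E\|\mathbf W\mathbf y_r\|^2=\eta\theta\big(\frac{P_s}{d_1^\tau}\|\mathbf h_1\|^2+\frac{P_I}{d_I^\tau}\|\mathbf h_I\|^2\big)$. The end-to-end SINR is $$\gamma=\frac{\frac{(1-\theta)P_s}{d_1^\tau d_2^\tau}|\mathbf h_2\mathbf W\mathbf h_1|^2}{\frac{(1-\theta)P_I}{d_I^\tau d_2^\tau}|\mathbf h_2\mathbf W\mathbf h_I|^2+\frac{\|\mathbf h_2\mathbf W\|^2}{d_2^\tau}N_0+N_0},$$ and the ergodic capacity is $C=\frac12E[\log_2(1+\gamma)]$. Put $$\gamma_{I1}=\frac{d_I^\tau\rho_1}{d_1^\tau\rho_I}\mathbf h_1^\dagger\mathbf R^{-1}\mathbf h_1,\qquad \gamma_{I2}=\frac{\eta\theta}{d_2^\tau}\Big(\frac{\rho_1}{d_1^\tau}\|\mathbf h_1\|^2+\frac{\rho_I}{d_I^\tau}\|\mathbf h_I\|^2\Big)\|\mathbf h_2\|^2,\qquad C_{\gamma_{Ii}}=\tfrac12E[\log_2(1+\gamma_{Ii})].$$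 **Special functions.** $\Gamma(a,x)=\int_x^\infty t^{a-1}e^{-t}dt$; $\psi=\Gamma'/\Gamma$; for $z>0$ $$G^{m,n}_{p,q}\Big(z\Big|{a_1,\dots,a_p\atop b_1,\dots,b_q}\Big)=\frac1{2\pi i}\int\frac{\prod_{j\le m}\Gamma(b_j-s)\prod_{j\le n}\Gamma(1-a_j+s)}{\prod_{j>m}\Gamma(1-b_j+s)\prod_{j>n}\Gamma(a_j-s)}z^s\,ds,$$ and, for $x,y>0$, $$G^{1,1,2,1,1}_{1,[1:2],0,[1:2]}\Big({x\atop y}\Big|\,\epsilon;\ c;\,(c_1',c_2');\ -;\ b;\,(b_1',b_2')\Big)=\frac1{(2\pi i)^2}\iint\Gamma(\epsilon+s+t)\,\Gamma(b-s)\Gamma(1-c+s)\,\frac{\Gamma(b_1'-t)\Gamma(1-c_1'+t)\Gamma(1-c_2'+t)}{\Gamma(1-b_2'+t)}\,x^sy^t\,ds\,dt,$$ all along vertical lines separating the poles of the gamma functions in the numerator with argument decreasing in $s$ (resp. $t$) from those with increasing argument. **Theorem.** Suppose $\rho_1/d_1^\tau\ne\rho_I/d_I^\tau$. Then $\log_2(1+\gamma)$,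 $\log_2(1+\gamma_{Ii})$ and $\ln\gamma_{Ii}$ ($i=1,2$) are integrable, and $$C\le C_{\gamma_{I1}}+C_{\gamma_{I2}}-\tfrac12\log_2\big(1+e^{E(\ln\gamma_{I1})}+e^{E(\ln\gamma_{I2})}\big),$$ where $$C_{\gamma_{I1}}=\frac{e^{\frac{d_1^\tau}{(1-\theta)\rho_1}}}{2\ln2}\sum_{k=0}^{N-1}\frac{d_1^{k\tau}\,\Gamma\big(-k,\frac{d_1^\tau}{(1-\theta)\rho_1}\big)}{((1-\theta)\rho_1)^k}-\frac{(1-\theta)^3\rho_I^2\rho_1}{2\ln2\,\Gamma(N)d_I^{2\tau}d_1^\tau}\,G^{1,1,2,1,1}_{1,[1:2],0,[1:2]}\left({\frac{(1-\theta)\rho_1}{d_1^\tau}\atop\frac{(1-\theta)\rho_I}{d_I^\tau}}\middle|\,N+2;\ 0;\,(-2,-1);\ -;\ 0;\,(-1,-2)\right),$$ $$E(\ln\gamma_{I1})=\psi(N)+\ln((1-\theta)\rho_1)-\ln d_1^\tau-\frac{((1-\theta)\rho_I)^2}{d_I^{2\tau}\Gamma(N)}\,G^{1,3}_{3,2}\left(\frac{(1-\theta)\rho_I}{d_I^\tau}\middle|{-N,-2,-1\atop-1,-2}\right),$$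 and, with $\mu_1=d_1^\tau/\rho_1$, $\mu_I=d_I^\tau/\rho_I$, $\kappa=d_2^\tau/(\eta\theta)$, $p_s=\prod_{j=1}^{s-1}(1-N-j)$, $$C_{\gamma_{I2}}=\frac{\mu_1^N\mu_I^N}{2\ln2}\sum_{s=1}^N\frac{p_s}{(N-s)!(s-1)!}\sum_{m=0}^{N-1}\frac{\kappa^{N+1-s}}{m!}\Big[(\mu_I-\mu_1)^{1-N-s}\,g_{s,m}(\kappa\mu_1)+(\mu_1-\mu_I)^{1-N-s}\,g_{s,m}(\kappa\mu_I)\Big],$$ $$g_{s,m}(z)=G^{3,1}_{1,3}\left(z\middle|{s-N-1\atop s-N-1,\ m+s-N-1,\ 0}\right),$$ $$E(\ln\gamma_{I2})=\ln(\eta\theta)-\ln d_2^\tau+\psi(N)+\mu_I^N\sum_{s=1}^N\frac{p_s}{(s-1)!}(\mu_I-\mu_1)^{1-N-s}\mu_1^{s-1}\big(\psi(N-s+1)-\ln\mu_1\big)+\mu_1^N\sum_{s=1}^N\frac{p_s}{(s-1)!}(\mu_1-\mu_I)^{1-N-s}\mu_I^{s-1}\big(\psi(N-s+1)-\ln\mu_I\big).$$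 -/

import Mathlib

open MeasureTheory ProbabilityTheory

/-! ### Special functions -/

namespace SpecialFun

/-- The upper incomplete gamma function `Γ(a, x) = ∫_x^∞ t^(a-1) e^(-t) dt`, for `x > 0` and
any real `a` (non-positive integers included). -/
noncomputable def upperGamma (a x : ℝ) : ℝ :=
  ∫ t in Set.Ioi x, t ^ (a - 1) * Real.exp (-t)

/-- The digamma function `ψ` at a real argument. -/
noncomputable def psi (x : ℝ) : ℝ := (Complex.digamma (x : ℂ)).re

/-- `∏ Γ(x - s)` over the entries `x` of a list. -/
noncomputable def gammaSub (l : List ℝ) (s : ℂ) : ℂ :=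
  (l.map fun x : ℝ => Complex.Gamma ((x : ℂ) - s)).prod

/-- `∏ Γ(1 - x + s)` over the entries `x` of a list. -/
noncomputable def gammaOneSubAdd (l : List ℝ) (s : ℂ) : ℂ :=
  (l.map fun x : ℝ => Complex.Gamma (1 - (x : ℂ) + s)).prod

/-- The Mellin-Barnes kernel of Meijer's `G^{m,n}_{p,q}` with upper parameters `a` (`p` of them)
and lower parameters `b` (`q` of them):
`∏_{j≤m} Γ(b_j - s) ∏_{j≤n} Γ(1 - a_j + s) / (∏_{j>m} Γ(1 - b_j + s) ∏_{j>n} Γ(a_j - s))`. -/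
noncomputable def meijerKernel (m n : ℕ) (a b : List ℝ) (s : ℂ) : ℂ :=
  gammaSub (b.take m) s * gammaOneSubAdd (a.take n) s /
    (gammaOneSubAdd (b.drop m) s * gammaSub (a.drop n) s)

/-- The vertical line `Re s = c` has all poles of `Γ(b_j - s)`, `j ≤ m`, on its right and all
poles of `Γ(1 - a_j + s)`, `j ≤ n`, on its left. -/
def MeijerSeparates (m n : ℕ) (a b : List ℝ) (c : ℝ) : Prop :=
  (∀ x ∈ b.take m, c < x) ∧ ∀ x ∈ a.take n, x - 1 < c

open Classical in
/-- Meijer's function `G^{m,n}_{p,q}(z | a; b) = (1/2πi) ∫_L kernel(s) z^s ds` for real parameters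
and `z > 0`, where `L` is a vertical line separating the two families of poles (by Cauchy's
theorem its choice does not matter; every instance used below admits such a line).
On `s = c + iy` one has `ds/(2πi) = dy/(2π)`. -/
noncomputable def meijerG (m n : ℕ) (a b : List ℝ) (z : ℝ) : ℂ :=
  if h : ∃ c : ℝ, MeijerSeparates m n a b c then
    (1 / (2 * (Real.pi : ℂ))) * ∫ y : ℝ,
      meijerKernel m n a b ((h.choose : ℂ) + (y : ℂ) * Complex.I) *
        (z : ℂ) ^ ((h.choose : ℂ) + (y : ℂ) * Complex.I)
  else 0

/-- The factor coupling the two integration variables in the generalized Meijer function of two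
variables, as a function of `w = s + t`:
`∏_{j≤n} Γ(e_j + w) / (∏_{j>n} Γ(1 - e_j - w) ∏ Γ(d_j + w))`. -/
noncomputable def couplingKernel (n : ℕ) (e d : List ℝ) (w : ℂ) : ℂ :=
  ((e.take n).map fun x : ℝ => Complex.Gamma ((x : ℂ) + w)).prod /
    (((e.drop n).map fun x : ℝ => Complex.Gamma (1 - (x : ℂ) - w)).prod *
      (d.map fun x : ℝ => Complex.Gamma ((x : ℂ) + w)).prod)

/-- The pair of vertical lines `Re s = c.1`, `Re t = c.2` separates the poles in each variable,
and `s + t` stays on the right of the poles of `Γ(e_j + s + t)`, `j ≤ n`. -/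
def BivariateSeparates (n ν₁ ν₂ m₁ m₂ : ℕ) (e g₁ g₂ b₁ b₂ : List ℝ) (c : ℝ × ℝ) : Prop :=
  MeijerSeparates m₁ ν₁ g₁ b₁ c.1 ∧ MeijerSeparates m₂ ν₂ g₂ b₂ c.2 ∧
    ∀ x ∈ e.take n, -x < c.1 + c.2

open Classical in
/-- The generalized Meijer function of two variables
`G^{n,ν₁,ν₂,m₁,m₂}_{p,[t:t'],s,[q:q']}(x, y | e; g₁; g₂; d; b₁; b₂)`, where `p, t, t', s, q, q'` are
the lengths of `e, g₁, g₂, d, b₁, b₂`: the double Mellin-Barnes integral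
`(1/(2πi)²) ∫∫ coupling(s+t) K₁(s) K₂(t) x^s y^t ds dt`, with `K₁`, `K₂` the kernels of
`G^{m₁,ν₁}_{t,q}(· | g₁; b₁)` and `G^{m₂,ν₂}_{t',q'}(· | g₂; b₂)`, along vertical lines that
separate the poles. -/
noncomputable def bivariateMeijerG (n ν₁ ν₂ m₁ m₂ : ℕ) (e g₁ g₂ d b₁ b₂ : List ℝ)
    (x y : ℝ) : ℂ :=
  if h : ∃ c : ℝ × ℝ, BivariateSeparates n ν₁ ν₂ m₁ m₂ e g₁ g₂ b₁ b₂ c then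
    (1 / (2 * (Real.pi : ℂ)) ^ 2) * ∫ u : ℝ × ℝ,
      couplingKernel n e d (((h.choose.1 : ℂ) + (u.1 : ℂ) * Complex.I) +
          ((h.choose.2 : ℂ) + (u.2 : ℂ) * Complex.I)) *
        (meijerKernel m₁ ν₁ g₁ b₁ ((h.choose.1 : ℂ) + (u.1 : ℂ) * Complex.I) *
          (x : ℂ) ^ ((h.choose.1 : ℂ) + (u.1 : ℂ) * Complex.I)) *
        (meijerKernel m₂ ν₂ g₂ b₂ ((h.choose.2 : ℂ) + (u.2 : ℂ) * Complex.I) *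
          (y : ℂ) ^ ((h.choose.2 : ℂ) + (u.2 : ℂ) * Complex.I))
  else 0

/-! With real parameters and positive arguments both Meijer functions are real, so that taking
real parts below loses nothing. -/

open scoped ComplexConjugate

theorem conj_line (c y : ℝ) :
    conj ((c : ℂ) + (y : ℂ) * Complex.I) = (c : ℂ) + ((-y : ℝ) : ℂ) * Complex.I := by
  simp

theorem conj_gammaSub (l : List ℝ) (s : ℂ) : conj (gammaSub l s) = gammaSub l (conj s) := by
  simp [gammaSub, map_list_prod, Function.comp_def, ← Complex.Gamma_conj]

theorem conj_gammaOneSubAdd (l : List ℝ) (s : ℂ) :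
    conj (gammaOneSubAdd l s) = gammaOneSubAdd l (conj s) := by
  simp [gammaOneSubAdd, map_list_prod, Function.comp_def, ← Complex.Gamma_conj]

theorem conj_meijerKernel (m n : ℕ) (a b : List ℝ) (s : ℂ) :
    conj (meijerKernel m n a b s) = meijerKernel m n a b (conj s) := by
  simp only [meijerKernel, map_div₀, map_mul, conj_gammaSub, conj_gammaOneSubAdd]

theorem conj_couplingKernel (n : ℕ) (e d : List ℝ) (w : ℂ) :
    conj (couplingKernel n e d w) = couplingKernel n e d (conj w) := by
  simp [couplingKernel, map_list_prod, Function.comp_def, ← Complex.Gamma_conj]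

theorem conj_pos_cpow {z : ℝ} (hz : 0 < z) (s : ℂ) :
    conj ((z : ℂ) ^ s) = (z : ℂ) ^ conj s := by
  rw [Complex.cpow_conj _ _ (by rw [Complex.arg_ofReal_of_nonneg hz.le]; exact Real.pi_pos.ne),
    Complex.conj_ofReal]

theorem meijerG_im (m n : ℕ) (a b : List ℝ) {z : ℝ} (hz : 0 < z) :
    (meijerG m n a b z).im = 0 := by
  rw [← Complex.conj_eq_iff_im]
  unfold meijerG
  split_ifs with h
  · rw [map_mul, ← integral_conj, ← integral_neg_eq_self]
    congr 1
    · simp [map_ofNat]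
    · refine integral_congr_ae (Filter.Eventually.of_forall fun y => ?_)
      simp only [map_mul, conj_meijerKernel, conj_pos_cpow hz, conj_line, neg_neg]
  · simp

theorem bivariateMeijerG_im (n ν₁ ν₂ m₁ m₂ : ℕ) (e g₁ g₂ d b₁ b₂ : List ℝ) {x y : ℝ}
    (hx : 0 < x) (hy : 0 < y) :
    (bivariateMeijerG n ν₁ ν₂ m₁ m₂ e g₁ g₂ d b₁ b₂ x y).im = 0 := by
  rw [← Complex.conj_eq_iff_im]
  unfold bivariateMeijerG
  split_ifs with h
  · rw [map_mul, ← integral_conj, ← integral_neg_eq_self]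
    congr 1
    · simp [map_ofNat]
    · refine integral_congr_ae (Filter.Eventually.of_forall fun u => ?_)
      simp only [map_mul, conj_couplingKernel, conj_meijerKernel, conj_pos_cpow hx,
        conj_pos_cpow hy]
      simp only [map_add _ ((_ : ℂ) + _) _, conj_line, Prod.fst_neg, Prod.snd_neg, neg_neg]
  · simp

end SpecialFun

/-! ### The relay system -/

/-- The law `CN(0,1)`: independent real and imaginary parts, each `N(0, 1/2)`. -/
noncomputable def stdComplexGaussian : Measure ℂ :=
  ((gaussianReal 0 (1 / 2)).prod (gaussianReal 0 (1 / 2))).map Complex.measurableEquivRealProd.symm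

/-- The deterministic parameters of the energy harvesting relay system: noise power `N₀`, source
power `Ps`, interference power `PI`, distances `d₁` (source-relay), `d₂` (relay-destination),
`dI` (interferer-relay), path loss exponent `τ`, energy conversion efficiency `η` and power
splitting ratio `θ`. -/
structure RelayParams where
  N₀ : ℝ
  Ps : ℝ
  PI : ℝ
  d₁ : ℝ
  d₂ : ℝ
  dI : ℝ
  τ : ℝ
  η : ℝ
  θ : ℝ
  N₀_pos : 0 < N₀
  Ps_pos : 0 < Ps
  PI_pos : 0 < PI
  d₁_pos : 0 < d₁
  d₂_pos : 0 < d₂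
  dI_pos : 0 < dI
  η_pos : 0 < η
  θ_pos : 0 < θ
  θ_lt_one : θ < 1

namespace RelayParams

open Matrix SpecialFun

variable (S : RelayParams) {N : ℕ}

/-- `ρ₁ = Ps / N₀`. -/
noncomputable def ρ₁ : ℝ := S.Ps / S.N₀

/-- `ρI = PI / N₀`. -/
noncomputable def ρI : ℝ := S.PI / S.N₀

/-- `d₁^τ`. -/
noncomputable def D₁ : ℝ := S.d₁ ^ S.τ

/-- `d₂^τ`. -/
noncomputable def D₂ : ℝ := S.d₂ ^ S.τ

/-- `dI^τ`. -/
noncomputable def DI : ℝ := S.dI ^ S.τ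

/-- The squared Frobenius norm of a complex vector. -/
noncomputable def vecSq (v : Fin N → ℂ) : ℝ := ∑ i, ‖v i‖ ^ 2

/-- The squared Frobenius norm of a complex matrix. -/
noncomputable def matSq (W : Matrix (Fin N) (Fin N) ℂ) : ℝ := ∑ i, ∑ j, ‖W i j‖ ^ 2

/-- `R = hI hI† + dI^τ / ((1-θ) ρI) I`. -/
noncomputable def R (hI : Fin N → ℂ) : Matrix (Fin N) (Fin N) ℂ :=
  vecMulVec hI (star hI) + ((S.DI / ((1 - S.θ) * S.ρI) : ℝ) : ℂ) • (1 : Matrix (Fin N) (Fin N) ℂ)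

/-- The MMSE combining row vector
`w₁ = h₁† (h₁ h₁† + hI hI† + dI^τ / ((1-θ) ρI) I)⁻¹`. -/
noncomputable def mmseCombiner (h₁ hI : Fin N → ℂ) : Fin N → ℂ :=
  star h₁ ᵥ* (vecMulVec h₁ (star h₁) + S.R hI)⁻¹

/-- The relay processing direction `(h₂† / ‖h₂‖) w₁` before power normalization. -/
noncomputable def relayDirection (h₁ hI h₂ : Fin N → ℂ) : Matrix (Fin N) (Fin N) ℂ :=
  ((1 / Real.sqrt (vecSq h₂) : ℝ) : ℂ) • vecMulVec (star h₂) (S.mmseCombiner h₁ hI)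

/-- The average power `E‖W y_r‖²` of the processed relay signal given the channels, where
`y_r = √((1-θ)Ps/d₁^τ) h₁ x + √((1-θ)PI/dI^τ) hI s_I + n_r` with uncorrelated unit-power symbols
`x`, `s_I` and white noise `n_r` of power `N₀` per antenna. -/
noncomputable def processedPower (h₁ hI : Fin N → ℂ) (W : Matrix (Fin N) (Fin N) ℂ) : ℝ :=
  (1 - S.θ) * S.Ps / S.D₁ * vecSq (W *ᵥ h₁) + (1 - S.θ) * S.PI / S.DI * vecSq (W *ᵥ hI) +
    S.N₀ * matSq W

/-- The relay transmit power, that is, harvested energy per second-phase duration: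
`P_r = η θ (Ps/d₁^τ ‖h₁‖² + PI/dI^τ ‖hI‖²)`. -/
noncomputable def relayPower (h₁ hI : Fin N → ℂ) : ℝ :=
  S.η * S.θ * (S.Ps / S.D₁ * vecSq h₁ + S.PI / S.DI * vecSq hI)

/-- The relay matrix `W = ω (h₂†/‖h₂‖) w₁` of the MMSE/MRT scheme, with `ω` such that
`E‖W y_r‖² = P_r`. -/
noncomputable def relayMatrix (h₁ hI h₂ : Fin N → ℂ) : Matrix (Fin N) (Fin N) ℂ :=
  ((Real.sqrt (S.relayPower h₁ hI / S.processedPower h₁ hI (S.relayDirection h₁ hI h₂)) : ℝ) : ℂ) •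
    S.relayDirection h₁ hI h₂

/-- The end-to-end SINR with relay matrix `W`; `h₂` is a row vector. -/
noncomputable def endToEndSINR (h₁ hI h₂ : Fin N → ℂ) (W : Matrix (Fin N) (Fin N) ℂ) : ℝ :=
  ((1 - S.θ) * S.Ps / (S.D₁ * S.D₂) * ‖h₂ ⬝ᵥ (W *ᵥ h₁)‖ ^ 2) /
    ((1 - S.θ) * S.PI / (S.DI * S.D₂) * ‖h₂ ⬝ᵥ (W *ᵥ hI)‖ ^ 2 +
      vecSq (h₂ ᵥ* W) / S.D₂ * S.N₀ + S.N₀)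

/-- The end-to-end SINR of the MMSE/MRT scheme. -/
noncomputable def γMMSE (h₁ hI h₂ : Fin N → ℂ) : ℝ :=
  S.endToEndSINR h₁ hI h₂ (S.relayMatrix h₁ hI h₂)

/-- `γ_{I1} = dI^τ ρ₁ / (d₁^τ ρI) h₁† R⁻¹ h₁`; the quadratic form is real, `R` being Hermitian. -/
noncomputable def γ₁ (h₁ hI : Fin N → ℂ) : ℝ :=
  S.DI * S.ρ₁ / (S.D₁ * S.ρI) * (star h₁ ⬝ᵥ ((S.R hI)⁻¹ *ᵥ h₁)).re

/-- `γ_{I2} = (ηθ/d₂^τ) (ρ₁/d₁^τ ‖h₁‖² + ρI/dI^τ ‖hI‖²) ‖h₂‖²`. -/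
noncomputable def γ₂ (h₁ hI h₂ : Fin N → ℂ) : ℝ :=
  S.η * S.θ / S.D₂ * (S.ρ₁ / S.D₁ * vecSq h₁ + S.ρI / S.DI * vecSq hI) * vecSq h₂

/-- The closed form of `C_{γ_{I1}}`. -/
noncomputable def capacityFormula₁ (N : ℕ) : ℝ :=
  Real.exp (S.D₁ / ((1 - S.θ) * S.ρ₁)) / (2 * Real.log 2) *
      ∑ k ∈ Finset.range N,
        S.D₁ ^ k * upperGamma (-(k : ℝ)) (S.D₁ / ((1 - S.θ) * S.ρ₁)) / ((1 - S.θ) * S.ρ₁) ^ k -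
    (1 - S.θ) ^ 3 * S.ρI ^ 2 * S.ρ₁ / (2 * Real.log 2 * Real.Gamma N * S.DI ^ 2 * S.D₁) *
      (bivariateMeijerG 1 1 2 1 1 [(N : ℝ) + 2] [0] [-2, -1] [] [0] [-1, -2]
        ((1 - S.θ) * S.ρ₁ / S.D₁) ((1 - S.θ) * S.ρI / S.DI)).re

/-- The closed form of `E(ln γ_{I1})`. -/
noncomputable def logMeanFormula₁ (N : ℕ) : ℝ :=
  psi N + Real.log ((1 - S.θ) * S.ρ₁) - Real.log S.D₁ -
    ((1 - S.θ) * S.ρI) ^ 2 / (S.DI ^ 2 * Real.Gamma N) *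
      (meijerG 1 3 [-(N : ℝ), -2, -1] [-1, -2] ((1 - S.θ) * S.ρI / S.DI)).re

/-- The coefficient `∏_{j=1}^{s-1} (1 - N - j)`. -/
noncomputable def coeffProd (N s : ℕ) : ℝ := ∏ j ∈ Finset.Icc 1 (s - 1), (1 - (N : ℝ) - (j : ℝ))

/-- The closed form of `C_{γ_{I2}}`. -/
noncomputable def capacityFormula₂ (N : ℕ) : ℝ :=
  S.D₁ ^ N * S.DI ^ N / (S.ρ₁ ^ N * S.ρI ^ N * (2 * Real.log 2)) *
      ∑ s ∈ Finset.Icc 1 N,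
        coeffProd N s / ((Nat.factorial (N - s) : ℝ) * (Nat.factorial (s - 1) : ℝ)) *
          (S.DI / S.ρI - S.D₁ / S.ρ₁) ^ (1 - (N : ℤ) - (s : ℤ)) *
          ∑ m ∈ Finset.range N, 1 / (Nat.factorial m : ℝ) *
            (S.D₂ / (S.η * S.θ)) ^ (N + 1 - s) *
            (meijerG 3 1 [(s : ℝ) - N - 1] [(s : ℝ) - N - 1, (m : ℝ) + s - N - 1, 0]
              (S.D₁ * S.D₂ / (S.η * S.θ * S.ρ₁))).re +
    S.D₁ ^ N * S.DI ^ N / (S.ρ₁ ^ N * S.ρI ^ N * (2 * Real.log 2)) *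
      ∑ s ∈ Finset.Icc 1 N,
        coeffProd N s / ((Nat.factorial (N - s) : ℝ) * (Nat.factorial (s - 1) : ℝ)) *
          (S.D₁ / S.ρ₁ - S.DI / S.ρI) ^ (1 - (N : ℤ) - (s : ℤ)) *
          ∑ m ∈ Finset.range N, 1 / (Nat.factorial m : ℝ) *
            (S.D₂ / (S.η * S.θ)) ^ (N + 1 - s) *
            (meijerG 3 1 [(s : ℝ) - N - 1] [(s : ℝ) - N - 1, (m : ℝ) + s - N - 1, 0]
              (S.D₂ * S.DI / (S.η * S.θ * S.ρI))).re

/-- The closed form of `E(ln γ_{I2})`. -/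
noncomputable def logMeanFormula₂ (N : ℕ) : ℝ :=
  Real.log (S.η * S.θ) - Real.log S.D₂ + psi N +
    S.DI ^ N / S.ρI ^ N *
      ∑ s ∈ Finset.Icc 1 N,
        coeffProd N s / (Nat.factorial (s - 1) : ℝ) *
          (S.DI / S.ρI - S.D₁ / S.ρ₁) ^ (1 - (N : ℤ) - (s : ℤ)) *
          (S.ρ₁ / S.D₁) ^ (1 - (s : ℤ)) *
          (psi ((N : ℝ) - s + 1) + Real.log S.ρ₁ - Real.log S.D₁) +
    S.D₁ ^ N / S.ρ₁ ^ N *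
      ∑ s ∈ Finset.Icc 1 N,
        coeffProd N s / (Nat.factorial (s - 1) : ℝ) *
          (S.D₁ / S.ρ₁ - S.DI / S.ρI) ^ (1 - (N : ℤ) - (s : ℤ)) *
          (S.ρI / S.DI) ^ (1 - (s : ℤ)) *
          (psi ((N : ℝ) - s + 1) + Real.log S.ρI - Real.log S.DI)

end RelayParams

/-- The ergodic capacity `½ E[log₂(1 + γ)]` of a half-duplex two-slot link with random SINR `γ`. -/
noncomputable def ergodicCapacity {Ω : Type*} [MeasurableSpace Ω] (μ : Measure Ω) (γ : Ω → ℝ) : ℝ :=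
  1 / 2 * ∫ ω, Real.logb 2 (1 + γ ω) ∂μ

/-! The MMSE direction makes the two-hop SINR collapse. With p = R⁻¹h₁, the interference plus noise
power behind the combiner is proportional to p†Rp = h₁†R⁻¹h₁, the same quadratic form that governs
the signal. Hence γ = γ₁γ₂/(1 + γ₁ + γ₂) (`γMMSE_eq`), that is, 1 + γ = (1 + γ₁)(1 + γ₂)/(1 + γ₁ +
γ₂). Taking logarithms and means, the first two factors give the two capacities exactly. The third
is bounded by Jensen's inequality for the convex function ln(1 + eˣ + eʸ) at (ln γ₁, ln γ₂). The
dependence of γ₁ and γ₂ through h₁ and hI plays no role. It remains to compute four means.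

First hop. By Sherman-Morrison, γ₁ is a constant times the residual power T = ‖h₁‖² - b|hI†h₁|²/(1 +
b‖hI‖²). Unitary invariance of the Gaussian law lets hI be rotated onto a coordinate axis, so given
hI the law of T is that of |h₀|²/(1 + b‖hI‖²) plus an independent Erlang variable
(`map_residual_gaussVec`). Averaging gives the explicit tail of T: the Erlang tail minus the Erlang
density times bx/(1 + bx) (`measure_residualPower_gt`). The layer cake formula turns this tail into
E ln(1 + aT), and a limit of such means gives E ln T.

Second hop. γ₂ is a product of independent variables: the total received power, a sum of two Erlang
variables of different rates, and ‖h₂‖². Partial fractions write the density of the sum as a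
combination of Erlang densities (`integral_conv_erlang`), so only integrals against single Erlang
laws remain.

Special functions. Each Meijer function contains, after a shift of the contour, the kernel Γ(-s)Γ(1
+ s), which represents 1/(1 + x). The remaining gamma factors are written as Euler integrals and
Fubini's theorem is applied; the result is a real integral over a half line or a quadrant, the form
produced by the probabilistic computation. Digamma values are means of logarithms of Erlang
variables, and incomplete gamma values are Stieltjes transforms of Erlang densities. -/

namespace MellinBarnes

/-! ### Mellin-Barnes representation of 1/(1 + x) -/

open Complex Set Filter Topology

/-- The point `σ + i y` of the vertical line `Re s = σ`. -/
noncomputable def linePt (σ y : ℝ) : ℂ := (σ : ℂ) + (y : ℂ) * I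

@[simp] lemma linePt_re (σ y : ℝ) : (linePt σ y).re = σ := by simp [linePt]

@[fun_prop] lemma continuous_linePt (σ : ℝ) : Continuous (linePt σ) := by
  unfold linePt; fun_prop

/-- The reflection kernel `Γ(-s) Γ(1 + s)` on the line `Re s = σ`. -/
noncomputable def reflKernel (σ y : ℝ) : ℂ :=
  Complex.Gamma (-linePt σ y) * Complex.Gamma (1 + linePt σ y)

lemma sin_mul_cosh_le_norm_sin (a b : ℝ) (ha : 0 ≤ Real.sin a) :
    Real.sin a * Real.cosh b ≤ ‖Complex.sin (a + b * I)‖ := by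
  have h : (Complex.sin (a + b * I)).re = Real.sin a * Real.cosh b := by
    rw [Complex.sin_add_mul_I, ← Complex.ofReal_sin, ← Complex.ofReal_cos, ← Complex.ofReal_cosh,
      ← Complex.ofReal_sinh, ← Complex.ofReal_mul, ← Complex.ofReal_mul, Complex.add_re,
      Complex.re_ofReal_mul, Complex.ofReal_re]
    simp
  calc _ = |(Complex.sin (a + b * I)).re| := by
        rw [h, abs_of_nonneg (mul_nonneg ha (Real.cosh_pos b).le)]
    _ ≤ _ := Complex.abs_re_le_norm _

lemma reflKernel_eq (σ y : ℝ) :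
    reflKernel σ y = (Real.pi : ℂ) /
      Complex.sin (((Real.pi * (-σ) : ℝ) : ℂ) + ((-(Real.pi * y) : ℝ) : ℂ) * I) := by
  have := Complex.Gamma_mul_Gamma_one_sub (-linePt σ y)
  rw [reflKernel, show (1 : ℂ) + linePt σ y = 1 - -linePt σ y by ring, this]
  congr 2
  simp only [linePt]; push_cast; ring

lemma sin_pos_of_mem {σ : ℝ} (h1 : -1 < σ) (h0 : σ < 0) : 0 < Real.sin (Real.pi * (-σ)) :=
  Real.sin_pos_of_pos_of_lt_pi (by nlinarith [Real.pi_pos]) (by nlinarith [Real.pi_pos])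

lemma continuous_reflKernel {σ : ℝ} (h1 : -1 < σ) (h0 : σ < 0) : Continuous (reflKernel σ) := by
  simp only [funext (reflKernel_eq σ)]
  refine Continuous.div (by fun_prop) (by fun_prop) fun y hy => ?_
  have := sin_mul_cosh_le_norm_sin (Real.pi * (-σ)) (-(Real.pi * y)) (sin_pos_of_mem h1 h0).le
  rw [hy, norm_zero] at this
  have h2 := mul_pos (sin_pos_of_mem h1 h0) (Real.cosh_pos (-(Real.pi * y)))
  linarith

/-- By Euler's reflection formula the kernel is π over a sine, and |sin(a + ib)| ≥ sin a cosh b. The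
true decay rate π is weakened to 1, which suffices for integrability. -/
lemma norm_reflKernel_le {σ : ℝ} (h1 : -1 < σ) (h0 : σ < 0) (y : ℝ) :
    ‖reflKernel σ y‖ ≤ 2 * Real.pi / Real.sin (Real.pi * (-σ)) * Real.exp (-|y|) := by
  have hs := sin_pos_of_mem h1 h0
  have hb := sin_mul_cosh_le_norm_sin (Real.pi * (-σ)) (-(Real.pi * y)) hs.le
  have hc : Real.exp |y| / 2 ≤ Real.cosh (-(Real.pi * y)) := by
    rw [← Real.cosh_abs, Real.cosh_eq]
    have h3 : |y| ≤ |-(Real.pi * y)| := by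
      rw [abs_neg, abs_mul, abs_of_pos Real.pi_pos]
      nlinarith [abs_nonneg y, Real.pi_gt_three]
    have := Real.exp_le_exp.2 h3
    have := Real.exp_pos (-|-(Real.pi * y)|)
    linarith
  rw [reflKernel_eq, norm_div, Complex.norm_of_nonneg Real.pi_pos.le]
  have hpos : 0 < Real.sin (Real.pi * (-σ)) * (Real.exp |y| / 2) := by positivity
  calc _ ≤ Real.pi / (Real.sin (Real.pi * (-σ)) * (Real.exp |y| / 2)) := by
        refine div_le_div_of_nonneg_left Real.pi_pos.le hpos (le_trans ?_ hb)
        exact mul_le_mul_of_nonneg_left hc hs.le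
    _ = _ := by rw [Real.exp_neg]; field_simp

lemma integrable_exp_neg_abs : Integrable fun y : ℝ => Real.exp (-|y|) := by
  have h : IntegrableOn (fun y : ℝ => Real.exp (-|y|)) (Ioi 0) :=
    (integrableOn_exp_neg_Ioi 0).congr_fun (fun y hy => by simp [abs_of_pos (mem_Ioi.1 hy)])
      measurableSet_Ioi
  have h' : IntegrableOn (fun y : ℝ => Real.exp (-|y|)) (Iic 0) :=
    (integrableOn_exp_Iic 0).congr_fun
      (fun y hy => by simp [abs_of_nonpos (mem_Iic.1 hy)]) measurableSet_Iic
  rw [← integrableOn_univ, ← Iic_union_Ioi (a := (0 : ℝ))]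
  exact h'.union h

lemma integrable_reflKernel {σ : ℝ} (h1 : -1 < σ) (h0 : σ < 0) : Integrable (reflKernel σ) :=
  (integrable_exp_neg_abs.const_mul _).mono' (continuous_reflKernel h1 h0).aestronglyMeasurable
    (Eventually.of_forall (norm_reflKernel_le h1 h0))

lemma mellinConvergent_one_div_one_add {s : ℂ} (h0 : 0 < s.re) (h1 : s.re < 1) :
    MellinConvergent (fun x : ℝ => 1 / (1 + (x : ℂ))) s := by
  have hn : ∀ x : ℝ, 0 < x → ‖1 / (1 + (x : ℂ))‖ = 1 / (1 + x) := fun x hx => by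
    rw [show (1 : ℂ) + (x : ℂ) = ((1 + x : ℝ) : ℂ) by push_cast; ring, norm_div, norm_one,
      Complex.norm_of_nonneg (by linarith)]
  refine mellinConvergent_of_isBigO_rpow (a := 1) (b := 0) ?_ ?_ h1 ?_ h0
  · refine ContinuousOn.locallyIntegrableOn (ContinuousOn.div (by fun_prop) (by fun_prop) ?_)
      measurableSet_Ioi
    intro x hx h
    have := congrArg Complex.re h
    simp at this
    have : 0 < x := hx
    linarith
  · refine Asymptotics.IsBigO.of_bound 1 ?_
    filter_upwards [eventually_gt_atTop 0] with x hx
    rw [hn x hx, Real.rpow_neg_one, Real.norm_of_nonneg (by positivity), one_mul, ← one_div]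
    exact one_div_le_one_div_of_le hx (by linarith)
  · refine Asymptotics.IsBigO.of_bound 1 ?_
    filter_upwards [self_mem_nhdsWithin] with x hx
    have hx : 0 < x := hx
    rw [hn x hx]
    simp
    exact inv_le_one_of_one_le₀ (by linarith)

lemma integral_exp_neg_one_add_mul {x : ℝ} (hx : 0 < x) :
    ∫ t in Ioi (0 : ℝ), Real.exp (-(1 + x) * t) = 1 / (1 + x) := by
  rw [integral_exp_mul_Ioi (by linarith)]
  simp
  rw [neg_div, ← div_neg]; simp

/-- Write 1/(1 + x) = ∫ e^{-(1+x)t} dt and exchange the integrals: the x-integral gives Γ(s)t⁻ˢ, and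
then the t-integral gives Γ(1 - s). -/
lemma mellin_one_div_one_add {s : ℂ} (h0 : 0 < s.re) (h1 : s.re < 1) :
    mellin (fun x : ℝ => 1 / (1 + (x : ℂ))) s = Complex.Gamma s * Complex.Gamma (1 - s) := by
  set F : ℝ → ℝ → ℂ := fun x t => (x : ℂ) ^ (s - 1) * (Real.exp (-(1 + x) * t) : ℂ) with hF
  have hmeas : AEStronglyMeasurable (Function.uncurry F)
      ((volume.restrict (Ioi 0)).prod (volume.restrict (Ioi 0))) := by
    refine Measurable.aestronglyMeasurable ?_
    simp only [hF, Function.uncurry_def]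
    fun_prop
  have hint : Integrable (Function.uncurry F)
      ((volume.restrict (Ioi 0)).prod (volume.restrict (Ioi 0))) := by
    rw [integrable_prod_iff hmeas]
    constructor
    · filter_upwards [ae_restrict_mem measurableSet_Ioi] with x hx
      have hx : 0 < x := hx
      have hneg : -(1 + x) < 0 := by linarith
      have h := (Integrable.ofReal (𝕜 := ℂ)
        (integrableOn_exp_mul_Ioi hneg 0)).const_mul ((x : ℂ) ^ (s - 1))
      exact h
    · have := (mellinConvergent_one_div_one_add h0 h1).norm
      refine this.congr ?_
      filter_upwards [ae_restrict_mem measurableSet_Ioi] with x hx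
      have hx : 0 < x := hx
      simp only [hF, Function.uncurry_apply_pair, norm_mul, integral_const_mul, smul_eq_mul]
      congr 1
      rw [show (1 : ℂ) + (x : ℂ) = ((1 + x : ℝ) : ℂ) by push_cast; ring, norm_div, norm_one,
        Complex.norm_of_nonneg (by linarith), ← integral_exp_neg_one_add_mul hx]
      refine integral_congr_ae (Eventually.of_forall fun t => ?_)
      simp only [Complex.norm_real, Real.norm_eq_abs, Real.abs_exp]
  calc mellin (fun x : ℝ => 1 / (1 + (x : ℂ))) s
      = ∫ x in Ioi (0 : ℝ), ∫ t in Ioi (0 : ℝ), F x t := by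
        rw [mellin]
        refine setIntegral_congr_fun measurableSet_Ioi fun x hx => ?_
        have hx : 0 < x := hx
        simp only [hF, integral_const_mul, smul_eq_mul]
        rw [integral_complex_ofReal, integral_exp_neg_one_add_mul hx]
        push_cast; rfl
    _ = ∫ t in Ioi (0 : ℝ), ∫ x in Ioi (0 : ℝ), F x t := integral_integral_swap hint
    _ = ∫ t in Ioi (0 : ℝ), Complex.Gamma s * ((Real.exp (-t) : ℂ) * (t : ℂ) ^ ((1 - s) - 1)) := by
        refine setIntegral_congr_fun measurableSet_Ioi fun t ht => ?_
        have ht : 0 < t := ht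
        have h := Complex.integral_cpow_mul_exp_neg_mul_Ioi (a := s) (r := t) h0 (by simpa using ht)
        have h2 : ∀ x : ℝ, F x t =
            (Real.exp (-t) : ℂ) * ((x : ℂ) ^ (s - 1) * Complex.exp (-((t : ℂ) * x))) := fun x => by
          simp only [hF]
          rw [show -(1 + x) * t = -t + -(t * x) by ring, Real.exp_add]
          push_cast; ring
        simp only [h2, integral_const_mul]
        rw [h, show (1 - s) - 1 = -s by ring, one_div, Complex.inv_cpow, Complex.cpow_neg]
        · ring
        · rw [Complex.arg_ofReal_of_nonneg ht.le]; exact Real.pi_pos.ne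
    _ = _ := by
        rw [integral_const_mul, Complex.Gamma_eq_integral (s := 1 - s) (by simpa using h1)]
        rfl

/-- The Mellin-Barnes representation of `1 / (1 + x)`. -/
lemma integral_reflKernel_mul_cpow {σ : ℝ} (h1 : -1 < σ) (h0 : σ < 0) {x : ℝ} (hx : 0 < x) :
    ∫ y, reflKernel σ y * (x : ℂ) ^ linePt σ y = 2 * Real.pi * (1 / (1 + (x : ℂ))) := by
  -- The kernel at s is the Mellin transform at -s, so inversion takes place on the line of real
  -- part -σ in (0, 1), with y reflected.
  have hm : ∀ y : ℝ, mellin (fun x : ℝ => 1 / (1 + (x : ℂ))) ((-σ : ℝ) + y * I) =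
      reflKernel σ (-y) := fun y => by
    rw [mellin_one_div_one_add (by simpa using h0) (by simp; linarith), reflKernel]
    congr 2 <;> simp only [linePt] <;> push_cast <;> ring
  have key := mellinInv_mellin_eq (-σ) (fun x : ℝ => 1 / (1 + (x : ℂ))) hx
    (mellinConvergent_one_div_one_add (by simpa using h0) (by simp; linarith)) (by
      unfold VerticalIntegrable
      simp only [hm]
      exact (integrable_reflKernel h1 h0).comp_neg) (by
      refine ContinuousAt.div (by fun_prop) (by fun_prop) fun h => ?_
      have := congrArg Complex.re h
      simp at this
      linarith)
  rw [mellinInv] at key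
  simp only [hm] at key
  rw [← integral_neg_eq_self, ← key]
  have hpi : (Real.pi : ℂ) ≠ 0 := by exact_mod_cast Real.pi_ne_zero
  rw [Complex.real_smul]
  push_cast
  rw [← mul_assoc, mul_one_div_cancel (by simp), one_mul]
  refine integral_congr_ae (Eventually.of_forall fun y => ?_)
  simp only [smul_eq_mul]
  rw [mul_comm]
  congr 2
  simp only [linePt]; push_cast; ring

/-- Integrating the Mellin-Barnes representation of `1 / (1 + φ)` against a weight. -/
lemma integral_reflKernel_mul_integral {α : Type*} [MeasurableSpace α] (ρ : Measure α) [SFinite ρ]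
    {σ : ℝ} (h1 : -1 < σ) (h0 : σ < 0) (g φ : α → ℝ) (hg : Measurable g) (hφ : Measurable φ)
    (hpos : ∀ᵐ a ∂ρ, 0 < φ a) (hint : Integrable (fun a => g a * φ a ^ σ) ρ) :
    ∫ y, reflKernel σ y * ∫ a, (g a : ℂ) * (φ a : ℂ) ^ linePt σ y ∂ρ =
      2 * Real.pi * ((∫ a, g a / (1 + φ a) ∂ρ : ℝ) : ℂ) := by
  set F : ℝ → α → ℂ := fun y a => reflKernel σ y * ((g a : ℂ) * (φ a : ℂ) ^ linePt σ y) with hF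
  have hmeas : AEStronglyMeasurable (Function.uncurry F) (volume.prod ρ) := by
    have hk := (continuous_reflKernel h1 h0).measurable
    refine Measurable.aestronglyMeasurable ?_
    simp only [hF, Function.uncurry_def]
    have := (continuous_linePt σ).measurable
    fun_prop
  have hint' : Integrable (Function.uncurry F) (volume.prod ρ) := by
    -- On the line, |φˢ| = φ^σ does not depend on y, so the integrand is dominated by a product of
    -- integrable functions.
    refine Integrable.mono' ((integrable_reflKernel h1 h0).norm.mul_prod hint.norm) hmeas ?_
    have : ∀ᵐ z ∂(volume : Measure ℝ).prod ρ, 0 < φ z.2 :=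
      Measure.quasiMeasurePreserving_snd.ae hpos
    filter_upwards [this] with z hz
    simp only [hF, Function.uncurry_def, norm_mul]
    rw [Complex.norm_cpow_eq_rpow_re_of_pos hz, linePt_re, Complex.norm_real,
      Real.norm_of_nonneg (Real.rpow_nonneg hz.le σ)]
  calc _ = ∫ y, ∫ a, F y a ∂ρ := by simp only [hF, integral_const_mul]
    _ = ∫ a, (∫ y, F y a) ∂ρ := integral_integral_swap hint'
    _ = ∫ a, 2 * Real.pi * ((g a / (1 + φ a) : ℝ) : ℂ) ∂ρ := by
        refine integral_congr_ae ?_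
        filter_upwards [hpos] with a ha
        have : ∀ y, F y a = (g a : ℂ) * (reflKernel σ y * (φ a : ℂ) ^ linePt σ y) := fun y => by
          simp only [hF]; ring
        simp only [this, integral_const_mul]
        rw [integral_reflKernel_mul_cpow h1 h0 ha]
        push_cast; ring
    _ = _ := by rw [integral_const_mul, integral_complex_ofReal]

/-! ### The Meijer functions as real integrals -/

open Complex Set Filter Topology SpecialFun

lemma integrableOn_rpow_mul_exp_neg {p : ℝ} (hp : -1 < p) :
    IntegrableOn (fun t : ℝ => t ^ p * Real.exp (-t)) (Ioi 0) := by
  have := Real.GammaIntegral_convergent (s := p + 1) (by linarith)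
  refine this.congr_fun (fun t _ => ?_) measurableSet_Ioi
  simp [mul_comm]

/-- `Γ(n + 1 + s) x^s` as an integral of `(x t)^s`. -/
lemma Gamma_mul_cpow_eq_integral (n : ℕ) {x : ℝ} (hx : 0 < x) {s : ℂ} (hs : 0 < ((n : ℂ) + 1 + s).re) :
    Complex.Gamma ((n : ℂ) + 1 + s) * (x : ℂ) ^ s =
      ∫ t in Ioi (0 : ℝ), ((t ^ n * Real.exp (-t) : ℝ) : ℂ) * ((x * t : ℝ) : ℂ) ^ s := by
  rw [Complex.Gamma_eq_integral hs, Complex.GammaIntegral, mul_comm, ← integral_const_mul]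
  refine setIntegral_congr_fun measurableSet_Ioi fun t ht => ?_
  have ht : 0 < t := ht
  have ht' : (t : ℂ) ≠ 0 := by exact_mod_cast ht.ne'
  rw [show (n : ℂ) + 1 + s - 1 = n + s by ring, Complex.cpow_add _ _ ht', Complex.cpow_natCast,
    Complex.ofReal_mul x t, Complex.mul_cpow_ofReal_nonneg hx.le ht.le]
  push_cast; ring

lemma integrableOn_pow_mul_exp_neg_mul_rpow (n : ℕ) {x σ : ℝ} (hx : 0 < x) (hσ : -1 < n + σ) :
    IntegrableOn (fun t : ℝ => t ^ n * Real.exp (-t) * (x * t) ^ σ) (Ioi 0) := by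
  refine IntegrableOn.congr_fun ((integrableOn_rpow_mul_exp_neg hσ).const_mul (x ^ σ))
    (fun t ht => ?_) measurableSet_Ioi
  have ht : 0 < t := ht
  rw [Real.mul_rpow hx.le ht.le, Real.rpow_add ht, Real.rpow_natCast]
  ring

/-- The parameter -2 occurs above and below, so Γ(3 + s) cancels. The shift s ↦ s - 1 leaves
b⁻¹Γ(-s)Γ(1 + s)Γ(n + 1 + s)bˢ, and the last gamma factor is an Euler integral of (bt)ˢ. -/
lemma meijerG_one_three (n : ℕ) {b : ℝ} (hb : 0 < b) :
    meijerG 1 3 [-((n + 1 : ℕ) : ℝ), -2, -1] [-1, -2] b =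
      ((b⁻¹ * ∫ t in Ioi (0 : ℝ), t ^ n * Real.exp (-t) / (1 + b * t) : ℝ) : ℂ) := by
  have hex : ∃ c : ℝ, MeijerSeparates 1 3 [-((n + 1 : ℕ) : ℝ), -2, -1] [-1, -2] c := by
    refine ⟨-3 / 2, ?_⟩
    simp [MeijerSeparates]
    refine ⟨?_, ?_, ?_, ?_⟩ <;> linarith [Nat.cast_nonneg (α := ℝ) n]
  unfold meijerG
  rw [dif_pos hex]
  have hc := hex.choose_spec
  -- The contour of the definition is an unspecified one. Only the separation inequalities -2 < c <
  -- -1 are kept, and they place c + 1 in the strip of the reflection kernel.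
  generalize hex.choose = c at hc
  simp [MeijerSeparates] at hc
  obtain ⟨hc1, -, -, hc2⟩ := hc
  set σ := c + 1 with hσ
  have h1 : -1 < σ := by linarith
  have h0 : σ < 0 := by linarith
  have hn : (0 : ℝ) ≤ n := Nat.cast_nonneg n
  have hb0 : (b : ℂ) ≠ 0 := by exact_mod_cast hb.ne'
  have hpt : ∀ y : ℝ, meijerKernel 1 3 [-((n + 1 : ℕ) : ℝ), -2, -1] [-1, -2] ((c : ℂ) + y * I) *
      (b : ℂ) ^ ((c : ℂ) + y * I) = (b : ℂ)⁻¹ * (reflKernel σ y *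
        ∫ t in Ioi (0 : ℝ), ((t ^ n * Real.exp (-t) : ℝ) : ℂ) * ((b * t : ℝ) : ℂ) ^ linePt σ y) := by
    intro y
    have hs : (c : ℂ) + y * I = linePt σ y - 1 := by simp [linePt, hσ]; ring
    have hre : 0 < ((n : ℂ) + 1 + linePt σ y).re := by simp; linarith
    have hne : Complex.Gamma (2 + linePt σ y) ≠ 0 :=
      Gamma_ne_zero_of_re_pos (by simp; linarith)
    rw [← Gamma_mul_cpow_eq_integral n hb hre, hs, reflKernel, Complex.cpow_sub _ _ hb0,
      Complex.cpow_one]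
    simp [meijerKernel, gammaSub, gammaOneSubAdd]
    rw [show linePt σ y + 2 = 2 + linePt σ y by ring,
      show linePt σ y - (-1 + -(n : ℂ)) = n + 1 + linePt σ y by ring,
      show linePt σ y + 1 = 1 + linePt σ y by ring,
      show -1 - (linePt σ y - 1) = -linePt σ y by ring]
    field_simp
  simp only [hpt, integral_const_mul]
  rw [integral_reflKernel_mul_integral (volume.restrict (Ioi 0)) h1 h0
    (fun t => t ^ n * Real.exp (-t)) (fun t => b * t) (by fun_prop) (by fun_prop)
    (by filter_upwards [ae_restrict_mem measurableSet_Ioi] with t ht using mul_pos hb ht)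
    (integrableOn_pow_mul_exp_neg_mul_rpow n hb (by linarith))]
  have hpi : (Real.pi : ℂ) ≠ 0 := by exact_mod_cast Real.pi_ne_zero
  generalize (∫ t in Ioi (0 : ℝ), t ^ n * Real.exp (-t) / (1 + b * t)) = J
  push_cast
  field_simp

/-- The shift s ↦ s - q leaves z^{-q}Γ(-s)Γ(1 + s)Γ(m - s)Γ(q - s)zˢ. The last two gamma factors
form a double Euler integral of (w₁w₂)⁻ˢ, so the reflection kernel is evaluated at z/(w₁w₂). -/
lemma meijerG_three_one (m q : ℕ) (hq : 0 < q) (e₁ e₂ : ℝ) (he₁ : e₁ = -q) (he₂ : e₂ = m - q) {z : ℝ}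
    (hz : 0 < z) :
    meijerG 3 1 [e₁] [e₁, e₂, 0] z =
      (((z ^ q)⁻¹ * ∫ w in Ioi (0 : ℝ) ×ˢ Ioi (0 : ℝ),
        w.1 ^ m * w.2 ^ q * Real.exp (-w.1) * Real.exp (-w.2) / (w.1 * w.2 + z) : ℝ) : ℂ) := by
  subst he₁ he₂
  have hm : (0 : ℝ) ≤ m := Nat.cast_nonneg m
  have hq1 : (1 : ℝ) ≤ q := by exact_mod_cast hq
  have hex : ∃ c : ℝ, MeijerSeparates 3 1 [-(q : ℝ)] [-(q : ℝ), (m : ℝ) - q, 0] c := by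
    refine ⟨-q - 1 / 2, ?_⟩
    simp [MeijerSeparates]
    refine ⟨⟨?_, ?_⟩, ?_⟩ <;> linarith
  unfold meijerG
  rw [dif_pos hex]
  have hc := hex.choose_spec
  generalize hex.choose = c at hc
  simp [MeijerSeparates] at hc
  obtain ⟨⟨hc1, -, -⟩, hc2⟩ := hc
  set σ := c + q with hσ
  have h1 : -1 < σ := by linarith
  have h0 : σ < 0 := by linarith
  have hz0 : (z : ℂ) ≠ 0 := by exact_mod_cast hz.ne'
  have hvol : (volume : Measure (ℝ × ℝ)).restrict (Ioi 0 ×ˢ Ioi 0) =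
      (volume.restrict (Ioi (0 : ℝ))).prod (volume.restrict (Ioi (0 : ℝ))) := by
    rw [Measure.volume_eq_prod, Measure.prod_restrict]
  have hpt : ∀ y : ℝ, meijerKernel 3 1 [-(q : ℝ)] [-(q : ℝ), (m : ℝ) - q, 0] ((c : ℂ) + y * I) *
      (z : ℂ) ^ ((c : ℂ) + y * I) = ((z : ℂ) ^ q)⁻¹ * (reflKernel σ y *
        ∫ w in Ioi (0 : ℝ) ×ˢ Ioi (0 : ℝ), ((w.1 ^ ((m : ℝ) - 1) * Real.exp (-w.1) *
          (w.2 ^ ((q : ℝ) - 1) * Real.exp (-w.2)) : ℝ) : ℂ) *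
          ((z / (w.1 * w.2) : ℝ) : ℂ) ^ linePt σ y) := by
    intro y
    have hs : (c : ℂ) + y * I = linePt σ y - q := by simp [linePt, hσ]; ring
    -- The exponent k - 1 is kept real because k = m may be 0; the integral still converges since
    -- Re(-s) > 0.
    have hG : ∀ k : ℕ, 0 < ((k : ℂ) - linePt σ y).re → Complex.Gamma ((k : ℂ) - linePt σ y) =
        ∫ t in Ioi (0 : ℝ), ((t ^ ((k : ℝ) - 1) * Real.exp (-t) : ℝ) : ℂ) *
          (t : ℂ) ^ (-linePt σ y) := by
      intro k hk
      rw [Complex.Gamma_eq_integral hk, Complex.GammaIntegral]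
      refine setIntegral_congr_fun measurableSet_Ioi fun t ht => ?_
      have ht : 0 < t := ht
      have ht' : (t : ℂ) ≠ 0 := by exact_mod_cast ht.ne'
      rw [show (k : ℂ) - linePt σ y - 1 = ((k - 1 : ℝ) : ℂ) + (-linePt σ y) by push_cast; ring,
        Complex.cpow_add _ _ ht', Complex.ofReal_mul, Complex.ofReal_cpow ht.le]
      ring
    have hprod : ∫ w in Ioi (0 : ℝ) ×ˢ Ioi (0 : ℝ), ((w.1 ^ ((m : ℝ) - 1) * Real.exp (-w.1) *
          (w.2 ^ ((q : ℝ) - 1) * Real.exp (-w.2)) : ℝ) : ℂ) *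
          ((z / (w.1 * w.2) : ℝ) : ℂ) ^ linePt σ y =
        (z : ℂ) ^ linePt σ y *
          (Complex.Gamma ((m : ℂ) - linePt σ y) * Complex.Gamma ((q : ℂ) - linePt σ y)) := by
      rw [hG m (by simp; linarith), hG q (by simp; linarith), ← setIntegral_prod_mul,
        ← integral_const_mul, Measure.volume_eq_prod]
      refine setIntegral_congr_fun (measurableSet_Ioi.prod measurableSet_Ioi) fun w hw => ?_
      have hw1 : 0 < w.1 := hw.1
      have hw2 : 0 < w.2 := hw.2
      have hc : ((z / (w.1 * w.2) : ℝ) : ℂ) ^ linePt σ y = (z : ℂ) ^ linePt σ y *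
          ((w.1 : ℂ) ^ (-linePt σ y) * (w.2 : ℂ) ^ (-linePt σ y)) := by
        rw [div_eq_mul_inv, Complex.ofReal_mul,
          Complex.mul_cpow_ofReal_nonneg hz.le (by positivity), mul_inv, Complex.ofReal_mul,
          Complex.mul_cpow_ofReal_nonneg (by positivity) (by positivity), Complex.ofReal_inv,
          Complex.ofReal_inv, Complex.inv_cpow, Complex.inv_cpow, Complex.cpow_neg,
          Complex.cpow_neg] <;>
        · rw [Complex.arg_ofReal_of_nonneg (by positivity)]; exact Real.pi_pos.ne
      simp only [hc]
      push_cast; ring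
    rw [hprod, hs, reflKernel, Complex.cpow_sub _ _ hz0, Complex.cpow_natCast]
    simp [meijerKernel, gammaSub, gammaOneSubAdd]
    rw [show -(q : ℂ) - (linePt σ y - q) = -linePt σ y by ring]
    field_simp
  simp only [hpt, integral_const_mul]
  rw [integral_reflKernel_mul_integral (volume.restrict (Ioi 0 ×ˢ Ioi 0)) h1 h0
    (fun w : ℝ × ℝ => w.1 ^ ((m : ℝ) - 1) * Real.exp (-w.1) *
          (w.2 ^ ((q : ℝ) - 1) * Real.exp (-w.2))) (fun w => z / (w.1 * w.2))
    (by fun_prop) (by fun_prop)]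
  · have hpi : (Real.pi : ℂ) ≠ 0 := by exact_mod_cast Real.pi_ne_zero
    have : ∫ w in Ioi (0 : ℝ) ×ˢ Ioi (0 : ℝ), w.1 ^ ((m : ℝ) - 1) * Real.exp (-w.1) *
          (w.2 ^ ((q : ℝ) - 1) * Real.exp (-w.2)) / (1 + z / (w.1 * w.2)) =
        ∫ w in Ioi (0 : ℝ) ×ˢ Ioi (0 : ℝ),
          w.1 ^ m * w.2 ^ q * Real.exp (-w.1) * Real.exp (-w.2) / (w.1 * w.2 + z) := by
      refine setIntegral_congr_fun (measurableSet_Ioi.prod measurableSet_Ioi) fun w hw => ?_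
      have hw1 : 0 < w.1 := hw.1
      have hw2 : 0 < w.2 := hw.2
      rw [Real.rpow_sub_one hw1.ne', Real.rpow_sub_one hw2.ne', Real.rpow_natCast,
        Real.rpow_natCast]
      field_simp
    rw [this]
    push_cast
    field_simp
  · filter_upwards [ae_restrict_mem (measurableSet_Ioi.prod measurableSet_Ioi)] with w hw
    exact div_pos hz (mul_pos hw.1 hw.2)
  · have h := ((integrableOn_rpow_mul_exp_neg (p := m - 1 - σ) (by linarith)).mul_prod
      (integrableOn_rpow_mul_exp_neg (p := q - 1 - σ) (by linarith))).const_mul (z ^ σ)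
    rw [← hvol] at h
    refine h.congr ?_
    filter_upwards [ae_restrict_mem (measurableSet_Ioi.prod measurableSet_Ioi)] with w hw
    have hw1 : 0 < w.1 := hw.1
    have hw2 : 0 < w.2 := hw.2
    rw [Real.div_rpow hz.le (by positivity), Real.mul_rpow hw1.le hw2.le,
      Real.rpow_sub hw1 _ σ, Real.rpow_sub hw2 _ σ]
    field_simp

/-- After the shift t ↦ t - 1 in the second variable both kernels are reflection kernels. The
coupling factor Γ(n + 2 + s + t) is one Euler integral, which separates the variables: under it the
double contour integral is a product of two representations of 1/(1 + x). -/
lemma bivariateMeijerG_eq (n : ℕ) {a b : ℝ} (ha : 0 < a) (hb : 0 < b) :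
    bivariateMeijerG 1 1 2 1 1 [((n + 1 : ℕ) : ℝ) + 2] [0] [-2, -1] [] [0] [-1, -2] a b =
      ((b⁻¹ * ∫ t in Ioi (0 : ℝ), t ^ (n + 1) * Real.exp (-t) / ((1 + a * t) * (1 + b * t)) : ℝ)
        : ℂ) := by
  have hn : (0 : ℝ) ≤ n := Nat.cast_nonneg n
  have hex : ∃ c : ℝ × ℝ, BivariateSeparates 1 1 2 1 1 [((n + 1 : ℕ) : ℝ) + 2] [0] [-2, -1] [0]
      [-1, -2] c := by
    refine ⟨(-1 / 2, -3 / 2), ?_⟩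
    simp [BivariateSeparates, MeijerSeparates]
    refine ⟨⟨?_, ?_⟩, ⟨?_, ?_, ?_⟩, ?_⟩ <;> linarith
  unfold bivariateMeijerG
  rw [dif_pos hex]
  have hc := hex.choose_spec
  generalize hex.choose = c at hc
  obtain ⟨σ, c₂⟩ := c
  simp [BivariateSeparates, MeijerSeparates] at hc
  obtain ⟨⟨h0, h1⟩, ⟨hc1, -, hc2⟩, -⟩ := hc
  set τ := c₂ + 1 with hτ
  have h1' : -1 < τ := by linarith
  have h0' : τ < 0 := by linarith
  have ha0 : (a : ℂ) ≠ 0 := by exact_mod_cast ha.ne'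
  have hb0 : (b : ℂ) ≠ 0 := by exact_mod_cast hb.ne'
  set F : ℝ × ℝ → ℝ → ℂ := fun u t => (reflKernel σ u.1 * reflKernel τ u.2) *
    (((t ^ (n + 1) * Real.exp (-t) : ℝ) : ℂ) *
      (((a * t : ℝ) : ℂ) ^ linePt σ u.1 * ((b * t : ℝ) : ℂ) ^ linePt τ u.2)) with hF
  have hpt : ∀ u : ℝ × ℝ,
      couplingKernel 1 [((n + 1 : ℕ) : ℝ) + 2] [] (((σ : ℂ) + u.1 * I) + ((c₂ : ℂ) + u.2 * I)) *
        (meijerKernel 1 1 [0] [0] ((σ : ℂ) + u.1 * I) * (a : ℂ) ^ ((σ : ℂ) + u.1 * I)) *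
        (meijerKernel 1 2 [-2, -1] [-1, -2] ((c₂ : ℂ) + u.2 * I) *
          (b : ℂ) ^ ((c₂ : ℂ) + u.2 * I)) =
      (b : ℂ)⁻¹ * ∫ t in Ioi (0 : ℝ), F u t := by
    intro u
    have hs : (σ : ℂ) + u.1 * I = linePt σ u.1 := rfl
    have ht : (c₂ : ℂ) + u.2 * I = linePt τ u.2 - 1 := by simp [linePt, hτ]; ring
    have hG : Complex.Gamma (n + 2 + linePt σ u.1 + linePt τ u.2) * ((a : ℂ) ^ linePt σ u.1 *
        (b : ℂ) ^ linePt τ u.2) =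
        ∫ t in Ioi (0 : ℝ), ((t ^ (n + 1) * Real.exp (-t) : ℝ) : ℂ) *
      (((a * t : ℝ) : ℂ) ^ linePt σ u.1 * ((b * t : ℝ) : ℂ) ^ linePt τ u.2) := by
      rw [Complex.Gamma_eq_integral (by simp; linarith), Complex.GammaIntegral, mul_comm,
        ← integral_const_mul]
      refine setIntegral_congr_fun measurableSet_Ioi fun t ht => ?_
      have ht : 0 < t := ht
      have ht' : (t : ℂ) ≠ 0 := by exact_mod_cast ht.ne'
      rw [show (n : ℂ) + 2 + linePt σ u.1 + linePt τ u.2 - 1 =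
          ((n + 1 : ℕ) : ℂ) + (linePt σ u.1 + linePt τ u.2) by push_cast; ring,
        Complex.cpow_add _ _ ht', Complex.cpow_add _ _ ht', Complex.cpow_natCast,
        Complex.ofReal_mul a t, Complex.mul_cpow_ofReal_nonneg ha.le ht.le,
        Complex.ofReal_mul b t, Complex.mul_cpow_ofReal_nonneg hb.le ht.le]
      push_cast; ring
    have hne : Complex.Gamma (2 + linePt τ u.2) ≠ 0 :=
      Gamma_ne_zero_of_re_pos (by simp; linarith)
    simp only [hF, integral_const_mul]
    rw [← hG, hs, ht, reflKernel, reflKernel, Complex.cpow_sub _ _ hb0, Complex.cpow_one]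
    simp [couplingKernel, meijerKernel, gammaSub, gammaOneSubAdd]
    rw [show linePt τ u.2 + 2 = 2 + linePt τ u.2 by ring,
      show (n : ℂ) + 1 + 2 + (linePt σ u.1 + (linePt τ u.2 - 1)) =
        n + 2 + linePt σ u.1 + linePt τ u.2 by ring,
      show linePt τ u.2 + 1 = 1 + linePt τ u.2 by ring,
      show -1 - (linePt τ u.2 - 1) = -linePt τ u.2 by ring]
    field_simp
  have hK : Integrable (fun u : ℝ × ℝ => reflKernel σ u.1 * reflKernel τ u.2) :=
    (integrable_reflKernel h1 h0).mul_prod (integrable_reflKernel h1' h0')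
  have hint : Integrable (Function.uncurry F)
      ((volume : Measure (ℝ × ℝ)).prod (volume.restrict (Ioi 0))) := by
    have hw : IntegrableOn (fun t : ℝ => t ^ (n + 1) * Real.exp (-t) * ((a * t) ^ σ * (b * t) ^ τ))
        (Ioi 0) := by
      have hp : -1 < (n : ℝ) + 1 + σ + τ := by linarith
      refine IntegrableOn.congr_fun ((integrableOn_rpow_mul_exp_neg hp).const_mul
        (a ^ σ * b ^ τ)) (fun t ht => ?_) measurableSet_Ioi
      have ht : 0 < t := ht
      rw [Real.mul_rpow ha.le ht.le, Real.mul_rpow hb.le ht.le, Real.rpow_add ht, Real.rpow_add ht,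
        show (n : ℝ) + 1 = ((n + 1 : ℕ) : ℝ) by push_cast; ring, Real.rpow_natCast]
      ring
    refine Integrable.mono' (hK.norm.mul_prod hw.norm) ?_ ?_
    · have hk := (continuous_reflKernel h1 h0).measurable
      have hk' := (continuous_reflKernel h1' h0').measurable
      refine Measurable.aestronglyMeasurable ?_
      simp only [hF, Function.uncurry_def]
      have := (continuous_linePt σ).measurable
      have := (continuous_linePt τ).measurable
      fun_prop
    · have : ∀ᵐ z ∂(volume : Measure (ℝ × ℝ)).prod (volume.restrict (Ioi (0 : ℝ))), 0 < z.2 :=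
        Measure.quasiMeasurePreserving_snd.ae (ae_restrict_mem measurableSet_Ioi)
      filter_upwards [this] with z hz
      simp only [hF, Function.uncurry_def, norm_mul]
      rw [Complex.norm_cpow_eq_rpow_re_of_pos (mul_pos ha hz), linePt_re,
        Complex.norm_cpow_eq_rpow_re_of_pos (mul_pos hb hz), linePt_re, Complex.norm_real,
        Real.norm_of_nonneg (Real.rpow_nonneg (mul_pos ha hz).le σ),
        Real.norm_of_nonneg (Real.rpow_nonneg (mul_pos hb hz).le τ), norm_mul]
  simp only [hpt, integral_const_mul]
  rw [integral_integral_swap hint]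
  have hin : ∀ t ∈ Ioi (0 : ℝ), ∫ u : ℝ × ℝ, F u t = (2 * Real.pi) ^ 2 *
      ((t ^ (n + 1) * Real.exp (-t) / ((1 + a * t) * (1 + b * t)) : ℝ) : ℂ) := by
    intro t ht
    have h := integral_prod_mul (μ := (volume : Measure ℝ)) (ν := (volume : Measure ℝ))
      (fun y => reflKernel σ y * ((a * t : ℝ) : ℂ) ^ linePt σ y)
      (fun y => reflKernel τ y * ((b * t : ℝ) : ℂ) ^ linePt τ y)
    rw [integral_reflKernel_mul_cpow h1 h0 (mul_pos ha ht),
      integral_reflKernel_mul_cpow h1' h0' (mul_pos hb ht), ← Measure.volume_eq_prod] at h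
    have h2 : ∀ u : ℝ × ℝ, F u t = ((t ^ (n + 1) * Real.exp (-t) : ℝ) : ℂ) *
        (reflKernel σ u.1 * ((a * t : ℝ) : ℂ) ^ linePt σ u.1 *
          (reflKernel τ u.2 * ((b * t : ℝ) : ℂ) ^ linePt τ u.2)) := fun u => by
      simp only [hF]; ring
    simp only [h2, integral_const_mul]
    rw [h]
    push_cast
    rw [← div_div]
    ring
  rw [setIntegral_congr_fun measurableSet_Ioi hin, integral_const_mul, integral_complex_ofReal]
  have hpi : (Real.pi : ℂ) ≠ 0 := by exact_mod_cast Real.pi_ne_zero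
  generalize (∫ t in Ioi (0 : ℝ),
    t ^ (n + 1) * Real.exp (-t) / ((1 + a * t) * (1 + b * t))) = J
  push_cast
  field_simp

end MellinBarnes

/-! ### Linear algebra of the MMSE/MRT relay -/

namespace RelayParams

open Matrix

open scoped ComplexOrder

variable {N : ℕ}

lemma vecSq_nonneg (v : Fin N → ℂ) : 0 ≤ vecSq v := Finset.sum_nonneg fun _ _ => by positivity

lemma star_dotProduct_self (v : Fin N → ℂ) : star v ⬝ᵥ v = (vecSq v : ℂ) := by
  simp [dotProduct, vecSq, Complex.conj_mul']

lemma dotProduct_star_self (v : Fin N → ℂ) : v ⬝ᵥ star v = (vecSq v : ℂ) := by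
  rw [dotProduct_comm, star_dotProduct_self]

lemma vecSq_smul (c : ℂ) (v : Fin N → ℂ) : vecSq (c • v) = ‖c‖ ^ 2 * vecSq v := by
  simp [vecSq, mul_pow, Finset.mul_sum]

lemma vecSq_star (v : Fin N → ℂ) : vecSq (star v) = vecSq v := by
  simp [vecSq]

lemma matSq_smul_vecMulVec (c : ℂ) (v w : Fin N → ℂ) :
    matSq (c • vecMulVec v w) = ‖c‖ ^ 2 * (vecSq v * vecSq w) := by
  rw [matSq, vecSq, vecSq, Finset.sum_mul_sum]
  simp only [Finset.mul_sum]
  simp [vecMulVec_apply, mul_pow]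

/-- The squared modulus of the inner product of two vectors. -/
noncomputable def innerSq (v w : Fin N → ℂ) : ℝ := ‖star v ⬝ᵥ w‖ ^ 2

lemma innerSq_nonneg (v w : Fin N → ℂ) : 0 ≤ innerSq v w := by unfold innerSq; positivity

lemma innerSq_le (v w : Fin N → ℂ) : innerSq v w ≤ vecSq v * vecSq w := by
  have h := norm_inner_le_norm (𝕜 := ℂ) (WithLp.toLp 2 v : EuclideanSpace ℂ (Fin N))
    (WithLp.toLp 2 w)
  have h2 := pow_le_pow_left₀ (norm_nonneg _) h 2
  rw [mul_pow, EuclideanSpace.norm_sq_eq, EuclideanSpace.norm_sq_eq] at h2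
  rw [EuclideanSpace.inner_toLp_toLp, dotProduct_comm] at h2
  exact h2

/-- The Sherman-Morrison formula for a scalar matrix plus a matrix of rank one. -/
lemma inv_vecMulVec_add_smul_one (v w : Fin N → ℂ) (β : ℂ) (hβ : β ≠ 0) (h : β + w ⬝ᵥ v ≠ 0) :
    (vecMulVec v w + β • (1 : Matrix (Fin N) (Fin N) ℂ))⁻¹ =
      β⁻¹ • (1 - (β + w ⬝ᵥ v)⁻¹ • vecMulVec v w) := by
  refine inv_eq_right_inv ?_
  have hv : vecMulVec v w * vecMulVec v w = (w ⬝ᵥ v) • vecMulVec v w := by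
    rw [vecMulVec_mul_vecMulVec, vecMulVec_smul]
  rw [Matrix.mul_smul, Matrix.add_mul, Matrix.mul_sub, Matrix.mul_one, Matrix.mul_smul, hv,
    Matrix.smul_mul, Matrix.one_mul, smul_smul, smul_sub, smul_smul, smul_add, smul_sub, smul_sub,
    smul_smul, smul_smul, inv_mul_cancel₀ hβ, one_smul, smul_smul]
  have key : β⁻¹ • vecMulVec v w - (β⁻¹ * ((β + w ⬝ᵥ v)⁻¹ * w ⬝ᵥ v)) • vecMulVec v w -
      (β⁻¹ * (β * (β + w ⬝ᵥ v)⁻¹)) • vecMulVec v w = 0 := by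
    rw [← sub_smul, ← sub_smul]
    convert zero_smul ℂ _
    field_simp
    ring
  calc _ = (β⁻¹ • vecMulVec v w - (β⁻¹ * ((β + w ⬝ᵥ v)⁻¹ * w ⬝ᵥ v)) • vecMulVec v w -
      (β⁻¹ * (β * (β + w ⬝ᵥ v)⁻¹)) • vecMulVec v w) + 1 := by abel
    _ = 1 := by rw [key, zero_add]

variable (S : RelayParams)

lemma D₁_pos : 0 < S.D₁ := Real.rpow_pos_of_pos S.d₁_pos _
lemma D₂_pos : 0 < S.D₂ := Real.rpow_pos_of_pos S.d₂_pos _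
lemma DI_pos : 0 < S.DI := Real.rpow_pos_of_pos S.dI_pos _
lemma ρ₁_pos : 0 < S.ρ₁ := div_pos S.Ps_pos S.N₀_pos
lemma ρI_pos : 0 < S.ρI := div_pos S.PI_pos S.N₀_pos
lemma one_sub_θ_pos : 0 < 1 - S.θ := sub_pos.2 S.θ_lt_one

/-- The mean signal-to-noise ratio `(1-θ) ρ₁ / d₁^τ` of the source at a relay antenna. -/
noncomputable def srcSNR : ℝ := (1 - S.θ) * S.ρ₁ / S.D₁

/-- The mean interference-to-noise ratio `(1-θ) ρI / dI^τ` at a relay antenna. -/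
noncomputable def intSNR : ℝ := (1 - S.θ) * S.ρI / S.DI

lemma srcSNR_pos : 0 < S.srcSNR := div_pos (mul_pos S.one_sub_θ_pos S.ρ₁_pos) S.D₁_pos
lemma intSNR_pos : 0 < S.intSNR := div_pos (mul_pos S.one_sub_θ_pos S.ρI_pos) S.DI_pos

/-- `‖h₁‖² - b |hI† h₁|² / (1 + b ‖hI‖²)`, the power of `h₁` left after interference suppression. -/
noncomputable def residualPower (b : ℝ) (h₁ hI : Fin N → ℂ) : ℝ :=
  vecSq h₁ - b * innerSq hI h₁ / (1 + b * vecSq hI)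

lemma residualPower_le {b : ℝ} (hb : 0 < b) (h₁ hI : Fin N → ℂ) : residualPower b h₁ hI ≤ vecSq h₁ := by
  have := vecSq_nonneg hI
  have := innerSq_nonneg hI h₁
  have : 0 ≤ b * innerSq hI h₁ / (1 + b * vecSq hI) := by positivity
  unfold residualPower; linarith

/-- Cauchy-Schwarz: the loss is greatest when the two channels are parallel. This bound makes the
residual power positive and controls its logarithm from below. -/
lemma le_residualPower {b : ℝ} (hb : 0 < b) (h₁ hI : Fin N → ℂ) :
    vecSq h₁ / (1 + b * vecSq hI) ≤ residualPower b h₁ hI := by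
  have h1 := vecSq_nonneg hI
  have h2 := innerSq_le hI h₁
  have hpos : 0 < 1 + b * vecSq hI := by positivity
  unfold residualPower
  rw [div_le_iff₀ hpos, sub_mul, div_mul_cancel₀ _ hpos.ne']
  nlinarith [mul_le_mul_of_nonneg_left h2 hb.le]

lemma R_eq (hI : Fin N → ℂ) : S.R hI = vecMulVec hI (star hI) +
    ((S.intSNR⁻¹ : ℝ) : ℂ) • (1 : Matrix (Fin N) (Fin N) ℂ) := by
  rw [R, intSNR, inv_div]

lemma R_posDef (hI : Fin N → ℂ) : (S.R hI).PosDef := by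
  rw [R_eq]
  refine PosDef.posSemidef_add (posSemidef_vecMulVec_self_star hI) ?_
  refine PosDef.one.smul ?_
  exact_mod_cast inv_pos.2 S.intSNR_pos

/-- Sherman-Morrison with β = b⁻¹, where b is `intSNR`; the cross term h₁†hI · hI†h₁ is the squared
modulus of the inner product. -/
lemma star_dotProduct_R_inv_mulVec (h₁ hI : Fin N → ℂ) :
    star h₁ ⬝ᵥ ((S.R hI)⁻¹ *ᵥ h₁) = ((S.intSNR * residualPower S.intSNR h₁ hI : ℝ) : ℂ) := by
  have hb := S.intSNR_pos
  have hI0 := vecSq_nonneg hI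
  have hne : ((S.intSNR⁻¹ : ℝ) : ℂ) + star hI ⬝ᵥ hI ≠ 0 := by
    rw [star_dotProduct_self, ← Complex.ofReal_add, Complex.ofReal_ne_zero]
    positivity
  have hin : star h₁ ⬝ᵥ hI * star hI ⬝ᵥ h₁ = (innerSq hI h₁ : ℂ) := by
    have : star h₁ ⬝ᵥ hI = star (star hI ⬝ᵥ h₁) := by
      rw [star_dotProduct]
    rw [this, innerSq, Complex.star_def, Complex.conj_mul']
    push_cast; rfl
  rw [R_eq, inv_vecMulVec_add_smul_one _ _ _ (by exact_mod_cast (inv_pos.2 hb).ne') hne,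
    smul_mulVec, sub_mulVec, one_mulVec, smul_mulVec, vecMulVec_mulVec, dotProduct_smul,
    dotProduct_sub, dotProduct_smul]
  rw [op_smul_eq_smul, dotProduct_smul, star_dotProduct_self, star_dotProduct_self]
  simp only [smul_eq_mul]
  rw [mul_comm (star hI ⬝ᵥ h₁), hin]
  have hr : (1 + S.intSNR * vecSq hI) ≠ 0 := by positivity
  have hr2 : (S.intSNR⁻¹ + vecSq hI) ≠ 0 := by positivity
  rw [residualPower]
  norm_cast
  field_simp

lemma γ₁_eq (h₁ hI : Fin N → ℂ) : S.γ₁ h₁ hI = S.srcSNR * residualPower S.intSNR h₁ hI := by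
  rw [γ₁, star_dotProduct_R_inv_mulVec, Complex.ofReal_re, ← mul_assoc]
  congr 1
  have := S.D₁_pos.ne'
  have := S.DI_pos.ne'
  have := S.ρI_pos.ne'
  rw [intSNR, srcSNR]
  field_simp

/-- The MMSE combiner is proportional to `h₁† R⁻¹`. -/
lemma mmseCombiner_eq (h₁ hI : Fin N → ℂ) :
    S.mmseCombiner h₁ hI = (((1 + S.intSNR * residualPower S.intSNR h₁ hI)⁻¹ : ℝ) : ℂ) •
      star ((S.R hI)⁻¹ *ᵥ h₁) := by
  set g := S.intSNR * residualPower S.intSNR h₁ hI with hg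
  have hR := S.R_posDef hI
  have hunit : IsUnit (S.R hI).det := (isUnit_iff_isUnit_det _).1 hR.isUnit
  have hg0 : 0 ≤ g := by
    have := le_residualPower S.intSNR_pos h₁ hI
    have h1 := vecSq_nonneg h₁
    have h2 := vecSq_nonneg hI
    have h3 := S.intSNR_pos
    have : 0 ≤ vecSq h₁ / (1 + S.intSNR * vecSq hI) := by positivity
    exact mul_nonneg h3.le (by linarith)
  have hA : (vecMulVec h₁ (star h₁) + S.R hI).PosDef :=
    PosDef.posSemidef_add (posSemidef_vecMulVec_self_star h₁) hR
  have hAunit : IsUnit (vecMulVec h₁ (star h₁) + S.R hI).det :=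
    (isUnit_iff_isUnit_det _).1 hA.isUnit
  have hstar : star ((S.R hI)⁻¹ *ᵥ h₁) = star h₁ ᵥ* (S.R hI)⁻¹ := by
    rw [star_mulVec, conjTranspose_nonsing_inv, hR.isHermitian.eq]
  -- h₁†R⁻¹(h₁h₁† + R) = (1 + g)h₁†, so inverting the full matrix instead of R only changes the
  -- scale.
  have key : star ((S.R hI)⁻¹ *ᵥ h₁) ᵥ* (vecMulVec h₁ (star h₁) + S.R hI) =
      ((1 + g : ℝ) : ℂ) • star h₁ := by
    rw [hstar, vecMul_add, vecMul_vecMul _ _ (S.R hI), nonsing_inv_mul _ hunit, vecMul_one,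
      vecMul_vecMulVec, ← dotProduct_mulVec, star_dotProduct_R_inv_mulVec, ← hg]
    push_cast
    rw [add_smul, one_smul, add_comm]
  have h1g : ((1 + g : ℝ) : ℂ) ≠ 0 := by
    rw [Complex.ofReal_ne_zero]; positivity
  have h2 : star h₁ = (((1 + g)⁻¹ : ℝ) : ℂ) •
      (star ((S.R hI)⁻¹ *ᵥ h₁) ᵥ* (vecMulVec h₁ (star h₁) + S.R hI)) := by
    rw [key, smul_smul, ← Complex.ofReal_mul, inv_mul_cancel₀ (by positivity)]
    simp
  rw [mmseCombiner]
  generalize vecMulVec h₁ (star h₁) + S.R hI = A at *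
  rw [h2, smul_vecMul, vecMul_vecMul, mul_nonsing_inv _ hAunit, vecMul_one]

/-- Both sides are p†Rp for p = R⁻¹h₁: expanding R gives the left side, and Rp = h₁ gives the right
side. This identity is why interference and noise combine so neatly behind the combiner. -/
lemma intSNR_mul_innerSq_add (h₁ hI : Fin N → ℂ) :
    innerSq hI ((S.R hI)⁻¹ *ᵥ h₁) + S.intSNR⁻¹ * vecSq ((S.R hI)⁻¹ *ᵥ h₁) =
      S.intSNR * residualPower S.intSNR h₁ hI := by
  set p := (S.R hI)⁻¹ *ᵥ h₁ with hp
  have hunit : IsUnit (S.R hI).det := (isUnit_iff_isUnit_det _).1 (S.R_posDef hI).isUnit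
  have hRp : S.R hI *ᵥ p = h₁ := by
    rw [hp, mulVec_mulVec, mul_nonsing_inv _ hunit, one_mulVec]
  have h1 : star p ⬝ᵥ (S.R hI *ᵥ p) = ((S.intSNR * residualPower S.intSNR h₁ hI : ℝ) : ℂ) := by
    rw [hRp, ← Complex.conj_ofReal, ← star_dotProduct_R_inv_mulVec, ← hp, ← Complex.star_def,
      ← star_dotProduct]
  have hin : star p ⬝ᵥ hI * star hI ⬝ᵥ p = (innerSq hI p : ℂ) := by
    have : star p ⬝ᵥ hI = star (star hI ⬝ᵥ p) := by
      rw [star_dotProduct]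
    rw [this, innerSq, Complex.star_def, Complex.conj_mul']
    push_cast; rfl
  rw [R_eq, add_mulVec, vecMulVec_mulVec, smul_mulVec, one_mulVec, op_smul_eq_smul,
    dotProduct_add, dotProduct_smul, dotProduct_smul, star_dotProduct_self, smul_eq_mul,
    smul_eq_mul, mul_comm (star hI ⬝ᵥ p), hin] at h1
  exact_mod_cast h1

/-- The end-to-end SINR of the MMSE/MRT scheme in terms of the two hop SINRs. -/
lemma γMMSE_eq (h₁ hI h₂ : Fin N → ℂ) (hh₁ : 0 < vecSq h₁) (hh₂ : 0 < vecSq h₂) :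
    S.γMMSE h₁ hI h₂ =
      S.γ₁ h₁ hI * S.γ₂ h₁ hI h₂ / (1 + S.γ₁ h₁ hI + S.γ₂ h₁ hI h₂) := by
  have hD₁ := S.D₁_pos
  have hD₂ := S.D₂_pos
  have hDI := S.DI_pos
  have hN₀ := S.N₀_pos
  have hPs := S.Ps_pos
  have hPI := S.PI_pos
  have hθ := S.one_sub_θ_pos
  have hη := S.η_pos
  have hθ' := S.θ_pos
  have hb := S.intSNR_pos
  have hI0 := vecSq_nonneg hI
  set g := S.intSNR * residualPower S.intSNR h₁ hI with hg
  have hres : 0 < residualPower S.intSNR h₁ hI :=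
    lt_of_lt_of_le (by positivity) (le_residualPower hb h₁ hI)
  have hg0 : 0 < g := mul_pos hb hres
  set p := (S.R hI)⁻¹ *ᵥ h₁ with hp
  set w := S.mmseCombiner h₁ hI with hw
  have hwp : w = (((1 + g)⁻¹ : ℝ) : ℂ) • star p := S.mmseCombiner_eq h₁ hI
  set s := vecSq h₂ with hs
  set k := S.relayPower h₁ hI with hk
  have hk0 : 0 < k := by rw [hk, relayPower]; positivity
  have hwh₁ : ‖w ⬝ᵥ h₁‖ ^ 2 = ((1 + g)⁻¹) ^ 2 * g ^ 2 := by
    have : star p ⬝ᵥ h₁ = (g : ℂ) := by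
      rw [← Complex.conj_ofReal, hg, ← star_dotProduct_R_inv_mulVec, ← hp, ← Complex.star_def,
        ← star_dotProduct]
    rw [hwp, smul_dotProduct, this, smul_eq_mul, ← Complex.ofReal_mul, Complex.norm_real,
      Real.norm_eq_abs, sq_abs, mul_pow]
  have hwhI : ‖w ⬝ᵥ hI‖ ^ 2 = ((1 + g)⁻¹) ^ 2 * innerSq hI p := by
    have : star p ⬝ᵥ hI = star (star hI ⬝ᵥ p) := by
      rw [star_dotProduct]
    rw [hwp, smul_dotProduct, this, smul_eq_mul, norm_mul, norm_star, mul_pow, Complex.norm_real,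
      Real.norm_eq_abs, sq_abs, innerSq]
  have hww : vecSq w = ((1 + g)⁻¹) ^ 2 * vecSq p := by
    rw [hwp, vecSq_smul, vecSq_star, Complex.norm_real, Real.norm_eq_abs, sq_abs]
  have hsum := S.intSNR_mul_innerSq_add h₁ hI
  rw [← hp, ← hg] at hsum
  -- Since (1-θ)PI/dI^τ · b⁻¹ = N₀, this is the identity p†Rp = g in physical units. It simplifies
  -- both the power normalization and the denominator of the SINR.
  have heq : (1 - S.θ) * S.PI / S.DI * innerSq hI p + S.N₀ * vecSq p =
      (1 - S.θ) * S.PI / S.DI * g := by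
    rw [← hsum, intSNR, ρI]
    field_simp
  have hsq : Real.sqrt s ^ 2 = s := Real.sq_sqrt hh₂.le
  have hsq0 : 0 < Real.sqrt s := Real.sqrt_pos.2 hh₂
  have hDdef : S.relayDirection h₁ hI h₂ =
      ((1 / Real.sqrt s : ℝ) : ℂ) • vecMulVec (star h₂) w := rfl
  have hnorm1 : ‖((1 / Real.sqrt s : ℝ) : ℂ)‖ ^ 2 = s⁻¹ := by
    rw [Complex.norm_real, Real.norm_eq_abs, sq_abs, div_pow, hsq, one_pow, one_div]
  have hmul : ∀ h : Fin N → ℂ, S.relayDirection h₁ hI h₂ *ᵥ h =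
      (((1 / Real.sqrt s : ℝ) : ℂ) * (w ⬝ᵥ h)) • star h₂ := fun h => by
    rw [hDdef, smul_mulVec, vecMulVec_mulVec, op_smul_eq_smul, smul_smul]
  have hvD : ∀ h : Fin N → ℂ, vecSq (S.relayDirection h₁ hI h₂ *ᵥ h) = ‖w ⬝ᵥ h‖ ^ 2 := fun h => by
    rw [hmul, vecSq_smul, norm_mul, mul_pow, hnorm1, vecSq_star, ← hs]
    field_simp
  have hmD : matSq (S.relayDirection h₁ hI h₂) = vecSq w := by
    rw [hDdef, matSq_smul_vecMulVec, hnorm1, vecSq_star, ← hs]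
    field_simp
  have hP : S.processedPower h₁ hI (S.relayDirection h₁ hI h₂) =
      ((1 + g)⁻¹) ^ 2 * ((1 - S.θ) * S.Ps / S.D₁ * g ^ 2 + (1 - S.θ) * S.PI / S.DI * g) := by
    rw [processedPower, hvD, hvD, hmD, hwh₁, hwhI, hww]
    linear_combination ((1 + g)⁻¹) ^ 2 * heq
  set P := S.processedPower h₁ hI (S.relayDirection h₁ hI h₂) with hPdef
  have hP0 : 0 < P := by rw [hP]; positivity
  have hω : ‖((Real.sqrt (k / P) : ℝ) : ℂ)‖ ^ 2 = k / P := by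
    rw [Complex.norm_real, Real.norm_eq_abs, sq_abs, Real.sq_sqrt (by positivity)]
  have hW : S.relayMatrix h₁ hI h₂ =
      ((Real.sqrt (k / P) : ℝ) : ℂ) • S.relayDirection h₁ hI h₂ := rfl
  have hnum : ∀ h : Fin N → ℂ, ‖h₂ ⬝ᵥ (S.relayMatrix h₁ hI h₂ *ᵥ h)‖ ^ 2 =
      k / P * s * ‖w ⬝ᵥ h‖ ^ 2 := fun h => by
    rw [hW, smul_mulVec, hmul, dotProduct_smul, dotProduct_smul, dotProduct_star_self, smul_eq_mul,
      smul_eq_mul, norm_mul, norm_mul, norm_mul, mul_pow, mul_pow, mul_pow, hω, hnorm1,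
      Complex.norm_real, Real.norm_eq_abs, sq_abs, ← hs]
    field_simp
  have hden : vecSq (h₂ ᵥ* S.relayMatrix h₁ hI h₂) = k / P * s * vecSq w := by
    rw [hW, vecMul_smul, vecSq_smul, hDdef, vecMul_smul, vecSq_smul, vecMul_vecMulVec,
      dotProduct_star_self, vecSq_smul, hω, hnorm1, Complex.norm_real, Real.norm_eq_abs, sq_abs,
      ← hs]
    field_simp
  have hγ₂ : S.γ₂ h₁ hI h₂ = k * s / (S.D₂ * S.N₀) := by
    rw [γ₂, ← hs, hk, relayPower, ρ₁, ρI]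
    field_simp
  have hγ₁ : S.γ₁ h₁ hI = (S.Ps / S.D₁) / (S.PI / S.DI) * g := by
    rw [γ₁_eq, hg, srcSNR, intSNR, ρ₁, ρI]
    field_simp
  have hγ₁0 : 0 < S.γ₁ h₁ hI := by rw [hγ₁]; positivity
  have hγ₂0 : 0 < S.γ₂ h₁ hI h₂ := by rw [hγ₂]; positivity
  have hdenom : (1 - S.θ) * S.PI / (S.DI * S.D₂) * (k / P * s * (((1 + g)⁻¹) ^ 2 * innerSq hI p)) +
      k / P * s * (((1 + g)⁻¹) ^ 2 * vecSq p) / S.D₂ * S.N₀ + S.N₀ =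
      (1 - S.θ) * S.PI / (S.DI * S.D₂) * (k / P * s * (((1 + g)⁻¹) ^ 2 * g)) + S.N₀ := by
    linear_combination (k / P * s * ((1 + g)⁻¹) ^ 2 / S.D₂) * heq
  rw [γMMSE, endToEndSINR, hnum, hnum, hden, hwh₁, hwhI, hww, hdenom, hP]
  have e1 : S.γ₁ h₁ hI = (S.Ps / S.D₁) / (S.PI / S.DI) * g := hγ₁
  rw [hγ₂, hγ₁]
  have h1g : 0 < 1 + g := by linarith
  field_simp
  ring

end RelayParams

/-! ### Erlang laws and squared norms of Gaussian vectors -/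

namespace ErlangLaw

open Set Filter Topology

/-- The measure on the positive half line with density `p`. -/
noncomputable def posDensity (p : ℝ → ℝ) : Measure ℝ :=
  volume.withDensity ((Ioi 0).indicator fun x => ENNReal.ofReal (p x))

lemma posDensity_eq (p : ℝ → ℝ) :
    posDensity p = (volume.restrict (Ioi 0)).withDensity (fun x => ENNReal.ofReal (p x)) :=
  withDensity_indicator measurableSet_Ioi _

lemma lintegral_posDensity {p : ℝ → ℝ} (hp : Measurable p) {f : ℝ → ENNReal} (hf : Measurable f) :
    ∫⁻ x, f x ∂(posDensity p) = ∫⁻ x in Ioi 0, ENNReal.ofReal (p x) * f x := by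
  rw [posDensity_eq, lintegral_withDensity_eq_lintegral_mul _ (by fun_prop) hf]
  rfl

lemma integral_posDensity {p : ℝ → ℝ} (hp : Measurable p) (hp0 : ∀ x, 0 < x → 0 ≤ p x)
    (f : ℝ → ℝ) : ∫ x, f x ∂(posDensity p) = ∫ x in Ioi 0, p x * f x := by
  rw [posDensity_eq, integral_withDensity_eq_integral_toReal_smul (by fun_prop) (by simp)]
  refine setIntegral_congr_fun measurableSet_Ioi fun x hx => ?_
  simp [ENNReal.toReal_ofReal (hp0 x hx)]

lemma integrable_posDensity_iff {p : ℝ → ℝ} (hp : Measurable p) (hp0 : ∀ x, 0 < x → 0 ≤ p x)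
    (f : ℝ → ℝ) : Integrable f (posDensity p) ↔ IntegrableOn (fun x => p x * f x) (Ioi 0) := by
  rw [posDensity_eq, integrable_withDensity_iff_integrable_smul' (by fun_prop) (by simp)]
  refine integrable_congr ?_
  filter_upwards [ae_restrict_mem measurableSet_Ioi] with x hx
  simp [ENNReal.toReal_ofReal (hp0 x hx)]

lemma ae_pos_posDensity (p : ℝ → ℝ) : ∀ᵐ x ∂(posDensity p), 0 < x := by
  rw [posDensity_eq]
  exact (withDensity_absolutelyContinuous _ _).ae_le (ae_restrict_mem measurableSet_Ioi)

/-- The convolution of two continuous densities on the positive half line. -/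
lemma posDensity_conv {p q : ℝ → ℝ} (hp : Continuous p) (hq : Continuous q)
    (hp0 : ∀ x, 0 < x → 0 ≤ p x) (hq0 : ∀ x, 0 < x → 0 ≤ q x) :
    posDensity p ∗ posDensity q = posDensity (fun u => ∫ y in (0 : ℝ)..u, p y * q (u - y)) := by
  have hp' := hp.measurable
  have hq' := hq.measurable
  rw [posDensity, posDensity, conv_withDensity_eq_lconvolution
    (Measurable.indicator (by fun_prop) measurableSet_Ioi)
    (Measurable.indicator (by fun_prop) measurableSet_Ioi), posDensity]
  congr 1
  ext u
  rw [lconvolution_def]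
  by_cases hu : u ∈ Ioi (0 : ℝ)
  · rw [indicator_of_mem hu, intervalIntegral.integral_of_le (le_of_lt hu),
      integral_Ioc_eq_integral_Ioo, ofReal_integral_eq_lintegral_ofReal,
      ← lintegral_indicator measurableSet_Ioo]
    · refine lintegral_congr fun y => ?_
      by_cases hy : y ∈ Ioo 0 u
      · rw [indicator_of_mem hy, indicator_of_mem (show y ∈ Ioi (0 : ℝ) from hy.1),
          indicator_of_mem (show -y + u ∈ Ioi (0 : ℝ) by simp; exact hy.2),
          ENNReal.ofReal_mul (hp0 y hy.1)]
        ring_nf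
      · rw [indicator_of_notMem hy]
        rw [mem_Ioo, not_and_or] at hy
        rcases hy with hy | hy
        · rw [indicator_of_notMem (show y ∉ Ioi (0 : ℝ) from hy), zero_mul]
        · rw [indicator_of_notMem (s := Ioi (0 : ℝ)) (a := -y + u) (by simpa using hy), mul_zero]
    · exact ((by fun_prop : Continuous fun y => p y * q (u - y)).continuousOn.integrableOn_Icc
        (a := 0) (b := u)).mono_set Ioo_subset_Icc_self
    · filter_upwards [ae_restrict_mem measurableSet_Ioo] with y hy
      exact mul_nonneg (hp0 y hy.1) (hq0 _ (by linarith [hy.2]))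
  · rw [indicator_of_notMem hu]
    refine (lintegral_congr fun y => ?_).trans lintegral_zero
    by_cases hy : y ∈ Ioi (0 : ℝ)
    · rw [indicator_of_notMem (s := Ioi (0 : ℝ)) (a := -y + u), mul_zero]
      simp at hu hy ⊢; linarith
    · rw [indicator_of_notMem hy, zero_mul]

/-- The density of the Erlang law with shape `n + 1` and rate `μ`. -/
noncomputable def erlangDensity (μ : ℝ) (n : ℕ) (x : ℝ) : ℝ :=
  μ ^ (n + 1) * (x ^ n / n.factorial * Real.exp (-(μ * x)))

@[fun_prop] lemma continuous_erlangDensity (μ : ℝ) (n : ℕ) : Continuous (erlangDensity μ n) := by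
  unfold erlangDensity; fun_prop

lemma erlangDensity_nonneg {μ : ℝ} (hμ : 0 < μ) (n : ℕ) {x : ℝ} (hx : 0 < x) :
    0 ≤ erlangDensity μ n x := by unfold erlangDensity; positivity

/-- The Erlang law with shape `n + 1` and rate `μ`. -/
noncomputable def erlang (μ : ℝ) (n : ℕ) : Measure ℝ := posDensity (erlangDensity μ n)

lemma integral_pow_mul_exp (n : ℕ) {μ : ℝ} (hμ : 0 < μ) :
    ∫ x in Ioi (0 : ℝ), x ^ n * Real.exp (-(μ * x)) = n.factorial / μ ^ (n + 1) := by
  have h := Real.integral_rpow_mul_exp_neg_mul_Ioi (a := n + 1) (r := μ) (by positivity) hμ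
  rw [Real.Gamma_nat_eq_factorial, add_sub_cancel_right] at h
  have e : (1 / μ) ^ ((n : ℝ) + 1) = 1 / μ ^ (n + 1) := by
    rw [show (n : ℝ) + 1 = ((n + 1 : ℕ) : ℝ) by push_cast; ring, Real.rpow_natCast, div_pow,
      one_pow]
  rw [e] at h
  simp only [Real.rpow_natCast] at h
  rw [h]; ring

lemma integrableOn_pow_mul_exp (n : ℕ) {μ : ℝ} (hμ : 0 < μ) :
    IntegrableOn (fun x : ℝ => x ^ n * Real.exp (-(μ * x))) (Ioi 0) := by
  by_contra h
  have := integral_pow_mul_exp n hμ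
  rw [integral_undef h] at this
  have : (0 : ℝ) < n.factorial / μ ^ (n + 1) := by positivity
  linarith

lemma integrableOn_erlangDensity {μ : ℝ} (hμ : 0 < μ) (n : ℕ) :
    IntegrableOn (erlangDensity μ n) (Ioi 0) := by
  have h := (integrableOn_pow_mul_exp n hμ).const_mul (μ ^ (n + 1) / n.factorial)
  refine h.congr (Eventually.of_forall fun x => ?_)
  simp only [erlangDensity]; ring

lemma integral_erlangDensity {μ : ℝ} (hμ : 0 < μ) (n : ℕ) :
    ∫ x in Ioi 0, erlangDensity μ n x = 1 := by
  have : ∀ x, erlangDensity μ n x =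
      μ ^ (n + 1) / n.factorial * (x ^ n * Real.exp (-(μ * x))) := fun x => by
    simp only [erlangDensity]; ring
  simp only [this]
  rw [integral_const_mul, integral_pow_mul_exp n hμ]
  field_simp

lemma isProbabilityMeasure_erlang {μ : ℝ} (hμ : 0 < μ) (n : ℕ) :
    IsProbabilityMeasure (erlang μ n) := by
  constructor
  rw [erlang, ← lintegral_one, lintegral_posDensity (by fun_prop) (by fun_prop)]
  simp only [mul_one]
  rw [← ofReal_integral_eq_lintegral_ofReal (integrableOn_erlangDensity hμ n),
    integral_erlangDensity hμ, ENNReal.ofReal_one]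
  filter_upwards [ae_restrict_mem measurableSet_Ioi] with x hx
  exact erlangDensity_nonneg hμ n hx

instance (n : ℕ) : IsProbabilityMeasure (erlang 1 n) := isProbabilityMeasure_erlang one_pos n

/-- For equal rates the exponentials combine to e^{-u}, so after y ↦ u - y only the integral of a
power is left. The first index is shape minus one, hence 0 for the exponential law. -/
lemma erlang_conv (n : ℕ) : erlang 1 0 ∗ erlang 1 n = erlang 1 (n + 1) := by
  rw [erlang, erlang, posDensity_conv (by fun_prop) (by fun_prop)
    (fun x hx => erlangDensity_nonneg one_pos _ hx) (fun x hx => erlangDensity_nonneg one_pos _ hx),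
    erlang]
  congr 1
  ext u
  have hsub := intervalIntegral.integral_comp_sub_left (a := 0) (b := u)
    (fun y => erlangDensity 1 0 y * erlangDensity 1 n (u - y)) u
  rw [sub_self, sub_zero] at hsub
  rw [← hsub]
  have : ∀ x, erlangDensity 1 0 (u - x) * erlangDensity 1 n (u - (u - x)) =
      Real.exp (-u) / n.factorial * x ^ n := fun x => by
    simp only [erlangDensity]
    rw [show Real.exp (-u) = Real.exp (-(1 * (u - x))) * Real.exp (-(1 * x)) by
      rw [← Real.exp_add]; ring_nf]
    simp
    ring
  simp only [this, intervalIntegral.integral_const_mul, integral_pow]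
  simp only [erlangDensity, Nat.factorial_succ]
  push_cast
  simp
  field_simp

lemma map_div_erlang {μ : ℝ} (hμ : 0 < μ) (n : ℕ) :
    (erlang 1 n).map (fun x => x / μ) = erlang μ n := by
  refine Measure.ext_of_lintegral _ fun f hf => ?_
  rw [lintegral_map hf (by fun_prop), erlang, erlang, lintegral_posDensity (by fun_prop)
    (by fun_prop), lintegral_posDensity (by fun_prop) (by fun_prop)]
  have himg : (fun x : ℝ => μ * x) '' Ioi 0 = Ioi 0 := by
    ext y
    simp only [mem_image, mem_Ioi]
    exact ⟨fun ⟨x, hx, h⟩ => h ▸ mul_pos hμ hx, fun hy => ⟨y / μ, by positivity, by field_simp⟩⟩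
  conv_lhs => rw [← himg]
  rw [lintegral_image_eq_lintegral_abs_deriv_mul measurableSet_Ioi
    (f' := fun _ => μ) (fun x _ => by simpa using ((hasDerivAt_id x).const_mul μ).hasDerivWithinAt)
    (fun x _ y _ h => mul_left_cancel₀ hμ.ne' h)]
  refine setLIntegral_congr_fun measurableSet_Ioi fun x hx => ?_
  rw [abs_of_pos hμ, ← mul_assoc, ← ENNReal.ofReal_mul hμ.le, mul_div_cancel_left₀ _ hμ.ne']
  congr 2
  simp only [erlangDensity]
  ring_nf

instance : IsProbabilityMeasure stdComplexGaussian :=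
  Measure.isProbabilityMeasure_map (by fun_prop)

lemma gaussianPDF_mul_gaussianPDF (x y : ℝ) :
    gaussianPDF 0 (1 / 2) x * gaussianPDF 0 (1 / 2) y =
      ENNReal.ofReal (Real.pi⁻¹ * Real.exp (-(x ^ 2 + y ^ 2))) := by
  rw [gaussianPDF, gaussianPDF, ← ENNReal.ofReal_mul (gaussianPDFReal_nonneg _ _ _)]
  congr 1
  have hs : (√Real.pi)⁻¹ * (√Real.pi)⁻¹ = Real.pi⁻¹ := by
    rw [← mul_inv, Real.mul_self_sqrt Real.pi_pos.le]
  simp only [gaussianPDFReal]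
  push_cast
  rw [show 2 * Real.pi * (1 / 2) = Real.pi by ring, ← hs,
    show -(x ^ 2 + y ^ 2) = -(x - 0) ^ 2 / (2 * (1 / 2)) + -(y - 0) ^ 2 / (2 * (1 / 2)) by ring,
    Real.exp_add]
  ring

/-- In polar coordinates the density is π⁻¹e^{-r²}r dr dφ; the angle contributes 2π, and 2r dr is
the differential of r². -/
lemma map_norm_sq_stdComplexGaussian :
    stdComplexGaussian.map (fun z => ‖z‖ ^ 2) = erlang 1 0 := by
  refine Measure.ext_of_lintegral _ fun f hf => ?_
  rw [lintegral_map hf (by fun_prop), stdComplexGaussian, lintegral_map (by fun_prop) (by fun_prop),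
    gaussianReal_of_var_ne_zero _ (by simp), prod_withDensity (by fun_prop) (by fun_prop),
    lintegral_withDensity_eq_lintegral_mul _ (by fun_prop) (by fun_prop), ← Measure.volume_eq_prod,
    ← lintegral_comp_polarCoord_symm, erlang, lintegral_posDensity (by fun_prop) hf]
  have himg : (fun x : ℝ => x ^ 2) '' Ioi 0 = Ioi 0 := by
    ext y
    simp only [mem_image, mem_Ioi]
    exact ⟨fun ⟨x, hx, h⟩ => h ▸ by positivity, fun hy => ⟨√y, by positivity, Real.sq_sqrt hy.le⟩⟩
  conv_rhs => rw [← himg]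
  rw [lintegral_image_eq_lintegral_abs_deriv_mul measurableSet_Ioi
    (f' := fun x => 2 * x) (fun x _ => by simpa using (hasDerivAt_pow 2 x).hasDerivWithinAt)
    (fun x hx y hy h => (pow_left_inj₀ (le_of_lt hx) (le_of_lt hy) two_ne_zero).1 h)]
  have hpt : ∀ p ∈ polarCoord.target, ENNReal.ofReal p.1 •
      ((fun z : ℝ × ℝ => gaussianPDF 0 (1 / 2) z.1 * gaussianPDF 0 (1 / 2) z.2) *
        fun a : ℝ × ℝ => f (‖Complex.measurableEquivRealProd.symm a‖ ^ 2)) (polarCoord.symm p) =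
      ENNReal.ofReal (p.1 * (Real.pi⁻¹ * Real.exp (-p.1 ^ 2))) * f (p.1 ^ 2) * 1 := by
    intro p hp
    have hp1 : 0 < p.1 := hp.1
    have hsum : (p.1 * Real.cos p.2) ^ 2 + (p.1 * Real.sin p.2) ^ 2 = p.1 ^ 2 := by
      have := Real.sin_sq_add_cos_sq p.2
      linear_combination p.1 ^ 2 * this
    simp only [Pi.mul_apply, polarCoord_symm_apply, gaussianPDF_mul_gaussianPDF, hsum, smul_eq_mul]
    rw [← mul_assoc, ← ENNReal.ofReal_mul hp1.le, mul_one, Complex.sq_norm, Complex.normSq_apply]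
    simp only [Complex.measurableEquivRealProd_symm_apply]
    rw [← sq, ← sq, hsum]
  rw [setLIntegral_congr_fun polarCoord.open_target.measurableSet hpt, polarCoord_target,
    Measure.volume_eq_prod, ← Measure.prod_restrict, lintegral_prod_mul
      (f := fun r => ENNReal.ofReal (r * (Real.pi⁻¹ * Real.exp (-r ^ 2))) * f (r ^ 2))
      (g := fun _ => 1) (by fun_prop) (by fun_prop)]
  rw [lintegral_one, Measure.restrict_apply_univ, Real.volume_Ioo,
    ← lintegral_mul_const _ (by fun_prop)]
  refine setLIntegral_congr_fun measurableSet_Ioi fun r hr => ?_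
  have hr : 0 < r := hr
  simp only [erlangDensity]
  rw [mul_right_comm, ← ENNReal.ofReal_mul (by positivity), ← mul_assoc (ENNReal.ofReal _),
    ← ENNReal.ofReal_mul (by positivity), abs_of_pos (by positivity)]
  congr 2
  simp
  field_simp
  ring

open RelayParams in
@[fun_prop] lemma continuous_vecSq {N : ℕ} : Continuous (vecSq (N := N)) := by
  unfold vecSq; fun_prop

/-- The law of a vector of `N` independent `CN(0,1)` variables. -/
noncomputable def gaussVec (N : ℕ) : Measure (Fin N → ℂ) := Measure.pi fun _ => stdComplexGaussian

instance (N : ℕ) : IsProbabilityMeasure (gaussVec N) := by unfold gaussVec; infer_instance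

lemma measurePreserving_consEquiv (n : ℕ) :
    MeasurePreserving (MeasurableEquiv.piFinSuccAbove (fun _ : Fin (n + 1) => ℂ) 0)
      (gaussVec (n + 1)) (stdComplexGaussian.prod (gaussVec n)) :=
  measurePreserving_piFinSuccAbove (fun _ => stdComplexGaussian) 0

open RelayParams in
-- Splitting off one coordinate adds an independent exponential variable, which raises the Erlang
-- shape by one.
lemma map_vecSq_gaussVec (n : ℕ) : (gaussVec (n + 1)).map vecSq = erlang 1 n := by
  induction n with
  | zero =>
    have h : (gaussVec (0 + 1)).map vecSq =
        ((gaussVec 1).map (fun h => h 0)).map (fun z => ‖z‖ ^ 2) := by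
      rw [Measure.map_map (by fun_prop) (by fun_prop)]
      congr 1
      ext v
      simp [vecSq]
    rw [h, gaussVec, Measure.pi_map_eval]
    simp [map_norm_sq_stdComplexGaussian]
  | succ n ih =>
    have hv : (vecSq : (Fin (n + 2) → ℂ) → ℝ) = (fun z : ℝ × ℝ => z.1 + z.2) ∘
        (Prod.map (fun z : ℂ => ‖z‖ ^ 2) vecSq) ∘
          (MeasurableEquiv.piFinSuccAbove (fun _ : Fin (n + 2) => ℂ) 0) := by
      ext v
      simp [vecSq, Fin.sum_univ_succ, MeasurableEquiv.piFinSuccAbove, Fin.tail]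
    rw [hv, ← Measure.map_map (by fun_prop) (by fun_prop), ← Measure.map_map (by fun_prop)
      (by fun_prop), (measurePreserving_consEquiv (n + 1)).map_eq,
      ← Measure.map_prod_map _ _ (by fun_prop) (by fun_prop), ih, map_norm_sq_stdComplexGaussian,
      ← erlang_conv]
    rfl

/-! ### Erlang tails -/

open Set Filter Topology RelayParams

/-- The tail `e^{-x} ∑_{k ≤ n} x^k / k!` of the Erlang law with shape `n + 1` and rate one. -/
noncomputable def erlangTail (n : ℕ) (x : ℝ) : ℝ :=
  Real.exp (-x) * ∑ k ∈ Finset.range (n + 1), x ^ k / k.factorial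

lemma erlangTail_nonneg (n : ℕ) {x : ℝ} (hx : 0 ≤ x) : 0 ≤ erlangTail n x := by
  unfold erlangTail; positivity

lemma hasDerivAt_erlangTail (n : ℕ) (x : ℝ) :
    HasDerivAt (erlangTail n) (-erlangDensity 1 n x) x := by
  have he : HasDerivAt (fun x : ℝ => Real.exp (-x)) (-Real.exp (-x)) x := by
    simpa using (hasDerivAt_neg x).exp
  induction n with
  | zero =>
    have h : erlangTail 0 = fun x => Real.exp (-x) := by ext y; simp [erlangTail]
    rw [h]
    simpa [erlangDensity] using he
  | succ n ih =>
    have h : erlangTail (n + 1) = fun x => erlangTail n x +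
        Real.exp (-x) * (x ^ (n + 1) / (n + 1).factorial) := by
      ext y; simp only [erlangTail]; rw [Finset.sum_range_succ _ (n + 1), mul_add]
    rw [h]
    refine (ih.fun_add (he.fun_mul
      ((hasDerivAt_pow (n + 1) x).div_const ((n + 1).factorial : ℝ)))).congr_deriv ?_
    simp only [erlangDensity, Nat.factorial_succ]
    push_cast
    field_simp
    ring

lemma tendsto_erlangTail (n : ℕ) : Tendsto (erlangTail n) atTop (𝓝 0) := by
  have h : ∀ x, erlangTail n x =
      ∑ k ∈ Finset.range (n + 1), (x ^ k * Real.exp (-x)) / k.factorial := fun x => by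
    rw [erlangTail, Finset.mul_sum]
    exact Finset.sum_congr rfl fun k _ => by ring
  rw [show (0 : ℝ) = ∑ k ∈ Finset.range (n + 1), (0 : ℝ) / k.factorial by simp]
  simp only [funext h]
  exact tendsto_finsetSum _ fun k _ =>
    (Real.tendsto_pow_mul_exp_neg_atTop_nhds_zero k).div_const _

lemma integral_Ioi_erlangDensity (n : ℕ) {x : ℝ} (hx : 0 ≤ x) :
    ∫ t in Ioi x, erlangDensity 1 n t = erlangTail n x := by
  have h := integral_Ioi_of_hasDerivAt_of_tendsto' (a := x) (f := fun t => -erlangTail n t)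
    (f' := erlangDensity 1 n) (m := 0)
    (fun t _ => by have := (hasDerivAt_erlangTail n t).neg; rw [neg_neg] at this; exact this)
    ((integrableOn_erlangDensity one_pos n).mono_set (Ioi_subset_Ioi hx))
    (by simpa using (tendsto_erlangTail n).neg)
  rw [h]; ring

lemma erlang_Ioi (n : ℕ) {x : ℝ} (hx : 0 ≤ x) :
    erlang 1 n (Ioi x) = ENNReal.ofReal (erlangTail n x) := by
  rw [erlang, posDensity_eq, withDensity_apply _ measurableSet_Ioi,
    Measure.restrict_restrict measurableSet_Ioi, Ioi_inter_Ioi, max_eq_left hx,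
    ← integral_Ioi_erlangDensity n hx, ofReal_integral_eq_lintegral_ofReal
      ((integrableOn_erlangDensity one_pos n).mono_set (Ioi_subset_Ioi hx))]
  filter_upwards [ae_restrict_mem measurableSet_Ioi] with t ht
  exact erlangDensity_nonneg one_pos n (lt_of_le_of_lt hx ht)

lemma erlang_zero_Ioi (x : ℝ) :
    erlang 1 0 (Ioi x) = ENNReal.ofReal (Real.exp (-(max x 0))) := by
  rcases le_total 0 x with hx | hx
  · rw [erlang_Ioi 0 hx, max_eq_left hx]; simp [erlangTail]
  · rw [max_eq_right hx, neg_zero, Real.exp_zero, ENNReal.ofReal_one]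
    refine le_antisymm prob_le_one ?_
    calc (1 : ENNReal) = erlang 1 0 (Ioi 0) := by rw [erlang_Ioi 0 le_rfl]; simp [erlangTail]
      _ ≤ _ := measure_mono (Ioi_subset_Ioi hx)

/-! ### Unitary invariance -/

lemma charFun_stdComplexGaussian (t : ℂ) :
    charFun stdComplexGaussian t = Complex.exp (-(‖t‖ ^ 2 / 4 : ℝ)) := by
  rw [charFun_apply, stdComplexGaussian, integral_map (by fun_prop) (by fun_prop)]
  have h : ∀ z : ℝ × ℝ, Complex.exp ((inner ℝ (Complex.measurableEquivRealProd.symm z) t : ℝ) *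
      Complex.I) = Complex.exp (t.re * z.1 * Complex.I) * Complex.exp (t.im * z.2 * Complex.I) := by
    intro z
    rw [← Complex.exp_add, Complex.inner]
    congr 1
    simp [Complex.measurableEquivRealProd_symm_apply]
    ring
  simp only [h]
  rw [integral_prod_mul (fun x : ℝ => Complex.exp (t.re * x * Complex.I))
    (fun y : ℝ => Complex.exp (t.im * y * Complex.I)), ← charFun_apply_real, ← charFun_apply_real,
    charFun_gaussianReal, charFun_gaussianReal, ← Complex.exp_add]
  congr 1
  rw [Complex.sq_norm, Complex.normSq_apply]
  push_cast
  ring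

/-- The Gaussian vector as a random element of the Euclidean space. -/
noncomputable def gaussEuclidean (N : ℕ) : Measure (EuclideanSpace ℂ (Fin N)) :=
  (gaussVec N).map (WithLp.toLp 2)

instance (N : ℕ) : IsProbabilityMeasure (gaussEuclidean N) :=
  Measure.isProbabilityMeasure_map (by fun_prop)

lemma charFun_gaussEuclidean (N : ℕ) (t : EuclideanSpace ℂ (Fin N)) :
    charFun (gaussEuclidean N) t = Complex.exp (-(‖t‖ ^ 2 / 4 : ℝ)) := by
  rw [gaussEuclidean, gaussVec, charFun_pi, EuclideanSpace.norm_sq_eq]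
  simp only [charFun_stdComplexGaussian]
  rw [← Complex.exp_sum]
  congr 1
  push_cast
  rw [Finset.sum_div, Finset.sum_neg_distrib]

/-- The characteristic function depends on its argument only through the norm. It is built from the
real inner product, so the isometry is first regarded as real-linear. -/
lemma map_linearIsometryEquiv_gaussEuclidean {N : ℕ}
    (e : EuclideanSpace ℂ (Fin N) ≃ₗᵢ[ℂ] EuclideanSpace ℂ (Fin N)) :
    (gaussEuclidean N).map e = gaussEuclidean N := by
  have hm : Measurable e := e.continuous.measurable
  have := Measure.isProbabilityMeasure_map (μ := gaussEuclidean N) hm.aemeasurable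
  let e' : EuclideanSpace ℂ (Fin N) ≃ₗᵢ[ℝ] EuclideanSpace ℂ (Fin N) :=
    { e.toLinearEquiv.restrictScalars ℝ with norm_map' := e.norm_map }
  refine Measure.ext_of_charFun ?_
  ext t
  have h : charFun ((gaussEuclidean N).map e) t = charFun (gaussEuclidean N) (e'.symm t) := by
    rw [charFun_apply, charFun_apply, integral_map hm.aemeasurable (by fun_prop)]
    refine integral_congr_ae (Eventually.of_forall fun x => ?_)
    have : inner ℝ (e' x) t = inner ℝ x (e'.symm t) := by
      rw [← e'.inner_map_map x, e'.apply_symm_apply]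
    exact congrArg (fun r : ℝ => Complex.exp (r * Complex.I)) this
  rw [h, charFun_gaussEuclidean, charFun_gaussEuclidean, e'.symm.norm_map]

/-- The law of the residual power given the interference channel. -/
lemma map_residual_gaussVec (n : ℕ) {b : ℝ} (hb : 0 < b) (v : Fin (n + 1) → ℂ) :
    (gaussVec (n + 1)).map (fun h => residualPower b h v) =
      (gaussVec (n + 1)).map
        (fun h => ‖h 0‖ ^ 2 / (1 + b * vecSq v) + vecSq (fun i : Fin n => h i.succ)) := by
  have hZ := vecSq_nonneg v
  have hpos : 0 < 1 + b * vecSq v := by positivity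
  have hsplit : ∀ h : Fin (n + 1) → ℂ, vecSq h = ‖h 0‖ ^ 2 + vecSq (fun i : Fin n => h i.succ) :=
    fun h => by simp [vecSq, Fin.sum_univ_succ]
  -- A zero interference vector has no direction to rotate onto an axis, but then the two functions
  -- agree pointwise.
  rcases hZ.eq_or_lt with hZ0 | hZ0
  · congr 1
    ext h
    have h1 := innerSq_le v h
    have h2 := innerSq_nonneg v h
    rw [← hZ0, zero_mul] at h1
    rw [residualPower, le_antisymm h1 h2, ← hZ0, hsplit h]
    simp
  set V : EuclideanSpace ℂ (Fin (n + 1)) := WithLp.toLp 2 v with hV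
  have hVn : ‖V‖ ^ 2 = vecSq v := by rw [EuclideanSpace.norm_sq_eq]; rfl
  have hVpos : 0 < ‖V‖ := by
    by_contra h
    have : ‖V‖ = 0 := le_antisymm (not_lt.1 h) (norm_nonneg _)
    rw [this] at hVn
    norm_num at hVn
    linarith
  set u : EuclideanSpace ℂ (Fin (n + 1)) := ((‖V‖⁻¹ : ℝ) : ℂ) • V with hu
  have hun : ‖u‖ = 1 := by
    rw [hu, norm_smul, Complex.norm_real, norm_inv, norm_norm, inv_mul_cancel₀ hVpos.ne']
  -- An orthonormal basis starting with v/‖v‖. In its coordinates |v†h|² = ‖v‖²|h₀|², so suppression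
  -- scales the coordinate power |h₀|² by 1 - b‖v‖²/(1 + b‖v‖²) and leaves the others alone.
  obtain ⟨B, hB⟩ := Orthonormal.exists_orthonormalBasis_extension_of_card_eq (𝕜 := ℂ)
    (E := EuclideanSpace ℂ (Fin (n + 1))) (ι := Fin (n + 1)) (by simp) (v := fun _ => u)
    (s := {0}) (by
      rw [orthonormal_iff_ite]
      rintro ⟨i, hi⟩ ⟨j, hj⟩
      simp only [mem_singleton_iff] at hi hj
      subst hi hj
      simp [hun])
  have hB0 : B 0 = u := hB 0 rfl
  have hrot : ((((gaussVec (n + 1)).map (WithLp.toLp 2)).map B.repr).map WithLp.ofLp) =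
      gaussVec (n + 1) := by
    rw [← gaussEuclidean, map_linearIsometryEquiv_gaussEuclidean, gaussEuclidean,
      Measure.map_map (by fun_prop) (by fun_prop)]
    exact Measure.map_id
  have hBm : Measurable B.repr := B.repr.continuous.measurable
  have hcont : Measurable (fun h : Fin (n + 1) → ℂ =>
      ‖h 0‖ ^ 2 / (1 + b * vecSq v) + vecSq (fun i : Fin n => h i.succ)) := by
    refine Continuous.measurable (Continuous.add (by fun_prop) (continuous_vecSq.comp (by fun_prop)))
  conv_rhs => rw [← hrot]
  rw [Measure.map_map hcont (by fun_prop), Measure.map_map (hcont.comp (by fun_prop)) hBm,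
    Measure.map_map ((hcont.comp (by fun_prop)).comp hBm) (by fun_prop)]
  congr 1
  ext h
  simp only [Function.comp_apply]
  set y : EuclideanSpace ℂ (Fin (n + 1)) := B.repr (WithLp.toLp 2 h) with hy
  have hy2 : vecSq y.ofLp = vecSq h := by
    have h1 : ‖y‖ ^ 2 = ‖(WithLp.toLp 2 h : EuclideanSpace ℂ (Fin (n + 1)))‖ ^ 2 := by
      rw [hy, B.repr.norm_map]
    rw [EuclideanSpace.norm_sq_eq, EuclideanSpace.norm_sq_eq] at h1
    exact h1
  have hy0 : ‖y.ofLp 0‖ ^ 2 * vecSq v = innerSq v h := by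
    have h1 : y.ofLp 0 = inner ℂ u (WithLp.toLp 2 h) := by
      rw [← hB0, ← OrthonormalBasis.repr_apply_apply]
    have h2 : inner ℂ V (WithLp.toLp 2 h) = star v ⬝ᵥ h := by
      rw [hV, EuclideanSpace.inner_toLp_toLp, dotProduct_comm]
    rw [h1, hu, inner_smul_left, h2, norm_mul, RCLike.norm_conj, Complex.norm_real, mul_pow,
      Real.norm_eq_abs, sq_abs, innerSq, ← hVn]
    field_simp
  have hs := hsplit y.ofLp
  rw [hy2] at hs
  rw [residualPower, ← hy0, hs]
  field_simp
  ring

/-! ### The tail of the residual power -/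

/-- The tail of the law of the residual power for independent Gaussian vectors of length
`n + 1`. -/
noncomputable def residualTail (b : ℝ) (n : ℕ) (x : ℝ) : ℝ :=
  erlangTail n x - erlangDensity 1 n x * (b * x / (1 + b * x))

@[fun_prop] lemma continuous_innerSq {N : ℕ} :
    Continuous fun p : (Fin N → ℂ) × (Fin N → ℂ) => innerSq p.1 p.2 := by
  unfold innerSq dotProduct
  simp only [Pi.star_apply]
  fun_prop

lemma measurable_residualPower {N : ℕ} (b : ℝ) :
    Measurable fun p : (Fin N → ℂ) × (Fin N → ℂ) => residualPower b p.1 p.2 := by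
  have h1 : Measurable fun p : (Fin N → ℂ) × (Fin N → ℂ) => innerSq p.2 p.1 :=
    (continuous_innerSq.comp continuous_swap).measurable
  have h2 := (continuous_vecSq (N := N)).measurable
  unfold residualPower
  fun_prop

lemma measurable_residualPower_left {N : ℕ} (b : ℝ) (v : Fin N → ℂ) :
    Measurable fun h : Fin N → ℂ => residualPower b h v := by
  have h1 : Continuous fun h : Fin N → ℂ => innerSq v h := by
    unfold innerSq dotProduct
    fun_prop
  have h2 := (continuous_vecSq (N := N)).measurable
  have h3 := h1.measurable
  unfold residualPower
  fun_prop

/-- The Laplace transform of an Erlang law: the exponential factor changes the rate from 1 to 1 + c.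
-/
lemma lintegral_exp_erlang (n : ℕ) {c : ℝ} (hc : 0 ≤ c) :
    ∫⁻ z, ENNReal.ofReal (Real.exp (-(c * z))) ∂(erlang 1 n) =
      ENNReal.ofReal (1 / (1 + c) ^ (n + 1)) := by
  have hpos : 0 < 1 + c := by linarith
  have hden : ∀ z, erlangDensity 1 n z * Real.exp (-(c * z)) =
      1 / n.factorial * (z ^ n * Real.exp (-((1 + c) * z))) := fun z => by
    rw [erlangDensity, show -((1 + c) * z) = -(1 * z) + -(c * z) by ring, Real.exp_add]
    simp; ring
  rw [erlang, lintegral_posDensity (by fun_prop) (by fun_prop)]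
  have h : ∫⁻ z in Ioi (0 : ℝ), ENNReal.ofReal (erlangDensity 1 n z) *
      ENNReal.ofReal (Real.exp (-(c * z))) = ∫⁻ z in Ioi (0 : ℝ),
        ENNReal.ofReal (1 / n.factorial * (z ^ n * Real.exp (-((1 + c) * z)))) := by
    refine setLIntegral_congr_fun measurableSet_Ioi fun z hz => ?_
    rw [← hden, ENNReal.ofReal_mul (erlangDensity_nonneg one_pos n hz)]
  rw [h, ← ofReal_integral_eq_lintegral_ofReal
    ((integrableOn_pow_mul_exp n hpos).const_mul _), integral_const_mul, integral_pow_mul_exp n hpos]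
  · congr 1
    field_simp
  · filter_upwards [ae_restrict_mem measurableSet_Ioi] with z hz
    have hz : 0 < z := hz
    positivity

/-- `e^{-y} / (1 + b y)^{n+1}` with `y = (x - X)⁺`: the probability that the power exceeds `x`
given that the components orthogonal to the interference have power `X`. -/
noncomputable def condTail (b : ℝ) (n : ℕ) (x X : ℝ) : ℝ :=
  Real.exp (-(max (x - X) 0)) / (1 + b * max (x - X) 0) ^ (n + 1)

lemma condTail_nonneg {b : ℝ} (hb : 0 < b) (n : ℕ) (x X : ℝ) : 0 ≤ condTail b n x X := by
  have := le_max_right (x - X) 0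
  unfold condTail
  positivity

lemma continuous_condTail {b : ℝ} (hb : 0 < b) (n : ℕ) (x : ℝ) : Continuous (condTail b n x) := by
  unfold condTail
  refine Continuous.div (by fun_prop) (by fun_prop) fun X => ?_
  have := le_max_right (x - X) 0
  positivity

lemma condTail_le_one {b : ℝ} (hb : 0 < b) (n : ℕ) (x X : ℝ) : condTail b n x X ≤ 1 := by
  have h := le_max_right (x - X) 0
  have h2 : 0 ≤ b * max (x - X) 0 := by positivity
  unfold condTail
  refine div_le_one_of_le₀ ?_ (by positivity)
  calc _ ≤ (1 : ℝ) := Real.exp_le_one_iff.2 (by linarith)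
    _ ≤ _ := one_le_pow₀ (by linarith)

/-- Fix the interference v and the orthogonal components, of power X. The remaining coordinate is
exponential, so the threshold is exceeded with probability e^{-y(1 + b‖v‖²)}, y = (x - X)⁺. After
exchanging the integrals, the mean over ‖v‖² is a Laplace transform of an Erlang law. -/
lemma measure_residualPower_eq_lintegral (n : ℕ) {b : ℝ} (hb : 0 < b) (x : ℝ) :
    ((gaussVec (n + 1)).prod (gaussVec (n + 1))) {p | x < residualPower b p.1 p.2} =
      ∫⁻ h, ENNReal.ofReal (condTail b n x (vecSq h)) ∂(gaussVec n) := by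
  have hmeas := measurable_residualPower (N := n + 1) b
  have hvs : ∀ N, Measurable (vecSq (N := N)) := fun N => continuous_vecSq.measurable
  have hvs1 := hvs (n + 1)
  have hvs2 := hvs n
  rw [Measure.prod_apply_symm (measurableSet_lt measurable_const hmeas)]
  have h1 : ∀ v : Fin (n + 1) → ℂ, (gaussVec (n + 1))
      ((fun h => (h, v)) ⁻¹' {p | x < residualPower b p.1 p.2}) =
      ∫⁻ h, ENNReal.ofReal (Real.exp (-(max (x - vecSq h) 0 * (1 + b * vecSq v))))
        ∂(gaussVec n) := by
    intro v
    have hZ := vecSq_nonneg v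
    have hpos : 0 < 1 + b * vecSq v := by positivity
    have hm : Measurable fun h : Fin (n + 1) → ℂ => residualPower b h v :=
      measurable_residualPower_left b v
    have e1 : (gaussVec (n + 1)) ((fun h => (h, v)) ⁻¹' {p | x < residualPower b p.1 p.2}) =
        ((gaussVec (n + 1)).map (fun h => residualPower b h v)) (Ioi x) := by
      rw [Measure.map_apply hm measurableSet_Ioi]; rfl
    set Ψ : ℂ × (Fin n → ℂ) → ℝ := fun p => ‖p.1‖ ^ 2 / (1 + b * vecSq v) + vecSq p.2 with hΨ
    have hΨm : Measurable Ψ := by fun_prop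
    have e2 : (fun h : Fin (n + 1) → ℂ =>
        ‖h 0‖ ^ 2 / (1 + b * vecSq v) + vecSq (fun i : Fin n => h i.succ)) =
        Ψ ∘ MeasurableEquiv.piFinSuccAbove (fun _ : Fin (n + 1) => ℂ) 0 := by
      ext h; rfl
    rw [e1, map_residual_gaussVec n hb v, e2, ← Measure.map_map hΨm (by fun_prop),
      (measurePreserving_consEquiv n).map_eq, Measure.map_apply hΨm measurableSet_Ioi,
      Measure.prod_apply_symm (hΨm measurableSet_Ioi)]
    refine lintegral_congr fun h => ?_
    have e3 : (fun y : ℂ => (y, h)) ⁻¹' (Ψ ⁻¹' Ioi x) =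
        (fun z : ℂ => ‖z‖ ^ 2) ⁻¹' Ioi ((x - vecSq h) * (1 + b * vecSq v)) := by
      ext z
      simp only [hΨ, mem_preimage, mem_Ioi]
      rw [← sub_lt_iff_lt_add, lt_div_iff₀ hpos]
    rw [e3, ← Measure.map_apply (by fun_prop) measurableSet_Ioi, map_norm_sq_stdComplexGaussian,
      erlang_zero_Ioi, max_mul_of_nonneg _ _ hpos.le, zero_mul]
  simp only [h1]
  rw [lintegral_lintegral_swap (by fun_prop)]
  refine lintegral_congr fun h => ?_
  have hy := le_max_right (x - vecSq h) 0
  set y := max (x - vecSq h) 0 with hydef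
  have e4 : ∀ v : Fin (n + 1) → ℂ, ENNReal.ofReal (Real.exp (-(y * (1 + b * vecSq v)))) =
      ENNReal.ofReal (Real.exp (-y)) * ENNReal.ofReal (Real.exp (-(b * y * vecSq v))) := fun v => by
    rw [← ENNReal.ofReal_mul (Real.exp_pos _).le, ← Real.exp_add]
    ring_nf
  simp only [e4]
  have e5 := lintegral_map (μ := gaussVec (n + 1)) (g := vecSq)
    (f := fun z => ENNReal.ofReal (Real.exp (-(b * y * z)))) (by fun_prop) (by fun_prop)
  rw [lintegral_const_mul _ (by fun_prop), ← e5, map_vecSq_gaussVec,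
    lintegral_exp_erlang n (by positivity), ← ENNReal.ofReal_mul (Real.exp_pos _).le, condTail,
    ← hydef]
  congr 1
  ring

/-- Beyond x the orthogonal power alone exceeds the threshold and contributes an Erlang tail. Below
x the exponentials merge into e^{-x}, and a rational function with an explicit primitive is left. -/
lemma integral_condTail (k : ℕ) {b : ℝ} (hb : 0 < b) {x : ℝ} (hx : 0 ≤ x) :
    ∫ X in Ioi 0, erlangDensity 1 k X * condTail b (k + 1) x X = residualTail b (k + 1) x := by
  have hint : IntegrableOn (fun X => erlangDensity 1 k X * condTail b (k + 1) x X) (Ioi 0) := by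
    refine (integrableOn_erlangDensity one_pos k).mono'
      ((continuous_erlangDensity 1 k).mul (continuous_condTail hb (k + 1) x)).aestronglyMeasurable ?_
    filter_upwards [ae_restrict_mem measurableSet_Ioi] with X hX
    have h1 := erlangDensity_nonneg one_pos k hX
    rw [Real.norm_of_nonneg (mul_nonneg h1 (condTail_nonneg hb _ _ _))]
    exact mul_le_of_le_one_right h1 (condTail_le_one hb _ _ _)
  have hsplit := setIntegral_union (μ := volume) (Ioc_disjoint_Ioi_same (a := (0 : ℝ)) (b := x))
    measurableSet_Ioi (hint.mono_set Ioc_subset_Ioi_self) (hint.mono_set (Ioi_subset_Ioi hx))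
  rw [Ioc_union_Ioi_eq_Ioi hx] at hsplit
  rw [hsplit]
  have h2 : ∫ X in Ioi x, erlangDensity 1 k X * condTail b (k + 1) x X = erlangTail k x := by
    rw [← integral_Ioi_erlangDensity k hx]
    refine setIntegral_congr_fun measurableSet_Ioi fun X hX => ?_
    have hX : x < X := hX
    simp only [condTail]
    rw [max_eq_right (by linarith)]
    simp
  have h3 : ∫ X in Ioc 0 x, erlangDensity 1 k X * condTail b (k + 1) x X =
      Real.exp (-x) / ((k + 1).factorial * (1 + b * x)) * x ^ (k + 1) := by
    rw [← intervalIntegral.integral_of_le hx]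
    -- With w = 1 + b(x - X), the derivative of X/w is (w + bX)/w² = (1 + bx)/w², which explains the
    -- constant 1 + bx in the denominator of the primitive.
    have hderiv : ∀ X ∈ uIcc 0 x, HasDerivAt (fun X => Real.exp (-x) /
        ((k + 1).factorial * (1 + b * x)) * (X / (1 + b * (x - X))) ^ (k + 1))
        (erlangDensity 1 k X * condTail b (k + 1) x X) X := by
      intro X hX
      rw [uIcc_of_le hx] at hX
      have hpos : 0 < 1 + b * (x - X) := by
        have : 0 ≤ x - X := by linarith [hX.2]
        positivity
      have hposx : 0 < 1 + b * x := by positivity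
      have hd : HasDerivAt (fun X => 1 + b * (x - X)) (-b) X := by
        simpa using (((hasDerivAt_id X).const_sub x).const_mul b).const_add 1
      set w := 1 + b * (x - X) with hw
      have hxw : 1 + b * x = w + b * X := by rw [hw]; ring
      have := (((hasDerivAt_id X).fun_div hd hpos.ne').fun_pow (k + 1)).const_mul
        (Real.exp (-x) / ((k + 1).factorial * (1 + b * x)))
      refine this.congr_deriv ?_
      simp only [erlangDensity, condTail, id]
      rw [max_eq_left (by linarith [hX.2]), show Real.exp (-x) =
        Real.exp (-(1 * X)) * Real.exp (-(x - X)) by rw [← Real.exp_add]; ring_nf,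
        Nat.factorial_succ, ← hw]
      generalize 1 + b * x = D at hposx hxw
      simp only [Nat.add_sub_cancel, one_pow, one_mul, div_pow]
      clear_value w
      push_cast
      field_simp
      rw [hxw]
      ring
    rw [intervalIntegral.integral_eq_sub_of_hasDerivAt hderiv
      ((Continuous.mul (by fun_prop) (continuous_condTail hb _ _)).intervalIntegrable _ _)]
    simp
  have hposx : 0 < 1 + b * x := by positivity
  rw [h2, h3, residualTail, erlangTail, erlangTail, Finset.sum_range_succ _ (k + 1), erlangDensity]
  simp
  field_simp
  ring

lemma measure_residualPower_gt (n : ℕ) {b : ℝ} (hb : 0 < b) {x : ℝ} (hx : 0 ≤ x) :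
    ((gaussVec (n + 1)).prod (gaussVec (n + 1))) {p | x < residualPower b p.1 p.2} =
      ENNReal.ofReal (residualTail b n x) := by
  rw [measure_residualPower_eq_lintegral n hb x]
  cases n with
  -- With a single antenna no components are orthogonal to the interference, so X = 0 and there is
  -- nothing to average.
  | zero =>
    have : ∀ h : Fin 0 → ℂ, condTail b 0 x (vecSq h) = residualTail b 0 x := fun h => by
      have hposx : 0 < 1 + b * x := by positivity
      simp [condTail, vecSq, hx, residualTail, erlangTail, erlangDensity]
      field_simp
      ring
    simp [this]
  | succ k =>
    have hc := continuous_condTail hb (k + 1) x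
    have e5 := lintegral_map (μ := gaussVec (k + 1)) (g := vecSq)
      (f := fun z => ENNReal.ofReal (condTail b (k + 1) x z)) (by fun_prop) (by fun_prop)
    rw [← e5, map_vecSq_gaussVec, ← integral_condTail k hb hx,
      ← integral_posDensity (by fun_prop) (fun X hX => erlangDensity_nonneg one_pos k hX), ← erlang,
      ofReal_integral_eq_lintegral_ofReal]
    · refine Integrable.of_bound hc.aestronglyMeasurable 1 (Eventually.of_forall fun X => ?_)
      rw [Real.norm_of_nonneg (condTail_nonneg hb _ _ _)]
      exact condTail_le_one hb _ _ _
    · exact Eventually.of_forall fun X => condTail_nonneg hb _ _ _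

/-! ### Logarithmic means and the layer cake formula -/

open Set Filter Topology RelayParams SpecialFun

lemma integral_div_one_add_mul {a : ℝ} (ha : 0 < a) {x : ℝ} (hx : 0 ≤ x) :
    ∫ t in (0 : ℝ)..x, a / (1 + a * t) = Real.log (1 + a * x) := by
  have hd : ∀ t ∈ uIcc 0 x, HasDerivAt (fun t => Real.log (1 + a * t)) (a / (1 + a * t)) t := by
    intro t ht
    rw [uIcc_of_le hx] at ht
    have h0 : 0 ≤ t := ht.1
    have hpos : 0 < 1 + a * t := by positivity
    have : HasDerivAt (fun t => 1 + a * t) a t := by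
      simpa using ((hasDerivAt_id t).const_mul a).const_add 1
    exact this.log hpos.ne'
  rw [intervalIntegral.integral_eq_sub_of_hasDerivAt hd]
  · simp
  · refine ContinuousOn.intervalIntegrable (ContinuousOn.div (by fun_prop) (by fun_prop) ?_)
    intro t ht
    rw [uIcc_of_le hx] at ht
    have h0 : 0 ≤ t := ht.1
    positivity

/-- The layer cake formula for `E log (1 + a T)`. -/
lemma integral_log_one_add_eq_integral_tail {Ω : Type*} [MeasurableSpace Ω] (μ : Measure Ω)
    {T : Ω → ℝ} (hT : AEMeasurable T μ) (hT0 : 0 ≤ᵐ[μ] T) {F : ℝ → ℝ} (hF : IntegrableOn F (Ioi 0))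
    (hF0 : ∀ t, 0 < t → 0 ≤ F t) (htail : ∀ t, 0 < t → μ {ω | t < T ω} = ENNReal.ofReal (F t))
    {a : ℝ} (ha : 0 < a) :
    Integrable (fun ω => Real.log (1 + a * T ω)) μ ∧
      ∫ ω, Real.log (1 + a * T ω) ∂μ = ∫ t in Ioi 0, a / (1 + a * t) * F t := by
  have hg0 : ∀ᵐ t ∂volume.restrict (Ioi (0 : ℝ)), 0 ≤ a / (1 + a * t) := by
    filter_upwards [ae_restrict_mem measurableSet_Ioi] with t ht
    have ht : 0 < t := ht
    positivity
  have hcont : ∀ t > (0 : ℝ), IntervalIntegrable (fun t => a / (1 + a * t)) volume 0 t := by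
    intro x hx
    refine ContinuousOn.intervalIntegrable (ContinuousOn.div (by fun_prop) (by fun_prop) ?_)
    intro t ht
    rw [uIcc_of_le hx.le] at ht
    have h0 : 0 ≤ t := ht.1
    positivity
  have key := lintegral_comp_eq_lintegral_meas_lt_mul μ hT0 hT hcont hg0
  have hl : ∫⁻ ω, ENNReal.ofReal (∫ t in (0 : ℝ)..T ω, a / (1 + a * t)) ∂μ =
      ∫⁻ ω, ENNReal.ofReal (Real.log (1 + a * T ω)) ∂μ := by
    refine lintegral_congr_ae ?_
    filter_upwards [hT0] with ω hω
    rw [integral_div_one_add_mul ha hω]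
  have hint : IntegrableOn (fun t => a / (1 + a * t) * F t) (Ioi 0) := by
    refine Integrable.bdd_mul (c := a) hF ?_ ?_
    · refine Measurable.aestronglyMeasurable ?_
      fun_prop
    · filter_upwards [ae_restrict_mem measurableSet_Ioi, hg0] with t ht h0
      have ht : 0 < t := ht
      rw [Real.norm_of_nonneg h0]
      exact div_le_self ha.le (by nlinarith [mul_pos ha ht])
  have hint0 : 0 ≤ᵐ[volume.restrict (Ioi 0)] fun t => a / (1 + a * t) * F t := by
    filter_upwards [ae_restrict_mem measurableSet_Ioi, hg0] with t ht h0
    exact mul_nonneg h0 (hF0 t ht)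
  have hr : ∫⁻ t in Ioi (0 : ℝ), μ {ω | t < T ω} * ENNReal.ofReal (a / (1 + a * t)) =
      ENNReal.ofReal (∫ t in Ioi 0, a / (1 + a * t) * F t) := by
    rw [ofReal_integral_eq_lintegral_ofReal hint hint0]
    refine setLIntegral_congr_fun measurableSet_Ioi fun t ht => ?_
    rw [htail t ht, mul_comm, ENNReal.ofReal_mul]
    have ht : 0 < t := ht
    positivity
  rw [hl, hr] at key
  have hlog0 : 0 ≤ᵐ[μ] fun ω => Real.log (1 + a * T ω) := by
    filter_upwards [hT0] with ω hω
    have : 0 ≤ T ω := hω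
    exact Real.log_nonneg (by nlinarith [mul_nonneg ha.le this])
  have hmeas : AEStronglyMeasurable (fun ω => Real.log (1 + a * T ω)) μ := by
    have : AEMeasurable (fun ω => Real.log (1 + a * T ω)) μ := by fun_prop
    exact this.aestronglyMeasurable
  refine ⟨(lintegral_ofReal_ne_top_iff_integrable hmeas hlog0).1 (by rw [key]; simp), ?_⟩
  rw [integral_eq_lintegral_of_nonneg_ae hlog0 hmeas, key, ENNReal.toReal_ofReal]
  exact integral_nonneg_of_ae hint0

/-- The inequality ln x ≤ x - 1 at x = t and at x = t^{-1/2}. The exponent -1/2 keeps the bound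
integrable at 0, even against the exponential density. -/
lemma abs_log_le {t : ℝ} (ht : 0 < t) : |Real.log t| ≤ t + 2 * t ^ (-(1 / 2) : ℝ) := by
  have h1 : Real.log t ≤ t := (Real.log_le_sub_one_of_pos ht).trans (by linarith)
  have hp : 0 < t ^ (-(1 / 2) : ℝ) := Real.rpow_pos_of_pos ht _
  have h2 := Real.log_le_sub_one_of_pos hp
  rw [Real.log_rpow ht] at h2
  rw [abs_le]
  constructor <;> linarith

lemma integrableOn_erlangDensity_mul_log (n : ℕ) :
    IntegrableOn (fun t => erlangDensity 1 n t * Real.log t) (Ioi 0) := by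
  have hn : (0 : ℝ) ≤ n := Nat.cast_nonneg n
  have h1 := (MellinBarnes.integrableOn_rpow_mul_exp_neg (p := n + 1) (by linarith)).add
    ((MellinBarnes.integrableOn_rpow_mul_exp_neg (p := n - 1 / 2) (by linarith)).const_mul 2)
  refine Integrable.mono' h1 (Measurable.aestronglyMeasurable (by fun_prop)) ?_
  filter_upwards [ae_restrict_mem measurableSet_Ioi] with t ht
  have ht : 0 < t := ht
  have h0 := erlangDensity_nonneg one_pos n ht
  rw [norm_mul, Real.norm_of_nonneg h0, Real.norm_eq_abs]
  have hle : erlangDensity 1 n t ≤ t ^ n * Real.exp (-t) := by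
    have hf : (1 : ℝ) ≤ n.factorial := by exact_mod_cast Nat.factorial_pos n
    simp only [erlangDensity, one_pow, one_mul]
    exact mul_le_mul_of_nonneg_right (div_le_self (by positivity) hf) (Real.exp_pos _).le
  calc _ ≤ (t ^ n * Real.exp (-t)) * (t + 2 * t ^ (-(1 / 2) : ℝ)) :=
        mul_le_mul hle (abs_log_le ht) (abs_nonneg _) (by positivity)
    _ = _ := by
        simp only [Pi.add_apply]
        rw [Real.rpow_add_one ht.ne', sub_eq_add_neg, Real.rpow_add ht, Real.rpow_natCast]
        ring

lemma integrable_log_erlang_one (n : ℕ) : Integrable Real.log (erlang 1 n) :=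
  (integrable_posDensity_iff (by fun_prop) (fun _ hx => erlangDensity_nonneg one_pos n hx) _).2
    (integrableOn_erlangDensity_mul_log n)

lemma integral_erlang (n : ℕ) {μ : ℝ} (hμ : 0 < μ) (f : ℝ → ℝ) :
    ∫ x, f x ∂(erlang μ n) = ∫ x in Ioi 0, erlangDensity μ n x * f x :=
  integral_posDensity (by fun_prop) (fun _ hx => erlangDensity_nonneg hμ n hx) f

lemma integrable_erlang_iff (n : ℕ) {μ : ℝ} (hμ : 0 < μ) (f : ℝ → ℝ) :
    Integrable f (erlang μ n) ↔ IntegrableOn (fun x => erlangDensity μ n x * f x) (Ioi 0) :=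
  integrable_posDensity_iff (by fun_prop) (fun _ hx => erlangDensity_nonneg hμ n hx) f

/-- The digamma function as the mean of the logarithm of an Erlang variable. -/
lemma integral_log_erlang_one (n : ℕ) :
    ∫ x, Real.log x ∂(erlang 1 n) = psi ((n + 1 : ℕ) : ℝ) := by
  have hs : 0 < (((n + 1 : ℕ) : ℂ)).re := by simp; positivity
  -- Γ' is obtained by differentiating Euler's integral, with which Γ agrees near n + 1; dividing by
  -- Γ(n + 1) = n! gives the logarithmic derivative as a mean.
  have hd : HasDerivAt Complex.Gamma (∫ t : ℝ in Ioi 0, (t : ℂ) ^ (((n + 1 : ℕ) : ℂ) - 1) *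
      (Real.log t * Real.exp (-t))) ((n + 1 : ℕ) : ℂ) := by
    refine (Complex.hasDerivAt_GammaIntegral hs).congr_of_eventuallyEq ?_
    filter_upwards [(isOpen_lt continuous_const Complex.continuous_re).mem_nhds hs] with z hz
    exact Complex.Gamma_eq_integral hz
  have hval : (∫ t : ℝ in Ioi 0, (t : ℂ) ^ (((n + 1 : ℕ) : ℂ) - 1) *
      (Real.log t * Real.exp (-t))) =
      ((n.factorial * ∫ t in Ioi 0, erlangDensity 1 n t * Real.log t : ℝ) : ℂ) := by
    rw [← integral_const_mul, ← integral_complex_ofReal]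
    refine setIntegral_congr_fun measurableSet_Ioi fun t ht => ?_
    have e : ((n + 1 : ℕ) : ℂ) - 1 = (n : ℂ) := by push_cast; ring
    have hf : (n.factorial : ℂ) ≠ 0 := by exact_mod_cast n.factorial_ne_zero
    simp only [e, Complex.cpow_natCast, erlangDensity]
    push_cast
    simp
    field_simp
  rw [psi, Complex.ofReal_natCast, Complex.digamma_def, logDeriv_apply, hd.deriv, hval,
    Nat.cast_add, Nat.cast_one, Complex.Gamma_nat_eq_factorial, ← Complex.ofReal_natCast,
    ← Complex.ofReal_div, Complex.ofReal_re, integral_erlang n one_pos]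
  have hf : (n.factorial : ℝ) ≠ 0 := by exact_mod_cast n.factorial_ne_zero
  field_simp

lemma integrable_id_erlang (n : ℕ) : Integrable (fun x => x) (erlang 1 n) := by
  rw [integrable_erlang_iff n one_pos]
  have h := (integrableOn_pow_mul_exp (n + 1) one_pos).const_mul (1 / n.factorial : ℝ)
  refine h.congr (Eventually.of_forall fun x => ?_)
  simp only [erlangDensity]; simp; ring

lemma integrable_log_erlang (n : ℕ) {μ : ℝ} (hμ : 0 < μ) : Integrable Real.log (erlang μ n) := by
  rw [← map_div_erlang hμ, integrable_map_measure (by fun_prop) (by fun_prop)]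
  refine ((integrable_log_erlang_one n).sub (integrable_const (Real.log μ))).congr ?_
  filter_upwards [ae_pos_posDensity (erlangDensity 1 n)] with x hx
  simp [Real.log_div hx.ne' hμ.ne']

lemma integral_log_erlang (n : ℕ) {μ : ℝ} (hμ : 0 < μ) :
    ∫ x, Real.log x ∂(erlang μ n) = psi ((n + 1 : ℕ) : ℝ) - Real.log μ := by
  have h : ∫ x, Real.log (x / μ) ∂(erlang 1 n) =
      ∫ x, (Real.log x - Real.log μ) ∂(erlang 1 n) := by
    refine integral_congr_ae ?_
    filter_upwards [ae_pos_posDensity (erlangDensity 1 n)] with x hx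
    rw [Real.log_div hx.ne' hμ.ne']
  rw [← map_div_erlang hμ, integral_map (by fun_prop) (by fun_prop), h,
    integral_sub (integrable_log_erlang_one n) (integrable_const _), integral_log_erlang_one]
  simp

lemma integrableOn_erlangTail (n : ℕ) : IntegrableOn (erlangTail n) (Ioi 0) := by
  have h : ∀ x, erlangTail n x = ∑ k ∈ Finset.range (n + 1), erlangDensity 1 k x := fun x => by
    simp only [erlangTail, erlangDensity, Finset.mul_sum]
    exact Finset.sum_congr rfl fun k _ => by simp; ring
  simp only [funext h]
  exact integrable_finsetSum _ fun k _ => integrableOn_erlangDensity one_pos k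

lemma residualTail_nonneg {b : ℝ} (hb : 0 < b) (n : ℕ) {x : ℝ} (hx : 0 ≤ x) :
    0 ≤ residualTail b n x := by
  have h1 : erlangDensity 1 n x ≤ erlangTail n x := by
    rw [erlangTail, Finset.sum_range_succ, mul_add, erlangDensity]
    have : 0 ≤ Real.exp (-x) * ∑ k ∈ Finset.range n, x ^ k / k.factorial := by positivity
    simp
    linarith [mul_comm (Real.exp (-x)) (x ^ n / n.factorial)]
  have h2 : b * x / (1 + b * x) ≤ 1 := div_le_one_of_le₀ (by linarith) (by positivity)
  have h3 : 0 ≤ erlangDensity 1 n x := by unfold erlangDensity; positivity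
  unfold residualTail
  nlinarith [mul_le_mul_of_nonneg_left h2 h3]

lemma integrableOn_erlangDensity_mul_of_le {n : ℕ} {f : ℝ → ℝ} (hf : Measurable f) (c : ℝ)
    (h : ∀ x, 0 < x → |f x| ≤ c) : IntegrableOn (fun x => erlangDensity 1 n x * f x) (Ioi 0) := by
  refine Integrable.mul_bdd (c := c) (integrableOn_erlangDensity one_pos n)
    hf.aestronglyMeasurable ?_
  filter_upwards [ae_restrict_mem measurableSet_Ioi] with x hx using h x hx

lemma integrableOn_residualTail {b : ℝ} (hb : 0 < b) (n : ℕ) :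
    IntegrableOn (residualTail b n) (Ioi 0) := by
  refine (integrableOn_erlangTail n).sub
    (integrableOn_erlangDensity_mul_of_le (by fun_prop) 1 fun x hx => ?_)
  rw [abs_of_nonneg (by positivity)]
  exact div_le_one_of_le₀ (by linarith) (by positivity)

lemma integral_log_one_add_erlang (n : ℕ) {a : ℝ} (ha : 0 < a) :
    Integrable (fun x => Real.log (1 + a * x)) (erlang 1 n) ∧
      ∫ x, Real.log (1 + a * x) ∂(erlang 1 n) = ∫ t in Ioi 0, a / (1 + a * t) * erlangTail n t :=
  integral_log_one_add_eq_integral_tail _ aemeasurable_id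
    ((ae_pos_posDensity _).mono fun _ hx => hx.le) (integrableOn_erlangTail n)
    (fun _ ht => erlangTail_nonneg n ht.le) (fun _ ht => erlang_Ioi n ht.le) ha

/-! ### Integrability and logarithmic mean of the residual power -/

section Vector

variable (n : ℕ)

lemma measurePreserving_vecSq :
    MeasurePreserving (vecSq (N := n + 1)) (gaussVec (n + 1)) (erlang 1 n) :=
  ⟨continuous_vecSq.measurable, map_vecSq_gaussVec n⟩

lemma ae_vecSq_pos : ∀ᵐ h ∂(gaussVec (n + 1)), 0 < vecSq h :=
  (measurePreserving_vecSq n).quasiMeasurePreserving.ae (ae_pos_posDensity _)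

lemma integrable_vecSq : Integrable (vecSq (N := n + 1)) (gaussVec (n + 1)) :=
  (measurePreserving_vecSq n).integrable_comp_of_integrable (integrable_id_erlang n)

lemma integrable_log_vecSq : Integrable (fun h => Real.log (vecSq h)) (gaussVec (n + 1)) :=
  (measurePreserving_vecSq n).integrable_comp_of_integrable (integrable_log_erlang_one n)

end Vector

/-- The joint law of the source and interference channels. -/
noncomputable def gaussPair (N : ℕ) : Measure ((Fin N → ℂ) × (Fin N → ℂ)) :=
  (gaussVec N).prod (gaussVec N)

instance (N : ℕ) : IsProbabilityMeasure (gaussPair N) := by unfold gaussPair; infer_instance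

lemma ae_fst_gaussPair {N : ℕ} {p : (Fin N → ℂ) → Prop} (h : ∀ᵐ x ∂(gaussVec N), p x) :
    ∀ᵐ x ∂(gaussPair N), p x.1 := Measure.quasiMeasurePreserving_fst.ae h

lemma ae_residualPower_pos (n : ℕ) {b : ℝ} (hb : 0 < b) :
    ∀ᵐ p ∂(gaussPair (n + 1)), 0 < residualPower b p.1 p.2 := by
  filter_upwards [ae_fst_gaussPair (ae_vecSq_pos n)] with p hp
  have h0 := vecSq_nonneg p.2
  exact lt_of_lt_of_le (by positivity) (le_residualPower hb p.1 p.2)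

lemma integrable_vecSq_fst (n : ℕ) :
    Integrable (fun p => vecSq p.1) (gaussPair (n + 1)) :=
  (integrable_vecSq n).comp_fst _

lemma integrable_vecSq_snd (n : ℕ) :
    Integrable (fun p => vecSq p.2) (gaussPair (n + 1)) :=
  (integrable_vecSq n).comp_snd _

lemma integrable_residualPower (n : ℕ) {b : ℝ} (hb : 0 < b) :
    Integrable (fun p => residualPower b p.1 p.2) (gaussPair (n + 1)) := by
  refine (integrable_vecSq_fst n).mono' (measurable_residualPower b).aestronglyMeasurable ?_
  filter_upwards [ae_residualPower_pos n hb] with p hp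
  rw [Real.norm_of_nonneg hp.le]
  exact residualPower_le hb p.1 p.2

/-- The residual power lies between ‖h₁‖²/(1 + b‖hI‖²) and ‖h₁‖², so its logarithm is controlled by
|ln ‖h₁‖²| and ln(1 + b‖hI‖²) ≤ b‖hI‖². -/
lemma integrable_log_residualPower (n : ℕ) {b : ℝ} (hb : 0 < b) :
    Integrable (fun p => Real.log (residualPower b p.1 p.2)) (gaussPair (n + 1)) := by
  have hl : Integrable (fun p => Real.log (vecSq p.1)) (gaussPair (n + 1)) :=
    (integrable_log_vecSq n).comp_fst _
  refine (hl.norm.add ((integrable_vecSq_snd n).const_mul b)).mono'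
    (Real.measurable_log.comp (measurable_residualPower b)).aestronglyMeasurable ?_
  filter_upwards [ae_fst_gaussPair (ae_vecSq_pos n), ae_residualPower_pos n hb] with p hp hT
  have h0 := vecSq_nonneg p.2
  have hpos : 0 < 1 + b * vecSq p.2 := by positivity
  have h1 := Real.log_le_log (by positivity) (le_residualPower hb p.1 p.2)
  rw [Real.log_div hp.ne' hpos.ne'] at h1
  have h2 := Real.log_le_log hT (residualPower_le hb p.1 p.2)
  have h3 := Real.log_le_sub_one_of_pos hpos
  have h4 : 0 ≤ b * vecSq p.2 := by positivity
  simp only [Pi.add_apply, Real.norm_eq_abs]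
  rw [abs_le]
  constructor
  · linarith [neg_abs_le (Real.log (vecSq p.1))]
  · linarith [le_abs_self (Real.log (vecSq p.1))]

lemma integral_log_one_add_residualPower (n : ℕ) {b : ℝ} (hb : 0 < b) {a : ℝ} (ha : 0 < a) :
    Integrable (fun p => Real.log (1 + a * residualPower b p.1 p.2)) (gaussPair (n + 1)) ∧
      ∫ p, Real.log (1 + a * residualPower b p.1 p.2) ∂(gaussPair (n + 1)) =
        ∫ t in Ioi 0, a / (1 + a * t) * residualTail b n t :=
  integral_log_one_add_eq_integral_tail _ (measurable_residualPower b).aemeasurable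
    ((ae_residualPower_pos n hb).mono fun _ hx => hx.le) (integrableOn_residualTail hb n)
    (fun _ ht => residualTail_nonneg hb n ht.le)
    (fun _ ht => measure_residualPower_gt n hb ht.le) ha

/-- The logarithm is regularized at 0 because the layer cake formula is available for ln(1 + aX)
only. Since the shift is at most 1, |ln X| + X dominates. -/
lemma tendsto_integral_log_add {Ω : Type*} [MeasurableSpace Ω] {μ : Measure Ω} [IsFiniteMeasure μ]
    {X : Ω → ℝ} (hX : Integrable X μ) (hlog : Integrable (fun ω => Real.log (X ω)) μ)
    (hpos : ∀ᵐ ω ∂μ, 0 < X ω) :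
    Tendsto (fun k : ℕ => ∫ ω, Real.log (1 / ((k : ℝ) + 1) + X ω) ∂μ) atTop
      (𝓝 (∫ ω, Real.log (X ω) ∂μ)) := by
  refine tendsto_integral_of_dominated_convergence (fun ω => |Real.log (X ω)| + X ω) ?_
    (hlog.abs.add hX) ?_ ?_
  · intro k
    have : AEMeasurable (fun ω => Real.log (1 / ((k : ℝ) + 1) + X ω)) μ := by
      have := hX.aemeasurable
      fun_prop
    exact this.aestronglyMeasurable
  · intro k
    filter_upwards [hpos] with ω hω
    have hk : 0 < 1 / ((k : ℝ) + 1) := by positivity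
    have hk1 : 1 / ((k : ℝ) + 1) ≤ 1 := by
      rw [div_le_one (by positivity)]
      linarith [Nat.cast_nonneg (α := ℝ) k]
    have h1 := Real.log_le_log hω (by linarith : X ω ≤ 1 / ((k : ℝ) + 1) + X ω)
    have h2 := Real.log_le_sub_one_of_pos (by linarith : 0 < 1 / ((k : ℝ) + 1) + X ω)
    rw [Real.norm_eq_abs, abs_le]
    constructor
    · linarith [neg_abs_le (Real.log (X ω))]
    · linarith [abs_nonneg (Real.log (X ω))]
  · filter_upwards [hpos] with ω hω
    have h1 : Tendsto (fun k : ℕ => 1 / ((k : ℝ) + 1) + X ω) atTop (𝓝 (0 + X ω)) :=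
      tendsto_one_div_add_atTop_nhds_zero_nat.add_const _
    rw [zero_add] at h1
    exact (Real.continuousAt_log hω.ne').tendsto.comp h1

/-- `e^{-t} t^n / n! · b / (1 + b t)`. -/
lemma integrableOn_logCorrection (n : ℕ) {b : ℝ} (hb : 0 < b) :
    IntegrableOn (fun t => erlangDensity 1 n t * (b / (1 + b * t))) (Ioi 0) := by
  refine integrableOn_erlangDensity_mul_of_le (by fun_prop) b fun x hx => ?_
  rw [abs_of_nonneg (by positivity)]
  exact div_le_self hb.le (by nlinarith [mul_pos hb hx])

/-- Compare with an Erlang variable, whose logarithmic mean is the digamma value. After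
regularization the difference of the two means is the layer cake integral of the difference of the
tails, which is the density times bt/(1 + bt). As k → ∞ the weight (k + 1)/(1 + (k + 1)t) increases
to 1/t and cancels the factor t. -/
lemma integral_log_residualPower (n : ℕ) {b : ℝ} (hb : 0 < b) :
    ∫ p, Real.log (residualPower b p.1 p.2) ∂(gaussPair (n + 1)) =
      psi ((n + 1 : ℕ) : ℝ) - ∫ t in Ioi 0, erlangDensity 1 n t * (b / (1 + b * t)) := by
  have hT := tendsto_integral_log_add (integrable_residualPower n hb)
    (integrable_log_residualPower n hb) (ae_residualPower_pos n hb)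
  have hG := tendsto_integral_log_add (integrable_id_erlang n) (integrable_log_erlang_one n)
    (ae_pos_posDensity _)
  have hdiff : ∀ k : ℕ, (∫ x, Real.log (1 / ((k : ℝ) + 1) + x) ∂(erlang 1 n)) -
      (∫ p, Real.log (1 / ((k : ℝ) + 1) + residualPower b p.1 p.2) ∂(gaussPair (n + 1))) =
      ∫ t in Ioi 0, ((k : ℝ) + 1) / (1 + ((k : ℝ) + 1) * t) *
        (erlangDensity 1 n t * (b * t / (1 + b * t))) := by
    intro k
    have hk : 0 < (k : ℝ) + 1 := by positivity
    obtain ⟨i1, e1⟩ := integral_log_one_add_erlang n hk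
    obtain ⟨i2, e2⟩ := integral_log_one_add_residualPower n hb hk
    -- The diverging constant ln(k + 1) is the same for both variables and drops out of the
    -- difference.
    have hshift : ∀ x, 0 < x → Real.log (1 / ((k : ℝ) + 1) + x) =
        Real.log (1 + ((k : ℝ) + 1) * x) - Real.log ((k : ℝ) + 1) := fun x hx => by
      rw [← Real.log_div (by positivity) hk.ne']
      congr 1
      field_simp
    have f1 : ∫ x, Real.log (1 / ((k : ℝ) + 1) + x) ∂(erlang 1 n) =
        ∫ x, (Real.log (1 + ((k : ℝ) + 1) * x) - Real.log ((k : ℝ) + 1)) ∂(erlang 1 n) :=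
      integral_congr_ae ((ae_pos_posDensity _).mono fun x hx => hshift x hx)
    have f2 : ∫ p, Real.log (1 / ((k : ℝ) + 1) + residualPower b p.1 p.2) ∂(gaussPair (n + 1)) =
        ∫ p, (Real.log (1 + ((k : ℝ) + 1) * residualPower b p.1 p.2) - Real.log ((k : ℝ) + 1))
          ∂(gaussPair (n + 1)) :=
      integral_congr_ae ((ae_residualPower_pos n hb).mono fun p hp => hshift _ hp)
    have hbd : ∀ t : ℝ, 0 < t → ‖((k : ℝ) + 1) / (1 + ((k : ℝ) + 1) * t)‖ ≤ (k : ℝ) + 1 := by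
      intro t ht
      rw [Real.norm_of_nonneg (by positivity)]
      exact div_le_self hk.le (by nlinarith [mul_pos hk ht])
    have hm : ∀ F : ℝ → ℝ, IntegrableOn F (Ioi 0) →
        IntegrableOn (fun t => ((k : ℝ) + 1) / (1 + ((k : ℝ) + 1) * t) * F t) (Ioi 0) := by
      intro F hF
      refine Integrable.bdd_mul (c := (k : ℝ) + 1) hF
        (Measurable.aestronglyMeasurable (by fun_prop)) ?_
      filter_upwards [ae_restrict_mem measurableSet_Ioi] with t ht using hbd t ht
    rw [f1, f2, integral_sub i1 (integrable_const _), integral_sub i2 (integrable_const _), e1, e2,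
      integral_const, integral_const, probReal_univ, probReal_univ, sub_sub_sub_cancel_right,
      ← integral_sub (hm _ (integrableOn_erlangTail n))
        (hm _ (integrableOn_residualTail hb n))]
    refine integral_congr_ae (Eventually.of_forall fun t => ?_)
    simp only [residualTail]
    ring
  have hlim : Tendsto (fun k : ℕ => ∫ t in Ioi 0, ((k : ℝ) + 1) / (1 + ((k : ℝ) + 1) * t) *
        (erlangDensity 1 n t * (b * t / (1 + b * t)))) atTop
      (𝓝 (∫ t in Ioi 0, erlangDensity 1 n t * (b / (1 + b * t)))) := by
    refine tendsto_integral_of_dominated_convergence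
      (fun t => erlangDensity 1 n t * (b / (1 + b * t))) ?_ (integrableOn_logCorrection n hb) ?_ ?_
    · intro k
      exact (Measurable.aestronglyMeasurable (by fun_prop))
    · intro k
      filter_upwards [ae_restrict_mem measurableSet_Ioi] with t ht
      have ht : 0 < t := ht
      have h0 := erlangDensity_nonneg one_pos n ht
      have hk : 0 < (k : ℝ) + 1 := by positivity
      rw [Real.norm_of_nonneg (by positivity)]
      have e : ((k : ℝ) + 1) / (1 + ((k : ℝ) + 1) * t) *
          (erlangDensity 1 n t * (b * t / (1 + b * t))) =
          (((k : ℝ) + 1) * t / (1 + ((k : ℝ) + 1) * t)) *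
            (erlangDensity 1 n t * (b / (1 + b * t))) := by ring
      rw [e]
      refine mul_le_of_le_one_left (by positivity) (div_le_one_of_le₀ (by linarith) (by positivity))
    · filter_upwards [ae_restrict_mem measurableSet_Ioi] with t ht
      have ht : 0 < t := ht
      have e : ∀ k : ℕ, ((k : ℝ) + 1) / (1 + ((k : ℝ) + 1) * t) *
          (erlangDensity 1 n t * (b * t / (1 + b * t))) =
          (t / (1 / ((k : ℝ) + 1) + t)) * (erlangDensity 1 n t * (b / (1 + b * t))) := fun k => by
        field_simp
      simp only [e]
      have h1 : Tendsto (fun k : ℕ => t / (1 / ((k : ℝ) + 1) + t)) atTop (𝓝 (t / (0 + t))) :=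
        tendsto_const_nhds.div (tendsto_one_div_add_atTop_nhds_zero_nat.add_const _)
          (by rw [zero_add]; exact ht.ne')
      rw [zero_add, div_self ht.ne'] at h1
      simpa using h1.mul_const (erlangDensity 1 n t * (b / (1 + b * t)))
  have hfin := tendsto_nhds_unique ((hG.sub hT).congr hdiff) hlim
  rw [integral_log_erlang_one] at hfin
  linarith

/-- The incomplete gamma function as a Stieltjes transform of an Erlang density. -/
lemma integral_erlangDensity_div_add (k : ℕ) {c : ℝ} (hc : 0 < c) :
    ∫ t in Ioi 0, erlangDensity 1 k t / (c + t) =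
      c ^ k * Real.exp c * upperGamma (-(k : ℝ)) c := by
  -- Integrate F over x > c, t > 0 in both orders: t first gives k! Γ(-k, c), and x first gives ∫
  -- tᵏe^{-c(1+t)}/(1 + t) dt, which becomes the Stieltjes transform after rescaling t by c.
  set F : ℝ → ℝ → ℝ := fun x t => Real.exp (-x) * (t ^ k * Real.exp (-(x * t))) with hF
  have hinner : ∀ x, 0 < x → ∫ t in Ioi (0 : ℝ), F x t =
      k.factorial * (x ^ (-(k : ℝ) - 1) * Real.exp (-x)) := by
    intro x hx
    simp only [hF]
    rw [integral_const_mul, integral_pow_mul_exp k hx,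
      show -(k : ℝ) - 1 = -((k + 1 : ℕ) : ℝ) by push_cast; ring, Real.rpow_neg hx.le,
      Real.rpow_natCast]
    ring
  have hint : Integrable (Function.uncurry F)
      ((volume.restrict (Ioi c)).prod (volume.restrict (Ioi 0))) := by
    have hmeas : Measurable (Function.uncurry F) := by
      simp only [hF, Function.uncurry_def]; fun_prop
    rw [integrable_prod_iff hmeas.aestronglyMeasurable]
    constructor
    · filter_upwards [ae_restrict_mem measurableSet_Ioi] with x hx
      exact (integrableOn_pow_mul_exp k (hc.trans hx)).const_mul (Real.exp (-x))
    · have h1 : IntegrableOn (fun x => k.factorial / c ^ (k + 1) * Real.exp (-x)) (Ioi c) :=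
        (integrableOn_exp_neg_Ioi c).const_mul _
      refine Integrable.mono' h1 ?_ ?_
      · exact (StronglyMeasurable.integral_prod_right' (f := fun z => ‖Function.uncurry F z‖)
          hmeas.norm.stronglyMeasurable).aestronglyMeasurable
      · filter_upwards [ae_restrict_mem measurableSet_Ioi] with x hx
        have hx0 : 0 < x := hc.trans hx
        have e : ∫ t in Ioi (0 : ℝ), ‖Function.uncurry F (x, t)‖ = ∫ t in Ioi (0 : ℝ), F x t := by
          refine setIntegral_congr_fun measurableSet_Ioi fun t ht => ?_
          have ht : 0 < t := ht
          exact Real.norm_of_nonneg (by simp only [hF, Function.uncurry_apply_pair]; positivity)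
        rw [e]
        have e2 : ∫ t in Ioi (0 : ℝ), F x t =
            k.factorial / x ^ (k + 1) * Real.exp (-x) := by
          simp only [hF]
          rw [integral_const_mul, integral_pow_mul_exp k hx0]
          ring
        rw [e2, Real.norm_of_nonneg (by positivity)]
        have : c ^ (k + 1) ≤ x ^ (k + 1) := pow_le_pow_left₀ hc.le (le_of_lt hx) _
        gcongr
  have hswap := integral_integral_swap hint
  have hl : ∫ x in Ioi c, ∫ t in Ioi (0 : ℝ), F x t = k.factorial * upperGamma (-(k : ℝ)) c := by
    rw [upperGamma, ← integral_const_mul]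
    exact setIntegral_congr_fun measurableSet_Ioi fun x hx => hinner x (hc.trans hx)
  have hr : ∫ t in Ioi (0 : ℝ), ∫ x in Ioi c, F x t =
      ∫ t in Ioi (0 : ℝ), t ^ k * (Real.exp (-c * (1 + t)) / (1 + t)) := by
    refine setIntegral_congr_fun measurableSet_Ioi fun t ht => ?_
    have ht : 0 < t := ht
    have e : ∀ x, F x t = t ^ k * Real.exp (-(1 + t) * x) := fun x => by
      simp only [hF]
      rw [show -(1 + t) * x = -x + -(x * t) by ring, Real.exp_add]; ring
    simp only [e]
    rw [integral_const_mul, integral_exp_mul_Ioi (by linarith)]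
    rw [show -(1 + t) * c = -c * (1 + t) by ring, neg_div_neg_eq]
  have hsc := integral_comp_mul_left_Ioi
    (fun t => t ^ k * Real.exp (-t) / (c + t)) 0 hc
  rw [mul_zero, smul_eq_mul] at hsc
  have hsc2 : ∫ t in Ioi (0 : ℝ), t ^ k * (Real.exp (-c * (1 + t)) / (1 + t)) =
      c * (c ^ k)⁻¹ * Real.exp (-c) *
        ∫ t in Ioi (0 : ℝ), (c * t) ^ k * Real.exp (-(c * t)) / (c + c * t) := by
    rw [← integral_const_mul]
    refine setIntegral_congr_fun measurableSet_Ioi fun t ht => ?_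
    have ht : 0 < t := ht
    rw [show -c * (1 + t) = -c + -(c * t) by ring, Real.exp_add, mul_pow]
    field_simp
  rw [hl, hr, hsc2, hsc] at hswap
  have hfin : ∫ t in Ioi 0, erlangDensity 1 k t / (c + t) =
      1 / k.factorial * ∫ t in Ioi (0 : ℝ), t ^ k * Real.exp (-t) / (c + t) := by
    rw [← integral_const_mul]
    refine integral_congr_ae (Eventually.of_forall fun t => ?_)
    simp only [erlangDensity]; simp; ring
  have hf : (k.factorial : ℝ) ≠ 0 := by exact_mod_cast k.factorial_ne_zero
  have hck : c ^ k ≠ 0 := by positivity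
  rw [hfin]
  generalize ∫ t in Ioi (0 : ℝ), t ^ k * Real.exp (-t) / (c + t) = J at hswap
  rw [Real.exp_neg] at hswap
  have hexp := (Real.exp_pos c).ne'
  field_simp at hswap ⊢
  linarith

/-! ### Partial fractions and convolutions of Erlang densities of different rates -/

/-- The part at the first pole of the partial fraction decomposition of
`(s + μ)⁻⁽ᵐ⁺¹⁾ (s + ν)⁻⁽ⁿ⁺¹⁾`, with `w = (ν - μ)⁻¹` and `f i` in place of `(s + μ)⁻⁽ⁱ⁺¹⁾`. -/
noncomputable def partialFrac (w : ℝ) (f : ℕ → ℝ) (m n : ℕ) : ℝ :=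
  ∑ s ∈ Finset.range (m + 1), (-1) ^ s * ((n + s).choose s : ℝ) * w ^ (n + 1 + s) * f (m - s)

lemma partialFrac_zero_zero (w : ℝ) (f : ℕ → ℝ) : partialFrac w f 0 0 = w * f 0 := by
  simp [partialFrac]

lemma partialFrac_zero_succ (w : ℝ) (f : ℕ → ℝ) (n : ℕ) :
    partialFrac w f 0 (n + 1) = w * partialFrac w f 0 n := by
  simp [partialFrac]; ring

lemma partialFrac_succ_zero (w : ℝ) (f : ℕ → ℝ) (m : ℕ) :
    partialFrac w f (m + 1) 0 = w * (f (m + 1) - partialFrac w f m 0) := by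
  rw [partialFrac, Finset.sum_range_succ', partialFrac, mul_sub, Finset.mul_sum]
  simp only [Nat.zero_add, Nat.choose_self, Nat.add_sub_add_right]
  rw [sub_eq_add_neg, ← Finset.sum_neg_distrib, add_comm]
  congr 1
  · simp
  · refine Finset.sum_congr rfl fun s _ => ?_
    push_cast; ring

/-- Pascal's rule for the binomial coefficients. The recursion reflects 1/((s+μ)(s+ν)) = w(1/(s+μ) -
1/(s+ν)). -/
lemma partialFrac_succ_succ (w : ℝ) (f : ℕ → ℝ) (m n : ℕ) :
    partialFrac w f (m + 1) (n + 1) =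
      w * (partialFrac w f (m + 1) n - partialFrac w f m (n + 1)) := by
  rw [partialFrac, Finset.sum_range_succ', partialFrac, Finset.sum_range_succ' _ (m + 1),
    partialFrac, mul_sub, mul_add, Finset.mul_sum, Finset.mul_sum, add_sub_right_comm, ← Finset.sum_sub_distrib]
  congr 1
  · refine Finset.sum_congr rfl fun s _ => ?_
    rw [Nat.add_sub_add_right, show n + 1 + (s + 1) = (n + 1 + s) + 1 by ring, Nat.choose_succ_succ,
      show n + (s + 1) = n + 1 + s by ring]
    push_cast
    ring
  · simp; ring

/-- The function `u ↦ uⁱ / i! · e^{-μu}`. -/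
noncomputable def expMonomial (μ : ℝ) (i : ℕ) (u : ℝ) : ℝ :=
  u ^ i / i.factorial * Real.exp (-(μ * u))

@[fun_prop] lemma continuous_expMonomial (μ : ℝ) (i : ℕ) : Continuous (expMonomial μ i) := by
  unfold expMonomial; fun_prop

lemma expMonomial_zero_apply_zero (μ : ℝ) : expMonomial μ 0 0 = 1 := by simp [expMonomial]

lemma expMonomial_succ_apply_zero (μ : ℝ) (i : ℕ) : expMonomial μ (i + 1) 0 = 0 := by
  simp [expMonomial]

lemma hasDerivAt_expMonomial_zero (μ u : ℝ) :
    HasDerivAt (expMonomial μ 0) (-μ * expMonomial μ 0 u) u := by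
  have h : HasDerivAt (fun u => Real.exp (-(μ * u))) (Real.exp (-(μ * u)) * -(μ * 1)) u :=
    (((hasDerivAt_id u).const_mul μ).neg).exp
  have e : expMonomial μ 0 = fun u => Real.exp (-(μ * u)) := by ext; simp [expMonomial]
  rw [e]
  convert h using 1
  ring

lemma hasDerivAt_expMonomial_succ (μ : ℝ) (i : ℕ) (u : ℝ) :
    HasDerivAt (expMonomial μ (i + 1)) (expMonomial μ i u - μ * expMonomial μ (i + 1) u) u := by
  have h : HasDerivAt (fun u => Real.exp (-(μ * u))) (Real.exp (-(μ * u)) * -(μ * 1)) u :=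
    (((hasDerivAt_id u).const_mul μ).neg).exp
  have h2 := ((hasDerivAt_pow (i + 1) u).div_const ((i + 1).factorial : ℝ)).mul h
  refine h2.congr_deriv ?_
  have hf : (i.factorial : ℝ) ≠ 0 := by exact_mod_cast i.factorial_ne_zero
  have hi : ((i : ℝ) + 1) ≠ 0 := by positivity
  simp only [expMonomial, Nat.factorial_succ, Nat.cast_mul, Nat.cast_add, Nat.cast_one,
    Nat.add_sub_cancel]
  field_simp
  ring

/-- Convolutions of the functions `uⁱ / i! · e^{-μu}`. -/
noncomputable def expConv (μ ν : ℝ) (m n : ℕ) (u : ℝ) : ℝ :=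
  ∫ y in (0 : ℝ)..u, expMonomial μ m y * expMonomial ν n (u - y)

/-- The integrand is the derivative of the convolution integrand in y. Substituting the differential
equations of the factors produces (ν - μ) times the convolution plus convolutions of lower order,
hence the recursions below. -/
lemma integral_expMonomial_deriv {μ ν u : ℝ} {m n : ℕ} {f' g' : ℝ → ℝ}
    (hf : ∀ y, HasDerivAt (expMonomial μ m) (f' y) y)
    (hg : ∀ y, HasDerivAt (expMonomial ν n) (g' y) y) (hf' : Continuous f') (hg' : Continuous g') :
    ∫ y in (0 : ℝ)..u, (f' y * expMonomial ν n (u - y) - expMonomial μ m y * g' (u - y)) =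
      expMonomial μ m u * expMonomial ν n 0 - expMonomial μ m 0 * expMonomial ν n u := by
  have h : ∀ y, HasDerivAt (fun y => expMonomial μ m y * expMonomial ν n (u - y))
      (f' y * expMonomial ν n (u - y) - expMonomial μ m y * g' (u - y)) y := fun y => by
    have h2 : HasDerivAt (fun y => expMonomial ν n (u - y)) (-g' (u - y)) y := by
      simpa using (hg (u - y)).comp_const_sub u y
    refine ((hf y).mul h2).congr_deriv ?_
    ring
  rw [intervalIntegral.integral_eq_sub_of_hasDerivAt (fun y _ => h y)
    (Continuous.intervalIntegrable (by fun_prop) _ _)]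
  simp

lemma expConv_zero_zero (μ ν u : ℝ) :
    (ν - μ) * expConv μ ν 0 0 u = expMonomial μ 0 u - expMonomial ν 0 u := by
  have h := integral_expMonomial_deriv (u := u) (hasDerivAt_expMonomial_zero μ)
    (hasDerivAt_expMonomial_zero ν) (by fun_prop) (by fun_prop)
  rw [expMonomial_zero_apply_zero, expMonomial_zero_apply_zero, mul_one, one_mul] at h
  rw [← h, expConv, ← intervalIntegral.integral_const_mul]
  congr 1; ext y; ring

lemma expConv_succ_zero (μ ν u : ℝ) (m : ℕ) :
    (ν - μ) * expConv μ ν (m + 1) 0 u = expMonomial μ (m + 1) u - expConv μ ν m 0 u := by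
  have h := integral_expMonomial_deriv (u := u) (hasDerivAt_expMonomial_succ μ m)
    (hasDerivAt_expMonomial_zero ν) (by fun_prop) (by fun_prop)
  rw [expMonomial_zero_apply_zero, expMonomial_succ_apply_zero, mul_one, zero_mul, sub_zero] at h
  rw [← h, expConv, expConv, ← intervalIntegral.integral_const_mul,
    ← intervalIntegral.integral_sub (Continuous.intervalIntegrable (by fun_prop) _ _)
      (Continuous.intervalIntegrable (by fun_prop) _ _)]
  congr 1; ext y; ring

lemma expConv_zero_succ (μ ν u : ℝ) (n : ℕ) :
    (ν - μ) * expConv μ ν 0 (n + 1) u = expConv μ ν 0 n u - expMonomial ν (n + 1) u := by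
  have h := integral_expMonomial_deriv (u := u) (hasDerivAt_expMonomial_zero μ)
    (hasDerivAt_expMonomial_succ ν n) (by fun_prop) (by fun_prop)
  rw [expMonomial_zero_apply_zero, expMonomial_succ_apply_zero, mul_zero, one_mul, zero_sub] at h
  rw [sub_eq_add_neg (expConv μ ν 0 n u), ← h, expConv, expConv, ← intervalIntegral.integral_const_mul,
    ← intervalIntegral.integral_add (Continuous.intervalIntegrable (by fun_prop) _ _)
      (Continuous.intervalIntegrable (by fun_prop) _ _)]
  congr 1; ext y; ring

lemma expConv_succ_succ (μ ν u : ℝ) (m n : ℕ) :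
    (ν - μ) * expConv μ ν (m + 1) (n + 1) u =
      expConv μ ν (m + 1) n u - expConv μ ν m (n + 1) u := by
  have h := integral_expMonomial_deriv (u := u) (hasDerivAt_expMonomial_succ μ m)
    (hasDerivAt_expMonomial_succ ν n) (by fun_prop) (by fun_prop)
  rw [expMonomial_succ_apply_zero, expMonomial_succ_apply_zero, mul_zero, zero_mul, sub_zero] at h
  rw [← sub_eq_zero, ← h, expConv, expConv, expConv, ← intervalIntegral.integral_const_mul,
    ← intervalIntegral.integral_sub (Continuous.intervalIntegrable (by fun_prop) _ _)
      (Continuous.intervalIntegrable (by fun_prop) _ _),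
    ← intervalIntegral.integral_sub (Continuous.intervalIntegrable (by fun_prop) _ _)
      (Continuous.intervalIntegrable (by fun_prop) _ _)]
  congr 1; ext y; ring

/-- Both sides satisfy the same recursion in (m, n) with the same initial values. The second pole
has -w in place of w, which is why the two parts can be treated together. -/
lemma expConv_eq {μ ν : ℝ} (hμν : μ ≠ ν) (u : ℝ) (m n : ℕ) :
    expConv μ ν m n u = partialFrac (ν - μ)⁻¹ (fun i => expMonomial μ i u) m n +
      partialFrac (μ - ν)⁻¹ (fun i => expMonomial ν i u) n m := by
  have hd : ν - μ ≠ 0 := sub_ne_zero.2 hμν.symm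
  have hneg : (μ - ν)⁻¹ = -(ν - μ)⁻¹ := by rw [← neg_sub ν μ, inv_neg]
  have solve : ∀ {x y : ℝ}, (ν - μ) * x = y → x = (ν - μ)⁻¹ * y := fun h => by
    rw [← h, inv_mul_cancel_left₀ hd]
  rw [hneg]
  generalize hw : (ν - μ)⁻¹ = w at solve
  induction m generalizing n with
  | zero =>
    induction n with
    | zero => rw [solve (expConv_zero_zero μ ν u), partialFrac_zero_zero, partialFrac_zero_zero]; ring
    | succ n ih =>
      rw [solve (expConv_zero_succ μ ν u n), ih, partialFrac_zero_succ, partialFrac_succ_zero]; ring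
  | succ m ihm =>
    induction n with
    | zero =>
      rw [solve (expConv_succ_zero μ ν u m), ihm, partialFrac_succ_zero, partialFrac_zero_succ]; ring
    | succ n ih =>
      rw [solve (expConv_succ_succ μ ν u m n), ih, ihm, partialFrac_succ_succ,
        partialFrac_succ_succ (-w)]
      ring

/-! ### The law of the total received power -/

/-- The total received power `‖h₁‖² / μ + ‖hI‖² / ν`. -/
noncomputable def weightedPower {N : ℕ} (μ ν : ℝ) (p : (Fin N → ℂ) × (Fin N → ℂ)) : ℝ :=
  vecSq p.1 / μ + vecSq p.2 / ν

lemma measurable_weightedPower {N : ℕ} (μ ν : ℝ) : Measurable (weightedPower (N := N) μ ν) := by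
  have h := (continuous_vecSq (N := N)).measurable
  unfold weightedPower
  exact ((h.comp measurable_fst).div_const _).add ((h.comp measurable_snd).div_const _)

lemma measurePreserving_vecSq_div (n : ℕ) {μ : ℝ} (hμ : 0 < μ) :
    MeasurePreserving (fun h : Fin (n + 1) → ℂ => vecSq h / μ) (gaussVec (n + 1)) (erlang μ n) := by
  have h : MeasurePreserving (fun x => x / μ) (erlang 1 n) (erlang μ n) :=
    ⟨by fun_prop, map_div_erlang hμ n⟩
  exact h.comp (measurePreserving_vecSq n)

lemma measurePreserving_weightedPower (n : ℕ) {μ ν : ℝ} (hμ : 0 < μ) (hν : 0 < ν) :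
    MeasurePreserving (weightedPower μ ν) (gaussPair (n + 1)) (erlang μ n ∗ erlang ν n) := by
  have := isProbabilityMeasure_erlang hμ n
  have := isProbabilityMeasure_erlang hν n
  have h := (measurePreserving_vecSq_div n hμ).prod (measurePreserving_vecSq_div n hν)
  have hadd : MeasurePreserving (fun x : ℝ × ℝ => x.1 + x.2) ((erlang μ n).prod (erlang ν n))
      (erlang μ n ∗ erlang ν n) := ⟨by fun_prop, rfl⟩
  exact hadd.comp h

/-- The coefficients in the expansion of the convolution of two Erlang densities of different rates
as a combination of Erlang densities. -/
noncomputable def erlangCoeff (μ ν : ℝ) (n s : ℕ) : ℝ :=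
  ν ^ (n + 1) * μ ^ s * ((-1) ^ s * ((n + s).choose s : ℝ)) * (ν - μ)⁻¹ ^ (n + 1 + s)

lemma integral_erlangDensity_mul_erlangDensity {μ ν : ℝ} (hμν : μ ≠ ν) (n : ℕ) (u : ℝ) :
    ∫ y in (0 : ℝ)..u, erlangDensity μ n y * erlangDensity ν n (u - y) =
      ∑ s ∈ Finset.range (n + 1), erlangCoeff μ ν n s * erlangDensity μ (n - s) u +
        ∑ s ∈ Finset.range (n + 1), erlangCoeff ν μ n s * erlangDensity ν (n - s) u := by
  have h : ∀ y, erlangDensity μ n y * erlangDensity ν n (u - y) =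
      μ ^ (n + 1) * ν ^ (n + 1) * (expMonomial μ n y * expMonomial ν n (u - y)) := fun y => by
    simp only [erlangDensity, expMonomial]; ring
  simp only [h]
  rw [intervalIntegral.integral_const_mul, ← expConv, expConv_eq hμν, mul_add]
  congr 1
  all_goals
    rw [partialFrac, Finset.mul_sum]
    refine Finset.sum_congr rfl fun s hs => ?_
    obtain ⟨k, rfl⟩ := Nat.exists_eq_add_of_le' (Nat.lt_succ_iff.1 (Finset.mem_range.1 hs))
    simp only [erlangCoeff, erlangDensity, expMonomial, Nat.add_sub_cancel]
    ring

/-- The coefficients may be negative, so this is not a mixture of laws. The expansion of the density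
is integrated term by term, which requires integrability against every Erlang law involved. -/
lemma integral_conv_erlang {μ ν : ℝ} (hμ : 0 < μ) (hν : 0 < ν) (hμν : μ ≠ ν) (n : ℕ) {f : ℝ → ℝ}
    (hfμ : ∀ i, Integrable f (erlang μ i)) (hfν : ∀ i, Integrable f (erlang ν i)) :
    Integrable f (erlang μ n ∗ erlang ν n) ∧ ∫ u, f u ∂(erlang μ n ∗ erlang ν n) =
      ∑ s ∈ Finset.range (n + 1), erlangCoeff μ ν n s * ∫ u, f u ∂(erlang μ (n - s)) +
        ∑ s ∈ Finset.range (n + 1), erlangCoeff ν μ n s * ∫ u, f u ∂(erlang ν (n - s)) := by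
  have hconv : erlang μ n ∗ erlang ν n = _ := posDensity_conv (continuous_erlangDensity μ n)
    (continuous_erlangDensity ν n) (fun x hx => erlangDensity_nonneg hμ n hx)
    (fun x hx => erlangDensity_nonneg hν n hx)
  have hnn : ∀ u, 0 < u →
      0 ≤ ∫ y in (0 : ℝ)..u, erlangDensity μ n y * erlangDensity ν n (u - y) := fun u hu => by
    refine intervalIntegral.integral_nonneg hu.le fun y hy => ?_
    have h1 := hy.1
    have h2 : 0 ≤ u - y := sub_nonneg.2 hy.2
    unfold erlangDensity
    positivity
  have hmeas : Measurable fun u =>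
      ∫ y in (0 : ℝ)..u, erlangDensity μ n y * erlangDensity ν n (u - y) := by
    simp only [integral_erlangDensity_mul_erlangDensity hμν]
    fun_prop
  have e : ∀ u, (∫ y in (0 : ℝ)..u, erlangDensity μ n y * erlangDensity ν n (u - y)) * f u =
      ∑ s ∈ Finset.range (n + 1), erlangCoeff μ ν n s * (erlangDensity μ (n - s) u * f u) +
        ∑ s ∈ Finset.range (n + 1), erlangCoeff ν μ n s * (erlangDensity ν (n - s) u * f u) :=
    fun u => by
      rw [integral_erlangDensity_mul_erlangDensity hμν, add_mul, Finset.sum_mul, Finset.sum_mul]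
      simp only [mul_assoc]
  have i1 : ∀ s ∈ Finset.range (n + 1), IntegrableOn
      (fun u => erlangCoeff μ ν n s * (erlangDensity μ (n - s) u * f u)) (Ioi 0) := fun s _ =>
    ((integrable_erlang_iff _ hμ f).1 (hfμ (n - s))).const_mul _
  have i2 : ∀ s ∈ Finset.range (n + 1), IntegrableOn
      (fun u => erlangCoeff ν μ n s * (erlangDensity ν (n - s) u * f u)) (Ioi 0) := fun s _ =>
    ((integrable_erlang_iff _ hν f).1 (hfν (n - s))).const_mul _
  rw [hconv, integrable_posDensity_iff hmeas hnn, integral_posDensity hmeas hnn]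
  simp only [e]
  refine ⟨(integrable_finsetSum _ i1).add (integrable_finsetSum _ i2), ?_⟩
  rw [integral_add (integrable_finsetSum _ i1) (integrable_finsetSum _ i2),
    integral_finsetSum _ i1, integral_finsetSum _ i2]
  simp only [integral_const_mul, integral_erlang _ hμ, integral_erlang _ hν]

lemma integrable_id_erlang_of_pos (n : ℕ) {μ : ℝ} (hμ : 0 < μ) :
    Integrable (fun x => x) (erlang μ n) := by
  rw [integrable_erlang_iff n hμ]
  refine ((integrableOn_pow_mul_exp (n + 1) hμ).const_mul (μ ^ (n + 1) / n.factorial)).congr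
    (Eventually.of_forall fun x => ?_)
  simp only [erlangDensity]; ring

lemma integrable_log_one_add_mul_prod {ρ : Measure ℝ} [SFinite ρ] (hρ : Integrable (fun x => x) ρ)
    (hpos : ∀ᵐ x ∂ρ, 0 < x) (n : ℕ) {κ : ℝ} (hκ : 0 < κ) :
    Integrable (fun p : ℝ × ℝ => Real.log (1 + p.1 / κ * p.2)) (ρ.prod (erlang 1 n)) := by
  refine ((hρ.div_const κ).mul_prod (integrable_id_erlang n)).mono'
    (Measurable.aestronglyMeasurable (by fun_prop)) ?_
  filter_upwards [Measure.quasiMeasurePreserving_fst.ae hpos,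
    Measure.quasiMeasurePreserving_snd.ae (ae_pos_posDensity (erlangDensity 1 n))] with p h1 h2
  have h0 : 0 ≤ p.1 / κ * p.2 := by positivity
  rw [Real.norm_of_nonneg (Real.log_nonneg (by linarith))]
  linarith [Real.log_le_sub_one_of_pos (show 0 < 1 + p.1 / κ * p.2 by linarith)]

/-! ### Logarithmic means for the second hop as Meijer functions -/

/-- The mean of `ln (1 + (u / κ) V)` for an Erlang variable `V`. -/
noncomputable def meanLogOneAdd (n : ℕ) (κ u : ℝ) : ℝ :=
  ∫ v, Real.log (1 + u / κ * v) ∂(erlang 1 n)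

lemma integrable_meanLogOneAdd (n i : ℕ) {κ μ : ℝ} (hκ : 0 < κ) (hμ : 0 < μ) :
    Integrable (meanLogOneAdd n κ) (erlang μ i) := by
  have := isProbabilityMeasure_erlang hμ i
  exact (integrable_log_one_add_mul_prod (integrable_id_erlang_of_pos i hμ)
    (ae_pos_posDensity _) n hκ).integral_prod_left

lemma integrableOn_pow_mul_pow_div (m q : ℕ) {z : ℝ} (hz : 0 < z) :
    Integrable (fun w : ℝ × ℝ =>
      w.1 ^ m * w.2 ^ q * Real.exp (-w.1) * Real.exp (-w.2) / (w.1 * w.2 + z))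
      ((volume.restrict (Ioi 0)).prod (volume.restrict (Ioi 0))) := by
  have h := ((integrableOn_pow_mul_exp m one_pos).mul_prod
    (integrableOn_pow_mul_exp q one_pos)).div_const z
  refine h.mono' (Measurable.aestronglyMeasurable (by fun_prop)) ?_
  rw [Measure.prod_restrict]
  filter_upwards [ae_restrict_mem (measurableSet_Ioi.prod measurableSet_Ioi)] with w hw
  have h1 : 0 < w.1 := hw.1
  have h2 : 0 < w.2 := hw.2
  rw [Real.norm_of_nonneg (by positivity), one_mul, one_mul]
  refine div_le_div₀ (by positivity) (le_of_eq (by ring)) hz (by nlinarith [mul_pos h1 h2])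

/-- The layer cake formula with a = u/κ; the sum over m is the finite sum in the Erlang tail. -/
lemma meanLogOneAdd_eq_sum (n : ℕ) {κ u : ℝ} (hκ : 0 < κ) (hu : 0 < u) :
    meanLogOneAdd n κ u = ∑ m ∈ Finset.range (n + 1),
      1 / (m.factorial : ℝ) * ∫ t in Ioi 0, u / (κ + u * t) * (t ^ m * Real.exp (-(1 * t))) := by
  have hi : ∀ m : ℕ,
      IntegrableOn (fun t => u / (κ + u * t) * (t ^ m * Real.exp (-(1 * t)))) (Ioi 0) := by
    intro m
    refine Integrable.bdd_mul (c := u / κ) (integrableOn_pow_mul_exp m one_pos)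
      (Measurable.aestronglyMeasurable (by fun_prop)) ?_
    filter_upwards [ae_restrict_mem measurableSet_Ioi] with t ht
    have ht : 0 < t := ht
    rw [Real.norm_of_nonneg (by positivity)]
    exact div_le_div_of_nonneg_left hu.le hκ (by nlinarith [mul_pos hu ht])
  rw [meanLogOneAdd, (integral_log_one_add_erlang n (div_pos hu hκ)).2]
  simp only [← integral_const_mul]
  rw [← integral_finsetSum _ fun m _ => (hi m).const_mul _]
  refine setIntegral_congr_fun measurableSet_Ioi fun t ht => ?_
  have ht : 0 < t := ht
  have e : u / κ / (1 + u / κ * t) = u / (κ + u * t) := by field_simp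
  simp only [e, erlangTail, Finset.mul_sum]
  refine Finset.sum_congr rfl fun m _ => ?_
  rw [one_mul]
  ring

/-- The numerator u of u/(κ + ut) raises uⁱ to u^{i+1}. With y = μu the double integral is then that
of `meijerG_three_one` with q = i + 1 and z = κμ. -/
lemma integral_meanLogOneAdd (n i : ℕ) {κ μ : ℝ} (hκ : 0 < κ) (hμ : 0 < μ) :
    ∫ u, meanLogOneAdd n κ u ∂(erlang μ i) = ∑ m ∈ Finset.range (n + 1),
      (κ * μ) ^ (i + 1) / (m.factorial * i.factorial : ℝ) *
        (meijerG 3 1 [-((i + 1 : ℕ) : ℝ)] [-((i + 1 : ℕ) : ℝ), m - ((i + 1 : ℕ) : ℝ), 0]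
          (κ * μ)).re := by
  have hz : 0 < κ * μ := mul_pos hκ hμ
  set K : ℕ → ℝ → ℝ := fun m y => ∫ t in Ioi (0 : ℝ),
    t ^ m * y ^ (i + 1) * Real.exp (-t) * Real.exp (-y) / (t * y + κ * μ) with hK
  have hKi : ∀ m, IntegrableOn (K m) (Ioi 0) := fun m =>
    (integrableOn_pow_mul_pow_div m (i + 1) hz).integral_prod_right
  have hKs : ∀ m, IntegrableOn (fun u => K m (μ * u)) (Ioi 0) := fun m => by
    have := (integrableOn_Ioi_comp_mul_left_iff (K m) 0 hμ).2 (by rw [mul_zero]; exact hKi m)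
    exact this
  have hG : ∀ m : ℕ, (meijerG 3 1 [-((i + 1 : ℕ) : ℝ)]
      [-((i + 1 : ℕ) : ℝ), m - ((i + 1 : ℕ) : ℝ), 0] (κ * μ)).re =
      ((κ * μ) ^ (i + 1))⁻¹ * ∫ y in Ioi 0, K m y := fun m => by
    rw [MellinBarnes.meijerG_three_one m (i + 1) i.succ_pos _ _ rfl rfl hz, Complex.ofReal_re,
      Measure.volume_eq_prod, ← Measure.prod_restrict,
      integral_prod_symm _ (integrableOn_pow_mul_pow_div m (i + 1) hz)]
  have hpt : ∀ u, 0 < u → erlangDensity μ i u * meanLogOneAdd n κ u =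
      ∑ m ∈ Finset.range (n + 1), μ / (m.factorial * i.factorial : ℝ) * K m (μ * u) := by
    intro u hu
    rw [meanLogOneAdd_eq_sum n hκ hu, Finset.mul_sum]
    refine Finset.sum_congr rfl fun m _ => ?_
    simp only [hK]
    rw [← integral_const_mul, ← integral_const_mul, ← integral_const_mul]
    refine setIntegral_congr_fun measurableSet_Ioi fun t ht => ?_
    have ht : 0 < t := ht
    have e : t * (μ * u) + κ * μ = μ * (κ + u * t) := by ring
    have hc : 0 < κ + u * t := by positivity
    simp only [e, erlangDensity, one_mul]
    generalize κ + u * t = c at hc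
    field_simp
    ring
  rw [integral_erlang i hμ, setIntegral_congr_fun measurableSet_Ioi fun u hu => hpt u hu,
    integral_finsetSum _ fun m _ => (hKs m).const_mul _]
  refine Finset.sum_congr rfl fun m _ => ?_
  have hs := integral_comp_mul_left_Ioi (K m) 0 hμ
  rw [mul_zero, smul_eq_mul] at hs
  rw [integral_const_mul, hs, hG]
  field_simp

end ErlangLaw

/-! ### Closed forms for the second hop -/

namespace RelayParams

open Set Filter Topology SpecialFun ErlangLaw

/-- For N = n + 1 the factors are -(n + j), j = 1, …, s, so the product is (-1)ˢ(n + s)!/n!. This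
matches the stated coefficients with those of the partial fractions, the index being shifted to
start at 0. -/
lemma coeffProd_div_factorial (n s : ℕ) :
    coeffProd (n + 1) (s + 1) / s.factorial = (-1) ^ s * ((n + s).choose s : ℝ) := by
  have hs : (s.factorial : ℝ) ≠ 0 := by exact_mod_cast s.factorial_ne_zero
  rw [div_eq_iff hs]
  clear hs
  induction s with
  | zero => simp [coeffProd]
  | succ s ih =>
    simp only [coeffProd, Nat.add_sub_cancel] at ih ⊢
    have h : ((n + s + 1 : ℕ) : ℝ) * ((n + s).choose s : ℝ) =
        ((n + (s + 1)).choose (s + 1) : ℝ) * ((s + 1 : ℕ) : ℝ) := by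
      exact_mod_cast Nat.add_one_mul_choose_eq (n + s) s
    rw [Finset.prod_Icc_succ_top (by omega), ih, Nat.factorial_succ]
    push_cast at h ⊢
    linear_combination (-1) ^ s * (s.factorial : ℝ) * (-1) * h

lemma sum_Icc_one_succ (n : ℕ) (F : ℕ → ℝ) :
    ∑ s ∈ Finset.Icc 1 (n + 1), F s = ∑ s ∈ Finset.range (n + 1), F (s + 1) := by
  rw [← Finset.Ico_add_one_right_eq_Icc, Finset.sum_Ico_eq_sum_range]
  simp only [Nat.add_sub_cancel, add_comm 1]

lemma zpow_one_sub_sub (x : ℝ) (n s : ℕ) :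
    x ^ (1 - ((n + 1 : ℕ) : ℤ) - ((s + 1 : ℕ) : ℤ)) = x⁻¹ ^ (n + 1 + s) := by
  rw [show (1 - ((n + 1 : ℕ) : ℤ) - ((s + 1 : ℕ) : ℤ)) = -((n + 1 + s : ℕ) : ℤ) by push_cast; ring,
    zpow_neg, zpow_natCast, inv_pow]

lemma inv_zpow_one_sub (x : ℝ) (s : ℕ) : x⁻¹ ^ (1 - ((s + 1 : ℕ) : ℤ)) = x ^ s := by
  rw [show (1 - ((s + 1 : ℕ) : ℤ)) = -(s : ℤ) by push_cast; ring, zpow_neg, zpow_natCast, inv_pow,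
    inv_inv]

variable (S : RelayParams)

/-- The joint law of all channels. -/
noncomputable def channelLaw (N : ℕ) : Measure (((Fin N → ℂ) × (Fin N → ℂ)) × (Fin N → ℂ)) :=
  (gaussPair N).prod (gaussVec N)

instance (N : ℕ) : IsProbabilityMeasure (channelLaw N) := by unfold channelLaw; infer_instance

/-- `d₁^τ / ρ₁`. -/
noncomputable def srcRate : ℝ := S.D₁ / S.ρ₁

/-- `dI^τ / ρI`. -/
noncomputable def intRate : ℝ := S.DI / S.ρI

/-- `d₂^τ / (ηθ)`. -/
noncomputable def hopRate : ℝ := S.D₂ / (S.η * S.θ)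

lemma srcRate_pos : 0 < S.srcRate := div_pos S.D₁_pos S.ρ₁_pos

lemma intRate_pos : 0 < S.intRate := div_pos S.DI_pos S.ρI_pos

lemma hopRate_pos : 0 < S.hopRate := div_pos S.D₂_pos (mul_pos S.η_pos S.θ_pos)

lemma srcRate_ne_intRate (hρ : S.ρ₁ / S.D₁ ≠ S.ρI / S.DI) : S.srcRate ≠ S.intRate := fun h =>
  hρ (by rw [← inv_div S.D₁, ← inv_div S.DI]; exact congrArg _ h)

lemma γ₂_eq {N : ℕ} (h₁ hI h₂ : Fin N → ℂ) : S.γ₂ h₁ hI h₂ =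
    weightedPower S.srcRate S.intRate (h₁, hI) / S.hopRate * vecSq h₂ := by
  simp only [γ₂, weightedPower, srcRate, intRate, hopRate, div_div_eq_mul_div]
  ring

variable (n : ℕ)

/-- The law of the total received power at the relay. -/
noncomputable def powerLaw : Measure ℝ := erlang S.srcRate n ∗ erlang S.intRate n

lemma measurePreserving_powers :
    MeasurePreserving (Prod.map (weightedPower S.srcRate S.intRate) vecSq) (channelLaw (n + 1))
      ((S.powerLaw n).prod (erlang 1 n)) := by
  have h := measurePreserving_weightedPower n S.srcRate_pos S.intRate_pos
  have : IsProbabilityMeasure (erlang S.srcRate n ∗ erlang S.intRate n) := by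
    rw [← h.map_eq]; exact Measure.isProbabilityMeasure_map h.aemeasurable
  exact h.prod (measurePreserving_vecSq n)

instance : IsProbabilityMeasure (S.powerLaw n) := by
  have h := measurePreserving_weightedPower n S.srcRate_pos S.intRate_pos
  rw [powerLaw, ← h.map_eq]
  exact Measure.isProbabilityMeasure_map h.aemeasurable

lemma ae_weightedPower_pos :
    ∀ᵐ p ∂(gaussPair (n + 1)), 0 < weightedPower S.srcRate S.intRate p := by
  filter_upwards [ae_fst_gaussPair (ae_vecSq_pos n)] with p hp
  have h1 := S.srcRate_pos
  have h2 := S.intRate_pos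
  have h3 := vecSq_nonneg p.2
  unfold weightedPower
  positivity

lemma ae_powerLaw_pos : ∀ᵐ u ∂(S.powerLaw n), 0 < u := by
  have h := measurePreserving_weightedPower n S.srcRate_pos S.intRate_pos
  rw [powerLaw, ← h.map_eq, ae_map_iff h.aemeasurable measurableSet_Ioi]
  exact S.ae_weightedPower_pos n

lemma integrable_id_powerLaw (hρ : S.ρ₁ / S.D₁ ≠ S.ρI / S.DI) :
    Integrable (fun u => u) (S.powerLaw n) :=
  (integral_conv_erlang S.srcRate_pos S.intRate_pos (S.srcRate_ne_intRate hρ) n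
    (fun i => integrable_id_erlang_of_pos i S.srcRate_pos)
    fun i => integrable_id_erlang_of_pos i S.intRate_pos).1

lemma integrable_and_integral_comp {α β : Type*} [MeasurableSpace α] [MeasurableSpace β]
    {ρ : Measure α} {ν : Measure β} {φ : α → β} (h : MeasurePreserving φ ρ ν) {g : β → ℝ}
    (hg : Integrable g ν) :
    Integrable (fun x => g (φ x)) ρ ∧ ∫ x, g (φ x) ∂ρ = ∫ y, g y ∂ν := by
  refine ⟨h.integrable_comp_of_integrable hg, ?_⟩
  rw [← h.map_eq] at hg ⊢
  exact (integral_map h.aemeasurable hg.aestronglyMeasurable).symm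

/-- The `γ₂` of the powers `u`, `v`. -/
lemma γ₂_eq_powers {n : ℕ} (p : ((Fin n → ℂ) × (Fin n → ℂ)) × (Fin n → ℂ)) :
    S.γ₂ p.1.1 p.1.2 p.2 = (Prod.map (weightedPower S.srcRate S.intRate) vecSq p).1 / S.hopRate *
      (Prod.map (weightedPower S.srcRate S.intRate) vecSq p).2 := S.γ₂_eq _ _ _

lemma ae_γ₂_pos : ∀ᵐ p ∂(channelLaw (n + 1)), 0 < S.γ₂ p.1.1 p.1.2 p.2 := by
  filter_upwards [Measure.quasiMeasurePreserving_fst.ae (S.ae_weightedPower_pos n),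
    Measure.quasiMeasurePreserving_snd.ae (ae_vecSq_pos n)] with p h1 h2
  rw [γ₂_eq]
  exact mul_pos (div_pos h1 S.hopRate_pos) h2

lemma logMean_γ₂ (hρ : S.ρ₁ / S.D₁ ≠ S.ρI / S.DI) :
    Integrable (fun p => Real.log (S.γ₂ p.1.1 p.1.2 p.2)) (channelLaw (n + 1)) ∧
      ∫ p, Real.log (S.γ₂ p.1.1 p.1.2 p.2) ∂(channelLaw (n + 1)) = S.logMeanFormula₂ (n + 1) := by
  obtain ⟨i1, e1⟩ := integral_conv_erlang S.srcRate_pos S.intRate_pos (S.srcRate_ne_intRate hρ) n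
    (fun i => integrable_log_erlang i S.srcRate_pos)
    fun i => integrable_log_erlang i S.intRate_pos
  change Integrable _ (S.powerLaw n) at i1
  have i2 := integrable_log_erlang_one n
  have i3 : Integrable (fun w : ℝ × ℝ => Real.log w.1 + Real.log w.2 - Real.log S.hopRate)
      ((S.powerLaw n).prod (erlang 1 n)) :=
    ((i1.comp_fst _).add (i2.comp_snd _)).sub (integrable_const _)
  obtain ⟨i4, e4⟩ := integrable_and_integral_comp (S.measurePreserving_powers n) i3
  have hae : ∀ᵐ p ∂(channelLaw (n + 1)), Real.log (weightedPower S.srcRate S.intRate p.1) +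
      Real.log (vecSq p.2) - Real.log S.hopRate = Real.log (S.γ₂ p.1.1 p.1.2 p.2) := by
    filter_upwards [Measure.quasiMeasurePreserving_fst.ae (S.ae_weightedPower_pos n),
      Measure.quasiMeasurePreserving_snd.ae (ae_vecSq_pos n)] with p h1 h2
    rw [γ₂_eq, Real.log_mul (div_pos h1 S.hopRate_pos).ne' h2.ne',
      Real.log_div h1.ne' S.hopRate_pos.ne']
    ring
  refine ⟨i4.congr hae, ?_⟩
  rw [← integral_congr_ae hae]
  refine e4.trans ?_
  have i5 : Integrable (fun w : ℝ × ℝ => Real.log w.1 + Real.log w.2)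
      ((S.powerLaw n).prod (erlang 1 n)) := (i1.comp_fst _).add (i2.comp_snd _)
  rw [integral_sub i5 (integrable_const _), integral_add (i1.comp_fst _) (i2.comp_snd _), integral_fun_fst, integral_fun_snd,
    integral_const, integral_log_erlang_one]
  simp only [probReal_univ, one_smul]
  rw [powerLaw, e1, logMeanFormula₂, sum_Icc_one_succ, sum_Icc_one_succ, hopRate,
    Real.log_div S.D₂_pos.ne' (mul_pos S.η_pos S.θ_pos).ne', Finset.mul_sum, Finset.mul_sum]
  -- The two sums differ by exchanging source and interferer, so one computation serves both.
  have key : ∀ {D ρ D' ρ' : ℝ}, 0 < D → 0 < ρ → ∀ s ∈ Finset.range (n + 1),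
      D' ^ (n + 1) / ρ' ^ (n + 1) * (coeffProd (n + 1) (s + 1) / ((s + 1 - 1).factorial : ℝ) *
          (D' / ρ' - D / ρ) ^ (1 - ((n + 1 : ℕ) : ℤ) - ((s + 1 : ℕ) : ℤ)) *
          (ρ / D) ^ (1 - ((s + 1 : ℕ) : ℤ)) *
          (psi (((n + 1 : ℕ) : ℝ) - ((s + 1 : ℕ) : ℝ) + 1) + Real.log ρ - Real.log D)) =
        erlangCoeff (D / ρ) (D' / ρ') n s *
          (psi ((n - s + 1 : ℕ) : ℝ) - Real.log (D / ρ)) := by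
    intro D ρ D' ρ' hD hR s hs
    rw [Nat.add_sub_cancel, coeffProd_div_factorial, zpow_one_sub_sub, ← inv_div D,
      inv_zpow_one_sub, Real.log_div hD.ne' hR.ne', erlangCoeff, ← div_pow,
      Nat.cast_add (n - s), Nat.cast_sub (Nat.lt_succ_iff.1 (Finset.mem_range.1 hs))]
    push_cast
    rw [add_sub_add_right_eq_sub]
    ring
  rw [Finset.sum_congr rfl (key S.D₁_pos S.ρ₁_pos), Finset.sum_congr rfl (key S.DI_pos S.ρI_pos)]
  simp only [integral_log_erlang _ S.srcRate_pos, integral_log_erlang _ S.intRate_pos]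
  simp only [srcRate, intRate]
  ring

lemma capacity_γ₂ (hρ : S.ρ₁ / S.D₁ ≠ S.ρI / S.DI) :
    Integrable (fun p => Real.log (1 + S.γ₂ p.1.1 p.1.2 p.2)) (channelLaw (n + 1)) ∧
      ∫ p, Real.log (1 + S.γ₂ p.1.1 p.1.2 p.2) ∂(channelLaw (n + 1)) =
        2 * Real.log 2 * S.capacityFormula₂ (n + 1) := by
  have i1 := integrable_log_one_add_mul_prod (S.integrable_id_powerLaw n hρ) (S.ae_powerLaw_pos n) n
    S.hopRate_pos
  obtain ⟨i2, e2⟩ := integrable_and_integral_comp (S.measurePreserving_powers n) i1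
  simp only [← γ₂_eq_powers] at i2 e2
  refine ⟨i2, ?_⟩
  rw [e2, integral_prod _ i1]
  change ∫ u, meanLogOneAdd n S.hopRate u ∂(S.powerLaw n) = _
  have hlog : Real.log 2 ≠ 0 := (Real.log_pos one_lt_two).ne'
  rw [powerLaw, (integral_conv_erlang S.srcRate_pos S.intRate_pos (S.srcRate_ne_intRate hρ) n
    (fun i => integrable_meanLogOneAdd n i S.hopRate_pos S.srcRate_pos)
    fun i => integrable_meanLogOneAdd n i S.hopRate_pos S.intRate_pos).2, capacityFormula₂,
    sum_Icc_one_succ, sum_Icc_one_succ, mul_add, ← mul_assoc (2 * Real.log 2), ← mul_assoc (2 * Real.log 2), Finset.mul_sum,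
    Finset.mul_sum]
  have key : ∀ {μ ν c : ℝ}, 0 < μ → c = μ ^ (n + 1) * ν ^ (n + 1) → ∀ s ∈ Finset.range (n + 1),
      erlangCoeff μ ν n s * ∫ u, meanLogOneAdd n S.hopRate u ∂(erlang μ (n - s)) =
        c * (coeffProd (n + 1) (s + 1) /
          (((n + 1 - (s + 1)).factorial : ℝ) * ((s + 1 - 1).factorial : ℝ)) *
          (ν - μ) ^ (1 - ((n + 1 : ℕ) : ℤ) - ((s + 1 : ℕ) : ℤ)) *
          ∑ m ∈ Finset.range (n + 1), 1 / (Nat.factorial m : ℝ) *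
            S.hopRate ^ (n + 1 + 1 - (s + 1)) *
            (meijerG 3 1 [((s + 1 : ℕ) : ℝ) - ((n + 1 : ℕ) : ℝ) - 1]
              [((s + 1 : ℕ) : ℝ) - ((n + 1 : ℕ) : ℝ) - 1,
                (m : ℝ) + ((s + 1 : ℕ) : ℝ) - ((n + 1 : ℕ) : ℝ) - 1, 0]
              (S.hopRate * μ)).re) := by
    intro μ ν c hμ hc s hs
    have hsn : s ≤ n := Nat.lt_succ_iff.1 (Finset.mem_range.1 hs)
    have h1 : ((s + 1 : ℕ) : ℝ) - ((n + 1 : ℕ) : ℝ) - 1 = -((n - s + 1 : ℕ) : ℝ) := by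
      rw [Nat.cast_add (n - s), Nat.cast_sub hsn]; push_cast; ring
    have h2 : ∀ m : ℕ, (m : ℝ) + ((s + 1 : ℕ) : ℝ) - ((n + 1 : ℕ) : ℝ) - 1 =
        m - ((n - s + 1 : ℕ) : ℝ) := fun m => by linarith
    rw [integral_meanLogOneAdd n _ S.hopRate_pos hμ, zpow_one_sub_sub, Nat.add_sub_cancel,
      mul_comm ((n + 1 - (s + 1)).factorial : ℝ), ← div_div, coeffProd_div_factorial,
      erlangCoeff, hc, show n + 1 - (s + 1) = n - s by omega,
      show n + 1 + 1 - (s + 1) = n - s + 1 by omega]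
    simp only [h1, h2]
    -- The factor μˢ comes from the Erlang coefficient and μ^{n-s+1} from the power of κμ in front
    -- of the Meijer function.
    have hpow : μ ^ (n + 1) = μ ^ s * μ ^ (n - s + 1) := by rw [← pow_add]; congr 1; omega
    rw [hpow, Finset.mul_sum, Finset.mul_sum, Finset.mul_sum]
    refine Finset.sum_congr rfl fun m _ => ?_
    ring
  have hz₁ : S.D₁ * S.D₂ / (S.η * S.θ * S.ρ₁) = S.hopRate * S.srcRate := by
    rw [hopRate, srcRate, div_mul_div_comm, mul_comm S.D₁]
  have hzI : S.D₂ * S.DI / (S.η * S.θ * S.ρI) = S.hopRate * S.intRate := by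
    rw [hopRate, intRate, div_mul_div_comm]
  have hc : 2 * Real.log 2 * (S.D₁ ^ (n + 1) * S.DI ^ (n + 1) /
      (S.ρ₁ ^ (n + 1) * S.ρI ^ (n + 1) * (2 * Real.log 2))) =
      S.srcRate ^ (n + 1) * S.intRate ^ (n + 1) := by
    have h1 := S.ρ₁_pos
    have h2 := S.ρI_pos
    rw [srcRate, intRate, div_pow, div_pow]
    field_simp
  rw [hz₁, hzI]
  exact congrArg₂ _ (Finset.sum_congr rfl (key S.srcRate_pos hc))
    (Finset.sum_congr rfl (key S.intRate_pos (hc.trans (mul_comm _ _))))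

end RelayParams

/-- Jensen's inequality for the convex function `(x, y) ↦ ln (1 + eˣ + eʸ)`. -/
lemma log_one_add_exp_add_exp_integral_le {Ω : Type*} [MeasurableSpace Ω] {ρ : Measure Ω}
    [IsProbabilityMeasure ρ] {X Y : Ω → ℝ} (hX : Integrable X ρ) (hY : Integrable Y ρ)
    (hXY : Integrable (fun ω => Real.log (1 + Real.exp (X ω) + Real.exp (Y ω))) ρ) :
    Real.log (1 + Real.exp (∫ ω, X ω ∂ρ) + Real.exp (∫ ω, Y ω ∂ρ)) ≤
      ∫ ω, Real.log (1 + Real.exp (X ω) + Real.exp (Y ω)) ∂ρ := by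
  set x := ∫ ω, X ω ∂ρ with hx
  set y := ∫ ω, Y ω ∂ρ with hy
  set Z := 1 + Real.exp x + Real.exp y with hZ
  have hZpos : 0 < Z := by positivity
  set q := Real.exp x / Z with hq
  set r := Real.exp y / Z with hr
  have hp : 1 - q - r = 1 / Z := by rw [hq, hr, hZ]; field_simp; ring
  -- The tangent plane at the point of means, with gradient (q, r); integrating it gives Jensen's
  -- inequality.
  have htan : ∀ u v, Real.log Z + (q * (u - x) + r * (v - y)) ≤
      Real.log (1 + Real.exp u + Real.exp v) := by
    intro u v
    set m := q * (u - x) + r * (v - y) with hm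
    -- The weights 1 - q - r, q, r are nonnegative with sum 1, and -m, u - x - m, v - y - m have
    -- weighted mean 0. Averaging 1 + z ≤ eᶻ at these points gives the bound.
    have hexp : Real.exp m ≤ (1 + Real.exp u + Real.exp v) / Z := by
      have h1 := Real.add_one_le_exp (-m)
      have h2 := Real.add_one_le_exp (u - x - m)
      have h3 := Real.add_one_le_exp (v - y - m)
      have hq0 : 0 ≤ q := by positivity
      have hr0 : 0 ≤ r := by positivity
      have hp0 : 0 ≤ 1 - q - r := by rw [hp]; positivity
      have h4 : 1 ≤ (1 - q - r) * Real.exp (-m) + q * Real.exp (u - x - m) +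
          r * Real.exp (v - y - m) := by
        have := mul_le_mul_of_nonneg_left h1 hp0
        have := mul_le_mul_of_nonneg_left h2 hq0
        have := mul_le_mul_of_nonneg_left h3 hr0
        nlinarith
      have h5 : (1 - q - r) * Real.exp (-m) + q * Real.exp (u - x - m) +
          r * Real.exp (v - y - m) = (1 + Real.exp u + Real.exp v) / Z / Real.exp m := by
        rw [hp, hq, hr, Real.exp_sub, Real.exp_sub, Real.exp_sub, Real.exp_sub, Real.exp_neg]
        field_simp
      rw [h5, one_le_div (Real.exp_pos m)] at h4
      exact h4
    have h := Real.log_le_log (Real.exp_pos m) hexp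
    rw [Real.log_exp, Real.log_div (by positivity) hZpos.ne'] at h
    linarith
  have i1 : Integrable (fun ω => q * (X ω - x)) ρ := (hX.sub (integrable_const x)).const_mul q
  have i2 : Integrable (fun ω => r * (Y ω - y)) ρ := (hY.sub (integrable_const y)).const_mul r
  have i3 : Integrable (fun ω => q * (X ω - x) + r * (Y ω - y)) ρ := i1.add i2
  have h := integral_mono ((integrable_const (Real.log Z)).add i3) hXY fun ω => htan (X ω) (Y ω)
  simp only [Pi.add_apply] at h
  rw [integral_add (integrable_const _) i3, integral_add i1 i2, integral_const_mul,
    integral_const_mul, integral_sub hX (integrable_const x), integral_sub hY (integrable_const y)]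
    at h
  simpa [← hx, ← hy] using h

/-! ### Closed forms for the first hop and the capacity bound -/

namespace RelayParams

open Set Filter Topology SpecialFun ErlangLaw

variable (S : RelayParams) (n : ℕ)

lemma logMean_γ₁ :
    Integrable (fun p => Real.log (S.γ₁ p.1.1 p.1.2)) (channelLaw (n + 1)) ∧
      ∫ p, Real.log (S.γ₁ p.1.1 p.1.2) ∂(channelLaw (n + 1)) = S.logMeanFormula₁ (n + 1) := by
  have hb := S.intSNR_pos
  have i1 := integrable_log_residualPower n hb
  have i2 : Integrable (fun p => Real.log S.srcSNR + Real.log (residualPower S.intSNR p.1 p.2))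
      (gaussPair (n + 1)) := (integrable_const _).add i1
  have hae : ∀ᵐ p ∂(channelLaw (n + 1)), Real.log S.srcSNR +
      Real.log (residualPower S.intSNR p.1.1 p.1.2) = Real.log (S.γ₁ p.1.1 p.1.2) := by
    filter_upwards [Measure.quasiMeasurePreserving_fst.ae (ae_residualPower_pos n hb)] with p hp
    rw [γ₁_eq, Real.log_mul S.srcSNR_pos.ne' hp.ne']
  refine ⟨(i2.comp_fst _).congr hae, ?_⟩
  rw [← integral_congr_ae hae, channelLaw, integral_fun_fst (fun p : (Fin (n + 1) → ℂ) × (Fin (n + 1) → ℂ) =>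
    Real.log S.srcSNR + Real.log (residualPower S.intSNR p.1 p.2)), probReal_univ, one_smul,
    integral_add (integrable_const _) i1, integral_const, probReal_univ, one_smul,
    integral_log_residualPower n hb, logMeanFormula₁, srcSNR,
    Real.log_div (mul_pos S.one_sub_θ_pos S.ρ₁_pos).ne' S.D₁_pos.ne', ← intSNR,
    MellinBarnes.meijerG_one_three n hb, Complex.ofReal_re, ← mul_assoc, Nat.cast_add, Nat.cast_one,
    Real.Gamma_nat_eq_factorial, ← integral_const_mul]
  -- The prefactor of the formula is b²/n!, and the Meijer function supplies b⁻¹; together they give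
  -- the single factor b of the integrand.
  have e : ∀ t, erlangDensity 1 n t * (S.intSNR / (1 + S.intSNR * t)) =
      ((1 - S.θ) * S.ρI) ^ 2 / (S.DI ^ 2 * n.factorial) * S.intSNR⁻¹ *
        (t ^ n * Real.exp (-t) / (1 + S.intSNR * t)) := fun t => by
    have h2 : ((1 - S.θ) * S.ρI) ^ 2 / (S.DI ^ 2 * n.factorial) =
        S.intSNR ^ 2 / n.factorial := by rw [intSNR, div_pow, div_div]
    rw [h2, sq, erlangDensity, one_mul, one_pow, one_mul]
    field_simp
  simp only [e]
  ring

/-- The Erlang tail is a sum of Erlang densities and a/(1 + at) = 1/(a⁻¹ + t), so each term is an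
incomplete gamma value. The correction to the tail gives the integral with two linear denominators,
which is the bivariate Meijer function. -/
lemma integral_residualTail (n : ℕ) {a b : ℝ} (ha : 0 < a) (hb : 0 < b) :
    ∫ t in Ioi 0, a / (1 + a * t) * residualTail b n t =
      ∑ k ∈ Finset.range (n + 1), a⁻¹ ^ k * Real.exp a⁻¹ * upperGamma (-(k : ℝ)) a⁻¹ -
        a * b / n.factorial *
          ∫ t in Ioi 0, t ^ (n + 1) * Real.exp (-t) / ((1 + a * t) * (1 + b * t)) := by
  have hai : 0 < a⁻¹ := inv_pos.2 ha
  have i1 : ∀ k, IntegrableOn (fun t => erlangDensity 1 k t / (a⁻¹ + t)) (Ioi 0) := fun k => by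
    refine integrableOn_erlangDensity_mul_of_le (f := fun t => (a⁻¹ + t)⁻¹) (by fun_prop) a
      fun t ht => ?_
    rw [abs_of_nonneg (by positivity)]
    exact inv_le_of_inv_le₀ ha (by linarith)
  have i2 : IntegrableOn (fun t => a * b / n.factorial *
      (t ^ (n + 1) * Real.exp (-t) / ((1 + a * t) * (1 + b * t)))) (Ioi 0) := by
    refine Integrable.const_mul ?_ _
    refine ((integrableOn_pow_mul_exp (n + 1) one_pos).mono' (Measurable.aestronglyMeasurable
      (by fun_prop)) ?_)
    filter_upwards [ae_restrict_mem measurableSet_Ioi] with t ht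
    have ht : 0 < t := ht
    rw [Real.norm_of_nonneg (by positivity), one_mul]
    refine div_le_self (by positivity) ?_
    nlinarith [mul_pos ha ht, mul_pos hb ht, mul_pos (mul_pos ha ht) (mul_pos hb ht)]
  simp only [← integral_erlangDensity_div_add _ hai]
  rw [← integral_finsetSum _ fun k _ => i1 k, ← integral_const_mul,
    ← integral_sub (integrable_finsetSum _ fun k _ => i1 k) i2]
  refine setIntegral_congr_fun measurableSet_Ioi fun t ht => ?_
  have ht : 0 < t := ht
  have h1 : 0 < 1 + a * t := by positivity
  have h2 : 0 < 1 + b * t := by positivity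
  have e1 : a / (1 + a * t) = (a⁻¹ + t)⁻¹ := by field_simp
  have e2 : ∑ k ∈ Finset.range (n + 1), erlangDensity 1 k t / (a⁻¹ + t) =
      a / (1 + a * t) * erlangTail n t := by
    rw [e1, erlangTail, Finset.mul_sum, Finset.mul_sum]
    refine Finset.sum_congr rfl fun k _ => ?_
    rw [erlangDensity, one_mul, one_pow, one_mul]
    ring
  simp only [e2]
  rw [residualTail, mul_sub, erlangDensity, one_mul, one_pow, one_mul]
  generalize 1 + a * t = A at h1
  generalize 1 + b * t = B at h2
  field_simp
  ring

lemma capacity_γ₁ :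
    Integrable (fun p => Real.log (1 + S.γ₁ p.1.1 p.1.2)) (channelLaw (n + 1)) ∧
      ∫ p, Real.log (1 + S.γ₁ p.1.1 p.1.2) ∂(channelLaw (n + 1)) =
        2 * Real.log 2 * S.capacityFormula₁ (n + 1) := by
  have ha := S.srcSNR_pos
  have hb := S.intSNR_pos
  have hlog : Real.log 2 ≠ 0 := (Real.log_pos one_lt_two).ne'
  obtain ⟨i1, e1⟩ := integral_log_one_add_residualPower n hb ha
  simp only [γ₁_eq]
  refine ⟨i1.comp_fst _, ?_⟩
  have hinv : S.D₁ / ((1 - S.θ) * S.ρ₁) = S.srcSNR⁻¹ := by rw [srcSNR, inv_div]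
  rw [channelLaw, integral_fun_fst (fun p : (Fin (n + 1) → ℂ) × (Fin (n + 1) → ℂ) =>
    Real.log (1 + S.srcSNR * residualPower S.intSNR p.1 p.2)), probReal_univ, one_smul, e1,
    integral_residualTail n ha hb, capacityFormula₁, ← srcSNR, ← intSNR, hinv,
    MellinBarnes.bivariateMeijerG_eq n ha hb, Complex.ofReal_re, Nat.cast_add, Nat.cast_one,
    Real.Gamma_nat_eq_factorial, mul_sub]
  congr 1
  · rw [← mul_assoc, Finset.mul_sum]
    refine Finset.sum_congr rfl fun k _ => ?_
    rw [mul_div_right_comm, ← div_pow, hinv]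
    field_simp
  -- Up to 1/Γ(N) and the logarithm of 2, the prefactor is ab²; one b cancels the b⁻¹ of the Meijer
  -- function.
  · rw [← mul_assoc, ← mul_assoc]
    congr 1
    rw [srcSNR, intSNR]
    have h1 := S.one_sub_θ_pos
    have h2 := S.ρI_pos
    have h3 := S.DI_pos
    have h4 := S.D₁_pos
    generalize 1 - S.θ = x at *
    field_simp

lemma ae_γ₁_pos : ∀ᵐ p ∂(channelLaw (n + 1)), 0 < S.γ₁ p.1.1 p.1.2 := by
  filter_upwards [Measure.quasiMeasurePreserving_fst.ae (ae_residualPower_pos n S.intSNR_pos)]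
    with p hp
  rw [γ₁_eq]
  exact mul_pos S.srcSNR_pos hp

/-- Domination by 1 + γ₁ + γ₂ ≤ (1 + γ₁)(1 + γ₂), whose logarithm splits into two integrable parts.
-/
lemma integrable_log_one_add_γ₁_add_γ₂ (hρ : S.ρ₁ / S.D₁ ≠ S.ρI / S.DI) :
    Integrable (fun p => Real.log (1 + S.γ₁ p.1.1 p.1.2 + S.γ₂ p.1.1 p.1.2 p.2))
      (channelLaw (n + 1)) := by
  have hm1 : Measurable fun p : ((Fin (n + 1) → ℂ) × (Fin (n + 1) → ℂ)) × (Fin (n + 1) → ℂ) =>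
      S.γ₁ p.1.1 p.1.2 := by
    simp only [γ₁_eq]
    exact ((measurable_residualPower S.intSNR).comp measurable_fst).const_mul _
  have hm2 : Measurable fun p : ((Fin (n + 1) → ℂ) × (Fin (n + 1) → ℂ)) × (Fin (n + 1) → ℂ) =>
      S.γ₂ p.1.1 p.1.2 p.2 := by
    simp only [γ₂_eq]
    exact (((measurable_weightedPower _ _).comp measurable_fst).div_const _).mul
      (continuous_vecSq.measurable.comp measurable_snd)
  refine ((S.capacity_γ₁ n).1.add (S.capacity_γ₂ n hρ).1).mono'
    (Real.measurable_log.comp ((hm1.const_add 1).add hm2)).aestronglyMeasurable ?_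
  filter_upwards [S.ae_γ₁_pos n, S.ae_γ₂_pos n] with p h1 h2
  rw [Real.norm_of_nonneg (Real.log_nonneg (by linarith)), Pi.add_apply,
    ← Real.log_mul (by positivity) (by positivity)]
  exact Real.log_le_log (by positivity) (by nlinarith [mul_pos h1 h2])

lemma capacity_γMMSE_le (hρ : S.ρ₁ / S.D₁ ≠ S.ρI / S.DI) :
    Integrable (fun p => Real.log (1 + S.γMMSE p.1.1 p.1.2 p.2)) (channelLaw (n + 1)) ∧
      ∫ p, Real.log (1 + S.γMMSE p.1.1 p.1.2 p.2) ∂(channelLaw (n + 1)) ≤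
        2 * Real.log 2 * S.capacityFormula₁ (n + 1) + 2 * Real.log 2 * S.capacityFormula₂ (n + 1) -
          Real.log (1 + Real.exp (S.logMeanFormula₁ (n + 1)) +
            Real.exp (S.logMeanFormula₂ (n + 1))) := by
  obtain ⟨i1, e1⟩ := S.capacity_γ₁ n
  obtain ⟨i2, e2⟩ := S.capacity_γ₂ n hρ
  obtain ⟨i3, e3⟩ := S.logMean_γ₁ n
  obtain ⟨i4, e4⟩ := S.logMean_γ₂ n hρ
  have i5 := S.integrable_log_one_add_γ₁_add_γ₂ n hρ
  have i6 : Integrable (fun p => Real.log (1 + S.γ₁ p.1.1 p.1.2) +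
      Real.log (1 + S.γ₂ p.1.1 p.1.2 p.2)) (channelLaw (n + 1)) := i1.add i2
  have hexp : (fun p => Real.log (1 + S.γ₁ p.1.1 p.1.2 + S.γ₂ p.1.1 p.1.2 p.2))
      =ᵐ[channelLaw (n + 1)] fun p => Real.log (1 + Real.exp (Real.log (S.γ₁ p.1.1 p.1.2)) +
        Real.exp (Real.log (S.γ₂ p.1.1 p.1.2 p.2))) := by
    filter_upwards [S.ae_γ₁_pos n, S.ae_γ₂_pos n] with p h1 h2
    rw [Real.exp_log h1, Real.exp_log h2]
  have hJ := log_one_add_exp_add_exp_integral_le i3 i4 (i5.congr hexp)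
  rw [e3, e4, ← integral_congr_ae hexp] at hJ
  -- The factorization 1 + γ = (1 + γ₁)(1 + γ₂)/(1 + γ₁ + γ₂) in logarithmic form; only the
  -- subtracted term is estimated, by Jensen's inequality.
  have hae : (fun p => Real.log (1 + S.γ₁ p.1.1 p.1.2) + Real.log (1 + S.γ₂ p.1.1 p.1.2 p.2) -
      Real.log (1 + S.γ₁ p.1.1 p.1.2 + S.γ₂ p.1.1 p.1.2 p.2)) =ᵐ[channelLaw (n + 1)]
      fun p => Real.log (1 + S.γMMSE p.1.1 p.1.2 p.2) := by
    filter_upwards [S.ae_γ₁_pos n, S.ae_γ₂_pos n,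
      Measure.quasiMeasurePreserving_fst.ae (ae_fst_gaussPair (ae_vecSq_pos n)),
      Measure.quasiMeasurePreserving_snd.ae (ae_vecSq_pos n)] with p h1 h2 h3 h4
    rw [γMMSE_eq S _ _ _ h3 h4, ← Real.log_mul (by positivity) (by positivity),
      ← Real.log_div (by positivity) (by positivity)]
    congr 1
    field_simp
    ring
  refine ⟨(i6.sub i5).congr hae, ?_⟩
  rw [← integral_congr_ae hae, integral_sub i6 i5, integral_add i1 i2, e1, e2]
  linarith

end RelayParams

/-! ### Transfer to the given random channels -/

/-- Independent standard complex Gaussian channel entries determine the joint law of the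
channels. -/
lemma hasLaw_channels {Ω : Type*} [MeasurableSpace Ω] {μ : Measure Ω} [IsProbabilityMeasure μ]
    {N : ℕ} {h₁ hI h₂ : Ω → Fin N → ℂ}
    (law₁ : ∀ i, HasLaw (fun ω => h₁ ω i) stdComplexGaussian μ)
    (lawI : ∀ i, HasLaw (fun ω => hI ω i) stdComplexGaussian μ)
    (law₂ : ∀ i, HasLaw (fun ω => h₂ ω i) stdComplexGaussian μ)
    (indep : iIndepFun (fun (k : Fin N ⊕ Fin N ⊕ Fin N) (ω : Ω) =>
      Sum.elim (h₁ ω) (Sum.elim (hI ω) (h₂ ω)) k) μ) :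
    HasLaw (fun ω => ((h₁ ω, hI ω), h₂ ω)) (RelayParams.channelLaw N) μ := by
  have hlaw : ∀ k : Fin N ⊕ Fin N ⊕ Fin N,
      HasLaw (fun ω => Sum.elim (h₁ ω) (Sum.elim (hI ω) (h₂ ω)) k) stdComplexGaussian μ := by
    rintro (i | i | i)
    · exact law₁ i
    · exact lawI i
    · exact law₂ i
  have hae := fun k => (hlaw k).aemeasurable
  have hpi : HasLaw (fun ω k => Sum.elim (h₁ ω) (Sum.elim (hI ω) (h₂ ω)) k)
      (Measure.pi fun _ : Fin N ⊕ Fin N ⊕ Fin N => stdComplexGaussian) μ :=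
    ⟨aemeasurable_pi_lambda _ hae, by
      rw [(iIndepFun_iff_map_fun_eq_pi_map hae).1 indep]
      simp only [(hlaw _).map_eq]⟩
  -- The product over all 3N entries is regrouped, first by splitting the index sum twice and then
  -- by reassociating to ((h₁, hI), h₂).
  have m1 := measurePreserving_sumPiEquivProdPi
    (fun _ : Fin N ⊕ Fin N ⊕ Fin N => stdComplexGaussian)
  have m2 := (MeasurePreserving.id (ErlangLaw.gaussVec N)).prod
    (measurePreserving_sumPiEquivProdPi (fun _ : Fin N ⊕ Fin N => stdComplexGaussian))
  have m3 := MeasurePreserving.symm _ (measurePreserving_prodAssoc (ErlangLaw.gaussVec N)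
    (ErlangLaw.gaussVec N) (ErlangLaw.gaussVec N))
  have m : MeasurePreserving _ _ (RelayParams.channelLaw N) := m3.comp (m2.comp m1)
  exact ⟨m.measurable.comp_aemeasurable hpi.aemeasurable, by
    rw [← m.map_eq, ← hpi.map_eq, AEMeasurable.map_map_of_aemeasurable m.measurable.aemeasurable
      hpi.aemeasurable]
    rfl⟩

/-- Transfer of an expectation to the law of a random variable. -/
lemma ProbabilityTheory.HasLaw.integrable_and_integral_comp {Ω 𝓧 : Type*} [MeasurableSpace Ω]
    [MeasurableSpace 𝓧] {P : Measure Ω} {ν : Measure 𝓧} {X : Ω → 𝓧} (hX : HasLaw X ν P)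
    {f : 𝓧 → ℝ} (hf : Integrable f ν) :
    Integrable (fun ω => f (X ω)) P ∧ ∫ ω, f (X ω) ∂P = ∫ x, f x ∂ν := by
  refine ⟨?_, hX.integral_comp hf.aestronglyMeasurable⟩
  rw [← hX.map_eq] at hf
  exact hf.comp_aemeasurable hX.aemeasurable

theorem theorem12 {Ω : Type*} [MeasurableSpace Ω] (μ : Measure Ω) [IsProbabilityMeasure μ]
    (N : ℕ) (hN : 0 < N) (S : RelayParams)
    (hρ : S.ρ₁ / S.D₁ ≠ S.ρI / S.DI)
    (h₁ hI h₂ : Ω → Fin N → ℂ)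
    (law₁ : ∀ i, HasLaw (fun ω => h₁ ω i) stdComplexGaussian μ)
    (lawI : ∀ i, HasLaw (fun ω => hI ω i) stdComplexGaussian μ)
    (law₂ : ∀ i, HasLaw (fun ω => h₂ ω i) stdComplexGaussian μ)
    (indep : iIndepFun (fun (k : Fin N ⊕ Fin N ⊕ Fin N) (ω : Ω) =>
      Sum.elim (h₁ ω) (Sum.elim (hI ω) (h₂ ω)) k) μ) :
    -- all the expectations involved are finite
    Integrable (fun ω => Real.logb 2 (1 + S.γMMSE (h₁ ω) (hI ω) (h₂ ω))) μ ∧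
    Integrable (fun ω => Real.logb 2 (1 + S.γ₁ (h₁ ω) (hI ω))) μ ∧
    Integrable (fun ω => Real.logb 2 (1 + S.γ₂ (h₁ ω) (hI ω) (h₂ ω))) μ ∧
    Integrable (fun ω => Real.log (S.γ₁ (h₁ ω) (hI ω))) μ ∧
    Integrable (fun ω => Real.log (S.γ₂ (h₁ ω) (hI ω) (h₂ ω))) μ ∧
    -- their closed forms
    ergodicCapacity μ (fun ω => S.γ₁ (h₁ ω) (hI ω)) = S.capacityFormula₁ N ∧
    ergodicCapacity μ (fun ω => S.γ₂ (h₁ ω) (hI ω) (h₂ ω)) = S.capacityFormula₂ N ∧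
    ∫ ω, Real.log (S.γ₁ (h₁ ω) (hI ω)) ∂μ = S.logMeanFormula₁ N ∧
    ∫ ω, Real.log (S.γ₂ (h₁ ω) (hI ω) (h₂ ω)) ∂μ = S.logMeanFormula₂ N ∧
    -- the upper bound
    ergodicCapacity μ (fun ω => S.γMMSE (h₁ ω) (hI ω) (h₂ ω)) ≤
      S.capacityFormula₁ N + S.capacityFormula₂ N -
        1 / 2 * Real.logb 2
          (1 + Real.exp (S.logMeanFormula₁ N) + Real.exp (S.logMeanFormula₂ N)) := by
  have hlaw := hasLaw_channels law₁ lawI law₂ indep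
  -- Erlang laws are indexed by shape minus one, so N antennas correspond to n = N - 1.
  obtain ⟨n, rfl⟩ : ∃ n, N = n + 1 := ⟨N - 1, by omega⟩
  have hlog : 0 < Real.log 2 := Real.log_pos one_lt_two
  obtain ⟨i₁, e₁⟩ := S.capacity_γ₁ n
  obtain ⟨i₂, e₂⟩ := S.capacity_γ₂ n hρ
  obtain ⟨i₃, e₃⟩ := S.logMean_γ₁ n
  obtain ⟨i₄, e₄⟩ := S.logMean_γ₂ n hρ
  obtain ⟨i₅, e₅⟩ := S.capacity_γMMSE_le n hρ
  obtain ⟨j₁, t₁⟩ := hlaw.integrable_and_integral_comp i₁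
  obtain ⟨j₂, t₂⟩ := hlaw.integrable_and_integral_comp i₂
  obtain ⟨j₃, t₃⟩ := hlaw.integrable_and_integral_comp i₃
  obtain ⟨j₄, t₄⟩ := hlaw.integrable_and_integral_comp i₄
  obtain ⟨j₅, t₅⟩ := hlaw.integrable_and_integral_comp i₅
  simp only [ergodicCapacity, Real.logb, integral_div]
  refine ⟨j₅.div_const _, j₁.div_const _, j₂.div_const _, j₃, j₄, ?_, ?_, t₃.trans e₃,
    t₄.trans e₄, ?_⟩
  · rw [t₁, e₁]
    field_simp
  · rw [t₂, e₂]
    field_simp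
  · rw [t₅]
    refine (mul_le_mul_of_nonneg_left (div_le_div_of_nonneg_right e₅ hlog.le)
      (by norm_num)).trans_eq ?_
    field_simp
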